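/- **Lemma (Valise Adinkras and Matrix Factorizations).** Let $\mathbf k$ be $\mathbb R$ or $\mathbb C$, $N\ge 1$, $R=\mathbf k[\lambda_1,\dots,\lambda_N]$ with $\deg\lambda_i=1$, $q_N=\sum_{i}\lambda_i^2$, $I=\langle q_N\rangle$, and $Y_N=\operatorname{Spec}(R/I)$. An *$N$-Adinkra* $A$ is a finite simple graph whose vertices carry a parity $|v|\in\mathbb Z/2$ and a height $h(v)\in\mathbb Z$ and whose edges carry a color $c(e)\in\{1,\dots,N\}$ and a dashing $p(e)\in\mathbb Z/2$, such that adjacent vertices have different parities and heights differing by $1$, every vertex lies on exactly one edge of each color, and for $i\ne j$ the edges of colors $i,j$ form a disjoint union of $4$-cycles on each of which the sum of the dashings is $1$. The source $s(e)$ and the target $t(e)$ of an edge $e$ are its ends of larger and of smaller height. The complex $C^\bullet(A)$ has $C^{-i}(A)$ free over $R$ on the vertices of height $i$, with $d(v)=\sum_{s(e)=v}(-1)^{p(e)}\lambda_{c(e)}\,t(e)$; put $d^\dagger(v)=\sum_{t(e)=v}(-1)^{p(e)}\lambda_{c(e)}\,s(e)$. $A$ is a *valise* if $\max_{v,w}|h(v)-h(w)|=1$;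 up to a shift, its heights are then $0$ and $1$, which we assume. A *linear graded MCM module on $Y_N$* is a finitely generated $\mathbb Z$-graded $R/I$-module $M$ which is zero or has depth equal to $\dim R/I$, has no direct summand isomorphic to $R/I$, and has a graded presentation $(R/I)(-1)^n\to (R/I)^n\to M\to 0$ given by a matrix of linear forms; morphisms are the homomorphisms of degree $0$. Let $C\ell(q_N)$ be the Clifford algebra with generators $e_1,\dots,e_N$, $v^2=q_N(v)$; its $\mathbb Z/2$-graded modules are taken finite-dimensional, with parity-preserving homomorphisms. 1. For every valise $A$, the map $f=\begin{pmatrix}0&d\\ d^\dagger&0\end{pmatrix}$ on $C^0(A)\oplus C^{-1}(A)$ is a linear matrix factorization of $q_N$: it is odd, $f^2=q_N\cdot\mathrm{id}$, and its entries are linear forms. The canonical projection $C^0(A)\to\operatorname{coker}(d)$ induces a quasi-isomorphism $C^\bullet(A)\to\operatorname{coker}(d)$ of complexes of $R$-modules, with $\operatorname{coker}(d)$ in degree $0$. 2. The assignment sending a $\mathbb Z/2$-graded $C\ell(q_N)$-module $W=W_0\oplus W_1$ to the cokernel of $\sum_i\lambda_i\otimes e_i:R\otimes_{\mathbf k}W_1\to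 R\otimes_{\mathbf k}W_0$ (with $W_0$ in degree $0$), and acting on morphisms through $W_0$, is an equivalence from the category of $\mathbb Z/2$-graded $C\ell(q_N)$-modules to the category of linear graded MCM modules on $Y_N$. 3. For every valise $A$, $\operatorname{coker}(d)$ (with the basis of $C^0(A)$ in degree $0$) is a nonzero linear graded MCM module on $Y_N$. Under the equivalence in 2 it corresponds to the Clifford module encoded by $A$, which has the vertices as a basis, the vertex $v$ having parity $h(v)\bmod 2$, and on which $e_i v=(-1)^{p(e)}w$ for every edge $e$ of color $i$ joining $v$ and $w$. 4. If $\mathbf k=\mathbb R$, then every nonzero linear graded MCM module on $Y_N$ is isomorphic to $\operatorname{coker}(d)$ for some valise Adinkra, and every nonzero $\mathbb Z/2$-graded $C\ell(q_N)$-module is isomorphic to the Clifford module encoded by some valise Adinkra. -/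

import Mathlib

open CategoryTheory MvPolynomial
open scoped TensorProduct

universe w

/-! ### The ring `R = 𝕜[λ₁, …, λ_N]`, the quadric `q_N`, and the coordinate ring `R / ⟨q_N⟩` -/

/-- The quadratic polynomial `q_N = ∑ λ_i ^ 2`. -/
noncomputable def qPoly (𝕜 : Type) [Field 𝕜] (N : ℕ) : MvPolynomial (Fin N) 𝕜 :=
  ∑ i, X i ^ 2

/-- The coordinate ring `R / ⟨q_N⟩` of the nilpotence variety `Y_N`. -/
abbrev YRing (𝕜 : Type) [Field 𝕜] (N : ℕ) : Type :=
  MvPolynomial (Fin N) 𝕜 ⧸ Ideal.span {qPoly 𝕜 N}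

/-- The quotient map `R → R / ⟨q_N⟩`. -/
noncomputable abbrev toY (𝕜 : Type) [Field 𝕜] (N : ℕ) : MvPolynomial (Fin N) 𝕜 →+* YRing 𝕜 N :=
  Ideal.Quotient.mk (Ideal.span {qPoly 𝕜 N})

/-- The homogeneous elements of degree `n` in `R / ⟨q_N⟩`: the classes of homogeneous
polynomials of degree `n`. -/
def IsHomogY {𝕜 : Type} [Field 𝕜] {N : ℕ} (n : ℕ) (a : YRing 𝕜 N) : Prop :=
  ∃ r : MvPolynomial (Fin N) 𝕜, r.IsHomogeneous n ∧ toY 𝕜 N r = a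

/-- The irrelevant maximal ideal `⟨λ₁, …, λ_N⟩` of `R / ⟨q_N⟩`. -/
noncomputable def irrelevantY (𝕜 : Type) [Field 𝕜] (N : ℕ) : Ideal (YRing 𝕜 N) :=
  Ideal.span (Set.range fun i : Fin N => toY 𝕜 N (X i))

/-! ### Matrix factorizations -/

/-- The odd endomorphism of `M₀ ⊕ M₁` with off-diagonal blocks `φ : M₁ → M₀` and
`ψ : M₀ → M₁`, that is `(x, y) ↦ (φ y, ψ x)`. -/
def offDiag {R M₀ M₁ : Type*} [CommRing R] [AddCommGroup M₀] [Module R M₀]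
    [AddCommGroup M₁] [Module R M₁] (φ : M₁ →ₗ[R] M₀) (ψ : M₀ →ₗ[R] M₁) :
    (M₀ × M₁) →ₗ[R] (M₀ × M₁) :=
  (φ.comp (LinearMap.snd R M₀ M₁)).prod (ψ.comp (LinearMap.fst R M₀ M₁))

/-- `(M₀ ⊕ M₁, f)` is a matrix factorization of `x`: `f` is odd and `f ∘ f = x • id`. -/
def IsMatrixFactorization {R M₀ M₁ : Type*} [CommRing R] [AddCommGroup M₀] [Module R M₀]
    [AddCommGroup M₁] [Module R M₁] (x : R) (f : (M₀ × M₁) →ₗ[R] (M₀ × M₁)) : Prop :=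
  (∃ (φ : M₁ →ₗ[R] M₀) (ψ : M₀ →ₗ[R] M₁), f = offDiag φ ψ) ∧
    f ∘ₗ f = x • (LinearMap.id : (M₀ × M₁) →ₗ[R] (M₀ × M₁))

/-- An endomorphism of `R^ι ⊕ R^κ` over a polynomial ring is linear if all its matrix entries
are homogeneous of degree one. -/
def IsLinearEnd {σ 𝕜 ι κ : Type*} [CommRing 𝕜] [DecidableEq ι] [DecidableEq κ]
    (f : ((ι → MvPolynomial σ 𝕜) × (κ → MvPolynomial σ 𝕜)) →ₗ[MvPolynomial σ 𝕜]
      ((ι → MvPolynomial σ 𝕜) × (κ → MvPolynomial σ 𝕜))) : Prop :=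
  (∀ i, (∀ i', ((f (Pi.single i 1, 0)).1 i').IsHomogeneous 1) ∧
        (∀ k', ((f (Pi.single i 1, 0)).2 k').IsHomogeneous 1)) ∧
  (∀ k, (∀ i', ((f (0, Pi.single k 1)).1 i').IsHomogeneous 1) ∧
        (∀ k', ((f (0, Pi.single k 1)).2 k').IsHomogeneous 1))

/-! ### Adinkras -/

/-- An `N`-Adinkra on the (finite) vertex set `V`. -/
structure Adinkra (V : Type*) (N : ℕ) where
  graph : SimpleGraph V
  parity : V → ZMod 2
  height : V → ℤ
  color : graph.edgeSet → Fin N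
  dash : graph.edgeSet → ZMod 2
  parity_ne : ∀ v w, graph.Adj v w → parity v ≠ parity w
  height_adj : ∀ v w, graph.Adj v w → |height w - height v| = 1
  /-- Every vertex has exactly one incident edge of each color. -/
  color_regular : ∀ (v : V) (i : Fin N), ∃! e : graph.edgeSet, v ∈ e.1 ∧ color e = i
  /-- For `i ≠ j` the edges of colors `i` and `j` form a disjoint union of 4-cycles with odd
  dashing. By color regularity it is enough to say that every vertex lies on such a cycle. -/
  four_cycle : ∀ (i j : Fin N), i ≠ j → ∀ v₀ : V, ∃ (v₁ v₂ v₃ : V)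
    (h₀ : graph.Adj v₀ v₁) (h₁ : graph.Adj v₁ v₂) (h₂ : graph.Adj v₂ v₃)
    (h₃ : graph.Adj v₃ v₀),
    color ⟨s(v₀, v₁), h₀⟩ = i ∧ color ⟨s(v₁, v₂), h₁⟩ = j ∧
    color ⟨s(v₂, v₃), h₂⟩ = i ∧ color ⟨s(v₃, v₀), h₃⟩ = j ∧
    dash ⟨s(v₀, v₁), h₀⟩ + dash ⟨s(v₁, v₂), h₁⟩ + dash ⟨s(v₂, v₃), h₂⟩ +
      dash ⟨s(v₃, v₀), h₃⟩ = 1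

namespace Adinkra

variable {V : Type*} {N : ℕ}

/-- A valise: the maximum of `|h(v) - h(w)|` over all pairs of vertices is `1`. -/
def IsValise (A : Adinkra V N) : Prop :=
  IsGreatest (Set.range fun p : V × V => |A.height p.1 - A.height p.2|) 1

/-- The vertices are concentrated in heights `0` and `1` (the normalization of valises). -/
def InHeights01 (A : Adinkra V N) : Prop :=
  ∀ v, A.height v = 0 ∨ A.height v = 1

/-- The sign `(-1) ^ p(e)` of an edge. -/
def sign (A : Adinkra V N) (e : A.graph.edgeSet) : ℤˣ := (-1) ^ (A.dash e).val

/-- The vertices indexing the summand of cohomological degree `n`, i.e. those of height `-n`. -/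
abbrev Level (A : Adinkra V N) (n : ℤ) : Type _ := {v : V // A.height v = -n}

/-- The free module `C^n(A)` with basis the vertices of height `-n`. -/
abbrev Cx (A : Adinkra V N) (𝕜 : Type) [Field 𝕜] (n : ℤ) : Type _ :=
  A.Level n → MvPolynomial (Fin N) 𝕜

open Classical in
/-- The coefficient of the vertex `w` in `d v`: it is `(-1) ^ p(e) * λ_{c(e)}` if there is an
edge `e` with source `v` and target `w`, i.e. if `h(v) = h(w) + 1`, and `0` otherwise. -/
noncomputable def coeffD (A : Adinkra V N) (𝕜 : Type) [Field 𝕜] (w v : V) :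
    MvPolynomial (Fin N) 𝕜 :=
  if h : A.graph.Adj v w ∧ A.height v = A.height w + 1 then
    ((A.sign ⟨s(v, w), h.1⟩ : ℤ) : MvPolynomial (Fin N) 𝕜) * X (A.color ⟨s(v, w), h.1⟩)
  else 0

theorem neighbor_unique (A : Adinkra V N) {v w w' : V} (h : A.graph.Adj v w)
    (h' : A.graph.Adj v w')
    (hc : A.color ⟨s(v, w), h⟩ = A.color ⟨s(v, w'), h'⟩) : w = w' := by
  have := (A.color_regular v (A.color ⟨s(v, w), h⟩)).unique
    (y₁ := ⟨s(v, w), h⟩) (y₂ := ⟨s(v, w'), h'⟩) ⟨by simp, rfl⟩ ⟨by simp, hc.symm⟩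
  have h2 : s(v, w) = s(v, w') := congrArg Subtype.val this
  rcases Sym2.eq_iff.1 h2 with ⟨-, h3⟩ | ⟨h3, h4⟩
  · exact h3
  · exact h4.trans h3

theorem edge_swap (A : Adinkra V N) {v w : V} (h : A.graph.Adj v w) :
    (⟨s(v, w), h⟩ : A.graph.edgeSet) = ⟨s(w, v), h.symm⟩ :=
  Subtype.ext Sym2.eq_swap

theorem exists_opposite (A : Adinkra V N) {v w x : V} (h : A.graph.Adj v w)
    (h' : A.graph.Adj w x) (hvx : v ≠ x) :
    ∃ (w' : V) (k : A.graph.Adj v w') (k' : A.graph.Adj w' x), w' ≠ w ∧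
      A.color ⟨s(v, w'), k⟩ = A.color ⟨s(w, x), h'⟩ ∧
      A.color ⟨s(w', x), k'⟩ = A.color ⟨s(v, w), h⟩ ∧
      A.dash ⟨s(v, w), h⟩ + A.dash ⟨s(w, x), h'⟩ + A.dash ⟨s(v, w'), k⟩ +
        A.dash ⟨s(w', x), k'⟩ = 1 := by
  have hne : A.color ⟨s(v, w), h⟩ ≠ A.color ⟨s(w, x), h'⟩ := by
    intro hc
    rw [A.edge_swap h] at hc
    exact hvx (A.neighbor_unique _ _ hc)
  obtain ⟨v₁, v₂, v₃, h₀, h₁, h₂, h₃, c₀, c₁, c₂, c₃, hd⟩ := A.four_cycle _ _ hne v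
  obtain rfl := A.neighbor_unique _ _ c₀
  obtain rfl := A.neighbor_unique _ _ c₁
  refine ⟨v₃, h₃.symm, h₂.symm, ?_, ?_, ?_, ?_⟩
  · rintro rfl
    apply hne
    rw [← c₃, A.edge_swap h₃]
  · rw [← A.edge_swap h₃]; exact c₃
  · rw [← A.edge_swap h₂]; exact c₂
  · rw [← A.edge_swap h₃, ← A.edge_swap h₂, ← hd]; ring

variable [Fintype V]

noncomputable instance (A : Adinkra V N) (n : ℤ) : Fintype (A.Level n) := Fintype.ofFinite _

noncomputable instance (A : Adinkra V N) (n : ℤ) : DecidableEq (A.Level n) :=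
  Classical.decEq _

/-- The matrix of `d : C^m(A) → C^n(A)`; it vanishes unless `n = m + 1`. -/
noncomputable def dMatrix (A : Adinkra V N) (𝕜 : Type) [Field 𝕜] (m n : ℤ) :
    Matrix (A.Level n) (A.Level m) (MvPolynomial (Fin N) 𝕜) :=
  Matrix.of fun w v => A.coeffD 𝕜 w v

/-- The differential `d v = ∑_{s(e) = v} (-1)^{p(e)} λ_{c(e)} t(e)`. -/
noncomputable def d (A : Adinkra V N) (𝕜 : Type) [Field 𝕜] (m n : ℤ) :
    A.Cx 𝕜 m →ₗ[MvPolynomial (Fin N) 𝕜] A.Cx 𝕜 n :=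
  (A.dMatrix 𝕜 m n).mulVecLin

/-- The adjoint `d† w = ∑_{t(e) = w} (-1)^{p(e)} λ_{c(e)} s(e)` of `d : C^m(A) → C^n(A)`. -/
noncomputable def dAdj (A : Adinkra V N) (𝕜 : Type) [Field 𝕜] (m n : ℤ) :
    A.Cx 𝕜 n →ₗ[MvPolynomial (Fin N) 𝕜] A.Cx 𝕜 m :=
  (A.dMatrix 𝕜 m n).transpose.mulVecLin

/-- The coefficients of `d ∘ d` vanish. -/
theorem coeffD_comp (A : Adinkra V N) (𝕜 : Type) [Field 𝕜] (l : ℤ) (x v : V) :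
    ∑ w : A.Level l, A.coeffD 𝕜 x w * A.coeffD 𝕜 w v = 0 := by
  have hsgn : ∀ a b c d : ZMod 2, a + b + c + d = 1 →
      (((-1 : ℤˣ) ^ a.val : ℤˣ) : ℤ) * (((-1 : ℤˣ) ^ b.val : ℤˣ) : ℤ) +
      (((-1 : ℤˣ) ^ c.val : ℤˣ) : ℤ) * (((-1 : ℤˣ) ^ d.val : ℤˣ) : ℤ) = 0 := by decide
  have key : ∀ w : A.Level l, A.coeffD 𝕜 x w * A.coeffD 𝕜 w v ≠ 0 →
      ∃ w' : A.Level l, w' ≠ w ∧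
        A.coeffD 𝕜 x w * A.coeffD 𝕜 w v + A.coeffD 𝕜 x w' * A.coeffD 𝕜 w' v = 0 ∧
        ∃ (h : A.graph.Adj v w) (h' : A.graph.Adj w x) (k : A.graph.Adj v w')
          (k' : A.graph.Adj w' x),
          A.color ⟨s(v, w'), k⟩ = A.color ⟨s(w, x), h'⟩ ∧
          A.color ⟨s(w', x), k'⟩ = A.color ⟨s(v, w), h⟩ := by
    intro w hw
    have hw1 : A.graph.Adj w x ∧ A.height w = A.height x + 1 := by
      by_contra h
      exact hw (by rw [coeffD, dif_neg h, zero_mul])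
    have hw2 : A.graph.Adj v w ∧ A.height v = A.height w + 1 := by
      by_contra h
      exact hw (by rw [coeffD.eq_def _ _ w.1 v, dif_neg h, mul_zero])
    have hvx : v ≠ x := by
      rintro rfl
      have := hw1.2; have := hw2.2; omega
    obtain ⟨w', k, k', hne, hc, hc', hd⟩ := A.exists_opposite hw2.1 hw1.1 hvx
    have hh : A.height w' = A.height w := by
      have e1 := A.height_adj _ _ k
      have e2 := A.height_adj _ _ k'
      have := hw1.2; have := hw2.2
      rcases abs_eq (by norm_num : (0 : ℤ) ≤ 1) |>.1 e1 with e1 | e1 <;>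
      rcases abs_eq (by norm_num : (0 : ℤ) ≤ 1) |>.1 e2 with e2 | e2 <;> omega
    refine ⟨⟨w', hh.trans w.2⟩, fun e => hne (congrArg Subtype.val e), ?_,
      hw2.1, hw1.1, k, k', hc, hc'⟩
    have hk' : A.graph.Adj w' x ∧ A.height w' = A.height x + 1 := ⟨k', hh ▸ hw1.2⟩
    have hk : A.graph.Adj v w' ∧ A.height v = A.height w' + 1 := ⟨k, hh ▸ hw2.2⟩
    have := hsgn _ _ _ _ hd
    rw [coeffD.eq_def _ _ x w.1, coeffD.eq_def _ _ w.1 v, coeffD.eq_def _ _ x w',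
      coeffD.eq_def _ _ w' v, dif_pos hw1, dif_pos hw2, dif_pos hk', dif_pos hk, hc, hc']
    have h3 := congrArg (fun z : ℤ => (z : MvPolynomial (Fin N) 𝕜)) this
    push_cast at h3
    simp only [sign]
    push_cast
    linear_combination
      (X (A.color ⟨s(v, w.1), hw2.1⟩) * X (A.color ⟨s(w.1, x), hw1.1⟩)) * h3
  classical
  choose g hg1 hg2 hg3 using key
  refine Finset.sum_involution (fun w _ => if h : A.coeffD 𝕜 x w * A.coeffD 𝕜 w v ≠ 0
    then g w h else w) ?_ ?_ (fun _ _ => Finset.mem_univ _) ?_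
  · intro w _
    by_cases h : A.coeffD 𝕜 x w * A.coeffD 𝕜 w v = 0
    · simp [h]
    · simp only [ne_eq, h, not_false_eq_true, dite_true]
      exact hg2 w h
  · intro w _ h
    simp only [ne_eq, h, not_false_eq_true, dite_true]
    exact hg1 w h
  · intro w _
    by_cases h : A.coeffD 𝕜 x w * A.coeffD 𝕜 w v = 0
    · simp [h]
    · have h2 : A.coeffD 𝕜 x (g w h) * A.coeffD 𝕜 (g w h) v ≠ 0 := by
        intro h0
        have := hg2 w h
        rw [h0, add_zero] at this
        exact h this
      simp only [ne_eq, h, not_false_eq_true, dite_true, h2]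
      obtain ⟨_, _, _, _, a1, a2⟩ := hg3 w h
      obtain ⟨_, _, _, _, b1, b2⟩ := hg3 (g w h) h2
      exact Subtype.ext (A.neighbor_unique _ _ (b1.trans a2))

theorem d_comp_d (A : Adinkra V N) (𝕜 : Type) [Field 𝕜] (l m n : ℤ) :
    A.d 𝕜 m n ∘ₗ A.d 𝕜 l m = 0 := by
  rw [d, d, ← Matrix.mulVecLin_mul]
  have : A.dMatrix 𝕜 m n * A.dMatrix 𝕜 l m = 0 := by
    ext1 x v
    exact A.coeffD_comp 𝕜 m x v
  rw [this, Matrix.mulVecLin_zero]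

theorem d_shape (A : Adinkra V N) (𝕜 : Type) [Field 𝕜] (m n : ℤ) (h : m + 1 ≠ n) :
    A.d 𝕜 m n = 0 := by
  have : A.dMatrix 𝕜 m n = 0 := by
    ext1 w v
    have hn : ¬ (A.graph.Adj v w ∧ A.height v = A.height w + 1) := by
      rintro ⟨-, h'⟩
      have := v.2; have := w.2; omega
    simp [dMatrix, coeffD, hn]
  rw [d, this, Matrix.mulVecLin_zero]

/-- The complex `C^•(A)` of free `R`-modules associated to the Adinkra. -/
noncomputable def complex (A : Adinkra V N) (𝕜 : Type) [Field 𝕜] :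
    CochainComplex (ModuleCat (MvPolynomial (Fin N) 𝕜)) ℤ where
  X n := ModuleCat.of (MvPolynomial (Fin N) 𝕜) (A.Cx 𝕜 n)
  d m n := ModuleCat.ofHom (A.d 𝕜 m n)
  shape m n h := by rw [A.d_shape 𝕜 m n h]; rfl
  d_comp_d' l m n _ _ := by rw [← ModuleCat.ofHom_comp, A.d_comp_d]; rfl

/-- The cokernel of `d : C^{-1}(A) → C^0(A)`. -/
abbrev coker (A : Adinkra V N) (𝕜 : Type) [Field 𝕜] : Type _ :=
  A.Cx 𝕜 0 ⧸ LinearMap.range (A.d 𝕜 (-1) 0)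

/-- The grading of `coker d`, with the basis vectors of `C^0(A)` in degree `0`: the degree `n`
part is given by the vectors whose entries are homogeneous polynomials of degree `n`, and it
vanishes for `n < 0`. -/
def cokerGrading (A : Adinkra V N) (𝕜 : Type) [Field 𝕜] (n : ℤ) : Set (A.coker 𝕜) :=
  {y | ∃ x : A.Cx 𝕜 0, (∀ v, x v = 0 ∨ ∃ k : ℕ, (k : ℤ) = n ∧ (x v).IsHomogeneous k) ∧
    (LinearMap.range (A.d 𝕜 (-1) 0)).mkQ x = y}

/-- The block map `f` on `C^0(A) ⊕ C^{-1}(A)` with off-diagonal blocks `d` and `d†`. -/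
noncomputable def blockMap (A : Adinkra V N) (𝕜 : Type) [Field 𝕜] :
    (A.Cx 𝕜 0 × A.Cx 𝕜 (-1)) →ₗ[MvPolynomial (Fin N) 𝕜] (A.Cx 𝕜 0 × A.Cx 𝕜 (-1)) :=
  offDiag (A.d 𝕜 (-1) 0) (A.dAdj 𝕜 (-1) 0)

end Adinkra

/-! ### Linear graded maximal Cohen-Macaulay modules on `Y_N` -/

/-- A `ℤ`-grading of a module over the graded ring `R / ⟨q_N⟩`. -/
structure IsGradedY (𝕜 : Type) [Field 𝕜] (N : ℕ) {M : Type*} [AddCommGroup M]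
    [Module (YRing 𝕜 N) M] (gr : ℤ → AddSubgroup M) : Prop where
  isInternal : DirectSum.IsInternal gr
  smul_mem : ∀ (i : ℕ) (j : ℤ) (a : YRing 𝕜 N) (m : M),
    IsHomogY i a → m ∈ gr j → a • m ∈ gr (i + j)

/-- The depth of `M` with respect to an ideal `J`: the supremum of the lengths of `M`-regular
sequences in `J`. -/
noncomputable def depthAt {A : Type*} [CommRing A] (J : Ideal A) (M : Type*) [AddCommGroup M]
    [Module A M] : ℕ∞ :=
  ⨆ rs : {rs : List A // (∀ r ∈ rs, r ∈ J) ∧ RingTheory.Sequence.IsRegular M rs},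
    (rs.1.length : ℕ∞)

/-- `M` is maximal Cohen-Macaulay over the graded ring `R / ⟨q_N⟩`: finitely generated, with
depth equal to the Krull dimension of the ring (the zero module is allowed). -/
def IsMCM (𝕜 : Type) [Field 𝕜] (N : ℕ) (M : Type*) [AddCommGroup M]
    [Module (YRing 𝕜 N) M] : Prop :=
  Module.Finite (YRing 𝕜 N) M ∧
    (Subsingleton M ∨
      (depthAt (irrelevantY 𝕜 N) M : WithBot ℕ∞) = ringKrullDim (YRing 𝕜 N))

/-- No direct summand of `M` is isomorphic to the ring. -/
def NoFreeSummand (A M : Type*) [CommRing A] [AddCommGroup M] [Module A M] : Prop :=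
  ¬ ∃ P Q : Submodule A M, IsCompl P Q ∧ Nonempty (P ≃ₗ[A] A)

/-- `M` has a linear graded free presentation `A(-1)^n → A^n → M → 0`, `A = R / ⟨q_N⟩`. -/
def HasLinearPresentation (𝕜 : Type) [Field 𝕜] (N : ℕ) {M : Type*} [AddCommGroup M]
    [Module (YRing 𝕜 N) M] (gr : ℤ → AddSubgroup M) : Prop :=
  ∃ (n : ℕ) (Φ : Matrix (Fin n) (Fin n) (YRing 𝕜 N))
    (p : (Fin n → YRing 𝕜 N) →ₗ[YRing 𝕜 N] M),
    (∀ i j, IsHomogY 1 (Φ i j)) ∧ (∀ i, p (Pi.single i 1) ∈ gr 0) ∧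
    Function.Surjective p ∧ LinearMap.range Φ.mulVecLin = LinearMap.ker p

/-- The linear graded MCM modules on `Y_N`: graded MCM modules over `R / ⟨q_N⟩` without free
summands which have a linear graded free presentation. -/
structure LinMCM (𝕜 : Type) [Field 𝕜] (N : ℕ) : Type (w + 1) where
  carrier : Type w
  [addCommGroup : AddCommGroup carrier]
  [module : Module (YRing 𝕜 N) carrier]
  gr : ℤ → AddSubgroup carrier
  isGraded : IsGradedY 𝕜 N gr
  isMCM : IsMCM 𝕜 N carrier
  noFree : NoFreeSummand (YRing 𝕜 N) carrier
  linear : HasLinearPresentation 𝕜 N gr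

attribute [instance] LinMCM.addCommGroup LinMCM.module

namespace LinMCM

variable {𝕜 : Type} [Field 𝕜] {N : ℕ}

/-- Morphisms are the module homomorphisms of degree `0`. -/
@[ext]
structure Hom (M M' : LinMCM.{w} 𝕜 N) where
  toLin : M.carrier →ₗ[YRing 𝕜 N] M'.carrier
  map_gr : ∀ i, ∀ m ∈ M.gr i, toLin m ∈ M'.gr i

noncomputable instance : Category (LinMCM.{w} 𝕜 N) where
  Hom M M' := Hom M M'
  id M := ⟨LinearMap.id, fun _ _ h => h⟩
  comp f g := ⟨g.toLin ∘ₗ f.toLin, fun i m h => g.map_gr i _ (f.map_gr i m h)⟩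

end LinMCM

/-! ### `ℤ/2`-graded modules over the Clifford algebra -/

/-- The quadratic form `q_N(x) = ∑ x_i ^ 2` on `𝕜^N`. -/
noncomputable abbrev qForm (𝕜 : Type) [Field 𝕜] (N : ℕ) : QuadraticForm 𝕜 (Fin N → 𝕜) :=
  QuadraticMap.weightedSumSquares 𝕜 (fun _ : Fin N => (1 : 𝕜))

/-- The Clifford algebra `Cl(q_N)`, with `v ^ 2 = q_N(v)`. -/
noncomputable abbrev Cl (𝕜 : Type) [Field 𝕜] (N : ℕ) : Type := CliffordAlgebra (qForm 𝕜 N)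

/-- The generator `e_i` of the Clifford algebra. -/
noncomputable def Cl.gen (𝕜 : Type) [Field 𝕜] (N : ℕ) (i : Fin N) : Cl 𝕜 N :=
  CliffordAlgebra.ι (qForm 𝕜 N) (Pi.single i 1)

/-- Finite-dimensional `ℤ/2`-graded `Cl(q_N)`-modules. -/
structure GrClMod (𝕜 : Type) [Field 𝕜] (N : ℕ) : Type (w + 1) where
  carrier : Type w
  [addCommGroup : AddCommGroup carrier]
  [moduleField : Module 𝕜 carrier]
  [module : Module (Cl 𝕜 N) carrier]
  [tower : IsScalarTower 𝕜 (Cl 𝕜 N) carrier]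
  [finite : Module.Finite 𝕜 carrier]
  gr : ZMod 2 → Submodule 𝕜 carrier
  isInternal : DirectSum.IsInternal gr
  smul_mem : ∀ (i j : ZMod 2) (c : Cl 𝕜 N) (m : carrier),
    c ∈ CliffordAlgebra.evenOdd (qForm 𝕜 N) i → m ∈ gr j → c • m ∈ gr (i + j)

attribute [instance] GrClMod.addCommGroup GrClMod.moduleField GrClMod.module GrClMod.tower
  GrClMod.finite

namespace GrClMod

variable {𝕜 : Type} [Field 𝕜] {N : ℕ}

/-- Morphisms are the module homomorphisms preserving the `ℤ/2`-grading. -/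
@[ext]
structure Hom (W W' : GrClMod.{w} 𝕜 N) where
  toLin : W.carrier →ₗ[Cl 𝕜 N] W'.carrier
  map_gr : ∀ i, ∀ m ∈ W.gr i, toLin m ∈ W'.gr i

noncomputable instance : Category (GrClMod.{w} 𝕜 N) where
  Hom W W' := Hom W W'
  id W := ⟨LinearMap.id, fun _ _ h => h⟩
  comp f g := ⟨g.toLin ∘ₗ f.toLin, fun i m h => g.map_gr i _ (f.map_gr i m h)⟩

/-- The action `W₁ → W₀` of the generator `e_i`. -/
noncomputable def act (W : GrClMod.{w} 𝕜 N) (i : Fin N) : W.gr 1 →ₗ[𝕜] W.gr 0 :=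
  LinearMap.codRestrict (W.gr 0)
    ((Algebra.lsmul 𝕜 𝕜 W.carrier (Cl.gen 𝕜 N i)) ∘ₗ (W.gr 1).subtype)
    (fun m => W.smul_mem 1 1 (Cl.gen 𝕜 N i) m
      (CliffordAlgebra.ι_mem_evenOdd_one (qForm 𝕜 N) _) m.2)

/-- The linear map `φ_W = ∑ λ_i ⊗ e_i : R ⊗ W₁ → R ⊗ W₀`. -/
noncomputable def phi (W : GrClMod.{w} 𝕜 N) :
    (MvPolynomial (Fin N) 𝕜 ⊗[𝕜] W.gr 1) →ₗ[MvPolynomial (Fin N) 𝕜]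
      (MvPolynomial (Fin N) 𝕜 ⊗[𝕜] W.gr 0) :=
  ∑ i, (X i : MvPolynomial (Fin N) 𝕜) •
    LinearMap.baseChange (MvPolynomial (Fin N) 𝕜) (W.act i)

end GrClMod

/-! ### The correspondences -/

/-- `p : R ⊗ W₀ → M` exhibits the graded `R / ⟨q_N⟩`-module `M` as the cokernel of `φ_W`, with
`W₀` placed in degree `0`. -/
structure GrClMod.IsCokernel {𝕜 : Type} [Field 𝕜] {N : ℕ} (W : GrClMod.{w} 𝕜 N)
    (M : LinMCM.{w} 𝕜 N)
    (p : (MvPolynomial (Fin N) 𝕜 ⊗[𝕜] W.gr 0) →ₛₗ[toY 𝕜 N] M.carrier) : Prop where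
  surjective : Function.Surjective p
  ker_eq : LinearMap.ker p = LinearMap.range W.phi
  degree_zero : ∀ x : W.gr 0, p (1 ⊗ₜ x) ∈ M.gr 0

/-- The graded `R / ⟨q_N⟩`-module `M` is isomorphic to `coker d`. -/
def Adinkra.HasCokernel {𝕜 : Type} [Field 𝕜] {N : ℕ} {V : Type*} [Fintype V]
    (A : Adinkra V N) (M : LinMCM.{w} 𝕜 N) : Prop :=
  ∃ e : A.coker 𝕜 →ₛₗ[toY 𝕜 N] M.carrier, Function.Bijective e ∧
    ∀ n, e '' A.cokerGrading 𝕜 n = M.gr n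

/-- `W` is the `ℤ/2`-graded Clifford module encoded by the Adinkra: it has a basis indexed by
the vertices, the parity of a basis vector is the height of the vertex modulo `2`, and `e_i`
interchanges the ends of each edge of color `i`, up to the sign `(-1) ^ p(e)`. -/
def Adinkra.HasCliffordModule {𝕜 : Type} [Field 𝕜] {N : ℕ} {V : Type*}
    (A : Adinkra V N) (W : GrClMod.{w} 𝕜 N) : Prop :=
  ∃ b : Module.Basis V 𝕜 W.carrier,
    (∀ v, b v ∈ W.gr (A.height v : ZMod 2)) ∧
    ∀ (v u : V) (h : A.graph.Adj v u),
      Cl.gen 𝕜 N (A.color ⟨s(v, u), h⟩) • b v = ((A.sign ⟨s(v, u), h⟩ : ℤ) : 𝕜) • b u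

/-! ### Homogeneous components of products -/

/-! A linear matrix factorization of `q_N` is a graded Clifford module in coordinates. If the blocks
are `φ = ∑ λ_i a_i` and `ψ = ∑ λ_i b_i`, then `φψ = ψφ = q_N` says exactly that the odd operators
with blocks `a_i`, `b_i` satisfy the Clifford relations. `linForm_comp` gives one direction,
`linCoeff_mul` and `exists_grClMod_of_factorization` the other.

The properties of `coker φ_W` follow from the factorization. The first `N - 1` variables form a
regular sequence on it (`isSMulRegular_coker_of_factorization`), and `N - 1` is the dimension of `R
/ ⟨q_N⟩`. A functional on the cokernel cannot reach a unit, because `ψ` has no constant terms, so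
there is no free summand (`evalY_eq_zero_of_hom`). The functor is faithful since `W₀` is the degree
`0` part of the cokernel and `W₁ = e₀ W₀`; it is full by comparing the degree `1` parts of the
relations (`exists_hom_of_even`).

Essential surjectivity is the harder part. Lift the linear presentation of `M` to `R`; the kernel
`K` of `R^n → M` is generated by the lifted linear columns and the vectors `q_N e_j`. The depth
lemma gives vanishing of `Ext` from the residue field into `K` below degree `N`, and prime avoidance
among linear forms turns this into a regular sequence of `N` independent linear forms
(`exists_linPoly_isWeaklyRegular`). A graded Nakayama argument then shows that `K` is free on a
subset of the given generators (`exists_linearIndependent_span_eq`). A basis vector `q_N e_j` would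
split a free summand off `M`, so all basis vectors are linear columns, and `q_N R^n ⊆ K` supplies
the other factor.

For an Adinkra, color regularity makes each color a signed permutation of the vertices, and the odd
4-cycles are the anticommutation relations. When all heights are `0` or `1`, `d` and `d†` are the
two blocks of the resulting Clifford module (`Adinkra.exists_bases`); `d†d = q_N` makes `d`
injective, so the complex resolves its cokernel.

Over the reals, adjoin the grading involution to the generators: all are anticommuting involutions.
They generate operators that commute up to sign and square to `±1`, and they preserve an inner
product. A vector whose stabilizer has the smallest common fixed space has an orbit that is
orthogonal up to sign; passing repeatedly to orthogonal complements yields a homogeneous basis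
permuted up to signs (`exists_signed_basis`), and such a basis is the vertex set of a valise. -/

theorem MvPolynomial.homogeneousComponent_mul_of_isHomogeneous {σ K : Type*} [CommSemiring K]
    {a : MvPolynomial σ K} {m : ℕ} (ha : a.IsHomogeneous m) (n : ℕ) (r : MvPolynomial σ K) :
    homogeneousComponent (m + n) (a * r) = a * homogeneousComponent n r := by
  conv_lhs => rw [← sum_homogeneousComponent r, Finset.mul_sum, map_sum]
  rw [Finset.sum_congr rfl fun d _ => homogeneousComponent_of_mem
    (ha.mul (homogeneousComponent_isHomogeneous d r))]
  simp only [add_right_inj, Finset.sum_ite_eq, Finset.mem_range]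
  split_ifs with h
  · rfl
  · rw [homogeneousComponent_eq_zero n r (by omega), mul_zero]

theorem MvPolynomial.homogeneousComponent_mul_of_isHomogeneous_of_lt {σ K : Type*}
    [CommSemiring K] {a : MvPolynomial σ K} {m : ℕ} (ha : a.IsHomogeneous m) {n : ℕ} (hn : n < m)
    (r : MvPolynomial σ K) : homogeneousComponent n (a * r) = 0 := by
  conv_lhs => rw [← sum_homogeneousComponent r, Finset.mul_sum, map_sum]
  refine Finset.sum_eq_zero fun d _ => ?_
  rw [homogeneousComponent_of_mem (ha.mul (homogeneousComponent_isHomogeneous d r)),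
    if_neg (by omega)]

/-! ### Linear forms with operator coefficients -/

section LinForm

variable {𝕜 : Type} [Field 𝕜] {N : ℕ} {V V' V'' : Type*} [AddCommGroup V] [Module 𝕜 V]
  [AddCommGroup V'] [Module 𝕜 V'] [AddCommGroup V''] [Module 𝕜 V'']

/-- The linear map `∑ λ_i ⊗ a_i : R ⊗ V → R ⊗ V'`. -/
noncomputable def linForm (a : Fin N → V →ₗ[𝕜] V') :
    (MvPolynomial (Fin N) 𝕜 ⊗[𝕜] V) →ₗ[MvPolynomial (Fin N) 𝕜] (MvPolynomial (Fin N) 𝕜 ⊗[𝕜] V') :=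
  ∑ i, (X i : MvPolynomial (Fin N) 𝕜) • LinearMap.baseChange (MvPolynomial (Fin N) 𝕜) (a i)

theorem linForm_tmul (a : Fin N → V →ₗ[𝕜] V') (r : MvPolynomial (Fin N) 𝕜) (x : V) :
    linForm a (r ⊗ₜ x) = ∑ i, (X i * r) ⊗ₜ[𝕜] a i x := by
  simp [linForm, LinearMap.sum_apply, TensorProduct.smul_tmul']

theorem linForm_comp [CharZero 𝕜] [DecidableEq (Fin N)] (a : Fin N → V' →ₗ[𝕜] V'')
    (b : Fin N → V →ₗ[𝕜] V') (c : V →ₗ[𝕜] V'')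
    (h : ∀ i j x, a i (b j x) + a j (b i x) = if i = j then (2 : 𝕜) • c x else 0) :
    linForm a ∘ₗ linForm b = qPoly 𝕜 N • LinearMap.baseChange (MvPolynomial (Fin N) 𝕜) c := by
  apply TensorProduct.AlgebraTensorModule.curry_injective
  ext x
  simp only [TensorProduct.AlgebraTensorModule.curry_apply, TensorProduct.curry_apply,
    LinearMap.coe_restrictScalars, LinearMap.comp_apply, LinearMap.smul_apply,
    LinearMap.baseChange_tmul, linForm_tmul, map_sum, mul_one]
  -- The hypothesis concerns only the symmetrized products, so the double sum is doubled and one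
  -- copy has its indices exchanged; the factor `2` is cancelled at the end.
  have hs : (2 : 𝕜) • (∑ i, ∑ j, ((X j * X i : MvPolynomial (Fin N) 𝕜) ⊗ₜ[𝕜] a j (b i x))) =
      (2 : 𝕜) • (qPoly 𝕜 N • ((1 : MvPolynomial (Fin N) 𝕜) ⊗ₜ[𝕜] c x)) := by
    rw [two_smul]
    nth_rewrite 2 [Finset.sum_comm]
    rw [← Finset.sum_add_distrib]
    simp_rw [← Finset.sum_add_distrib]
    calc _ = ∑ i, ∑ j, (X j * X i : MvPolynomial (Fin N) 𝕜) ⊗ₜ[𝕜]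
          (if j = i then (2 : 𝕜) • c x else 0) := by
          refine Finset.sum_congr rfl fun i _ => Finset.sum_congr rfl fun j _ => ?_
          rw [← h j i x, TensorProduct.tmul_add, mul_comm (X i) (X j)]
      _ = _ := by
          simp only [TensorProduct.smul_tmul', smul_eq_mul, mul_one, qPoly,
            TensorProduct.tmul_ite, TensorProduct.sum_tmul, Finset.smul_sum]
          simp [TensorProduct.smul_tmul', pow_two]
  exact smul_right_injective _ (two_ne_zero : (2 : 𝕜) ≠ 0) hs

/-- The homogeneous components on `R ⊗ V`, with `V` in degree `0`. -/
noncomputable def homComp (N : ℕ) (V : Type*) [AddCommGroup V] [Module 𝕜 V] (n : ℕ) :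
    (MvPolynomial (Fin N) 𝕜 ⊗[𝕜] V) →ₗ[𝕜] (MvPolynomial (Fin N) 𝕜 ⊗[𝕜] V) :=
  (homogeneousComponent n).rTensor V

@[simp]
theorem homComp_tmul (n : ℕ) (r : MvPolynomial (Fin N) 𝕜) (x : V) :
    homComp N V n (r ⊗ₜ x) = homogeneousComponent n r ⊗ₜ x := rfl

theorem homComp_homComp (m n : ℕ) (x : MvPolynomial (Fin N) 𝕜 ⊗[𝕜] V) :
    homComp N V m (homComp N V n x) = if m = n then homComp N V n x else 0 := by
  induction x with
  | zero => simp
  | tmul r v =>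
    rw [homComp_tmul, homComp_tmul,
      homogeneousComponent_of_mem (homogeneousComponent_mem n r)]
    split_ifs <;> simp
  | add x y hx hy =>
    rw [map_add, map_add, hx, hy]
    split_ifs <;> simp

theorem exists_sum_homComp (x : MvPolynomial (Fin N) 𝕜 ⊗[𝕜] V) :
    ∃ D, ∀ d, D ≤ d → ∑ n ∈ Finset.range d, homComp N V n x = x := by
  induction x with
  | zero => exact ⟨0, by simp⟩
  | tmul r v =>
    refine ⟨r.totalDegree + 1, fun d hd => ?_⟩
    simp only [homComp_tmul]
    rw [← TensorProduct.sum_tmul]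
    congr 1
    conv_rhs => rw [← sum_homogeneousComponent r]
    refine (Finset.sum_subset (Finset.range_subset_range.2 hd) fun i _ hi => ?_).symm
    exact homogeneousComponent_eq_zero i r (by simpa using hi)
  | add x y hx hy =>
    obtain ⟨D, hD⟩ := hx
    obtain ⟨D', hD'⟩ := hy
    refine ⟨max D D', fun d hd => ?_⟩
    simp_rw [map_add]
    rw [Finset.sum_add_distrib, hD d (by omega), hD' d (by omega)]

theorem homComp_smul {a : MvPolynomial (Fin N) 𝕜} {m : ℕ} (ha : a.IsHomogeneous m) (n : ℕ)
    (x : MvPolynomial (Fin N) 𝕜 ⊗[𝕜] V) :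
    homComp N V (m + n) (a • x) = a • homComp N V n x := by
  induction x with
  | zero => simp
  | tmul r v =>
    simp [TensorProduct.smul_tmul', homogeneousComponent_mul_of_isHomogeneous ha]
  | add x y hx hy => simp only [smul_add, map_add, hx, hy]

theorem homComp_linForm (a : Fin N → V →ₗ[𝕜] V') (n : ℕ) (x : MvPolynomial (Fin N) 𝕜 ⊗[𝕜] V) :
    homComp N V' (n + 1) (linForm a x) = linForm a (homComp N V n x) := by
  induction x with
  | zero => simp
  | tmul r v =>
    simp [linForm_tmul, add_comm n 1,
      homogeneousComponent_mul_of_isHomogeneous (isHomogeneous_X 𝕜 _)]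
  | add x y hx hy => simp only [map_add, hx, hy]

theorem homComp_zero_linForm (a : Fin N → V →ₗ[𝕜] V') (x : MvPolynomial (Fin N) 𝕜 ⊗[𝕜] V) :
    homComp N V' 0 (linForm a x) = 0 := by
  induction x with
  | zero => simp
  | tmul r v =>
    simp only [linForm_tmul, map_sum, homComp_tmul]
    exact Finset.sum_eq_zero fun i _ => by
      rw [homogeneousComponent_mul_of_isHomogeneous_of_lt (isHomogeneous_X 𝕜 i) one_pos,
        TensorProduct.zero_tmul]
  | add x y hx hy => simp only [map_add, hx, hy, add_zero]

theorem exists_homComp_zero_eq (x : MvPolynomial (Fin N) 𝕜 ⊗[𝕜] V) :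
    ∃ v : V, homComp N V 0 x = 1 ⊗ₜ v := by
  induction x with
  | zero => exact ⟨0, by simp⟩
  | tmul r v =>
    refine ⟨coeff 0 r • v, ?_⟩
    rw [homComp_tmul, homogeneousComponent_zero, ← mul_one (C _), ← smul_eq_C_mul,
      TensorProduct.smul_tmul]
  | add x y hx hy =>
    obtain ⟨v, hv⟩ := hx
    obtain ⟨u, hu⟩ := hy
    exact ⟨v + u, by rw [map_add, hv, hu, TensorProduct.tmul_add]⟩

/-- The coefficient of a monomial in an element of `R ⊗ V`. -/
noncomputable def tcoeff (N : ℕ) (V : Type*) [AddCommGroup V] [Module 𝕜 V] (m : Fin N →₀ ℕ) :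
    (MvPolynomial (Fin N) 𝕜 ⊗[𝕜] V) →ₗ[𝕜] V :=
  TensorProduct.lid 𝕜 V ∘ₗ (lcoeff 𝕜 m).rTensor V

@[simp]
theorem tcoeff_tmul (m : Fin N →₀ ℕ) (r : MvPolynomial (Fin N) 𝕜) (x : V) :
    tcoeff N V m (r ⊗ₜ x) = coeff m r • x := by
  simp [tcoeff]

theorem one_tmul_injective (N : ℕ) (V : Type*) [AddCommGroup V] [Module 𝕜 V] :
    Function.Injective fun v : V => (1 : MvPolynomial (Fin N) 𝕜) ⊗ₜ[𝕜] v := fun u v h => by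
  simpa using congrArg (tcoeff N V 0) h

theorem eq_of_sum_X_tmul_eq {u v : Fin N → V}
    (h : ∑ i, (X i : MvPolynomial (Fin N) 𝕜) ⊗ₜ[𝕜] u i = ∑ i, X i ⊗ₜ[𝕜] v i) (i : Fin N) :
    u i = v i := by
  classical
  have := congrArg (tcoeff N V (Finsupp.single i 1)) h
  simpa [coeff_X, Finsupp.single_left_inj] using this

theorem linForm_one_tmul (a : Fin N → V →ₗ[𝕜] V') (x : V) :
    linForm a (1 ⊗ₜ x) = ∑ i, (X i : MvPolynomial (Fin N) 𝕜) ⊗ₜ[𝕜] a i x := by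
  simp [linForm_tmul]

end LinForm

/-! ### Regular sequences on cokernels of matrix factorizations -/

theorem Module.Basis.mem_ideal_smul_top_iff {A F ι : Type*} [CommRing A] [AddCommGroup F]
    [Module A F] [Fintype ι] (b : Module.Basis ι A F) (I : Ideal A) (x : F) :
    x ∈ I • (⊤ : Submodule A F) ↔ ∀ i, b.repr x i ∈ I := by
  constructor
  · intro h i
    refine Submodule.smul_induction_on h (fun r hr n _ => ?_) fun y z hy hz => ?_
    · simpa using I.mul_mem_right _ hr
    · simpa using I.add_mem hy hz
  · intro h
    rw [← b.sum_repr x]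
    exact Submodule.sum_mem _ fun i _ => Submodule.smul_mem_smul (h i) Submodule.mem_top

theorem Module.Basis.mem_smul_top_of_smul_mem {A F ι : Type*} [CommRing A] [AddCommGroup F]
    [Module A F] [Fintype ι] (b : Module.Basis ι A F) {I : Ideal A} {a : A}
    (ha : ∀ r, a * r ∈ I → r ∈ I) {x : F} (hx : a • x ∈ I • (⊤ : Submodule A F)) :
    x ∈ I • (⊤ : Submodule A F) := by
  rw [b.mem_ideal_smul_top_iff] at hx ⊢
  exact fun i => ha _ (by simpa using hx i)

theorem mem_smul_top_of_surjective {A F M : Type*} [CommRing A] [AddCommGroup F]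
    [Module A F] [AddCommGroup M] [Module A M] (π : F →ₗ[A] M) (hπ : Function.Surjective π)
    (I : Ideal A) (u : F) :
    π u ∈ I • (⊤ : Submodule A M) ↔
      ∃ a ∈ I • (⊤ : Submodule A F), ∃ k ∈ LinearMap.ker π, u = a + k := by
  have h : I • (⊤ : Submodule A M) = (I • (⊤ : Submodule A F)).map π := by
    rw [Submodule.map_smul'', Submodule.map_top, LinearMap.range_eq_top.2 hπ]
  rw [h]
  constructor
  · rintro ⟨a, ha, e⟩
    exact ⟨a, ha, u - a, by simp [e], by abel⟩
  · rintro ⟨a, ha, k, hk, rfl⟩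
    exact ⟨a, ha, by simp [LinearMap.mem_ker.1 hk]⟩

/-- Suppose `a u = c + φ v` with `c ∈ I F₀`. Applying `ψ` shows that `q v` vanishes modulo `I +
(a)`, hence so does `v`, say `v = v₁ + a v'` with `v₁ ∈ I F₁`. Then `a (u - φ v')` lies in `I F₀`,
and `a` can be cancelled. Only the composite `ψφ` is needed. -/
theorem isSMulRegular_coker_of_factorization {A F₀ F₁ M ι κ : Type*} [CommRing A]
    [AddCommGroup F₀] [Module A F₀] [AddCommGroup F₁] [Module A F₁] [AddCommGroup M] [Module A M]
    [Fintype ι] [Fintype κ] (b₀ : Module.Basis ι A F₀) (b₁ : Module.Basis κ A F₁)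
    (φ : F₁ →ₗ[A] F₀) (ψ : F₀ →ₗ[A] F₁) (q : A) (hψφ : ∀ x, ψ (φ x) = q • x)
    (π : F₀ →ₗ[A] M) (hπ : Function.Surjective π) (hker : LinearMap.ker π = LinearMap.range φ)
    (I : Ideal A) (a : A) (ha : ∀ r, a * r ∈ I → r ∈ I)
    (hq : ∀ r, q * r ∈ I ⊔ Ideal.span {a} → r ∈ I ⊔ Ideal.span {a}) :
    IsSMulRegular (M ⧸ (I • ⊤ : Submodule A M)) a := by
  rw [isSMulRegular_quotient_iff_mem_of_smul_mem]
  intro m hm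
  obtain ⟨u, rfl⟩ := hπ m
  rw [← map_smul, mem_smul_top_of_surjective π hπ] at hm
  obtain ⟨c, hc, k, hk, e⟩ := hm
  rw [hker] at hk
  obtain ⟨v, rfl⟩ := hk
  have hv : v ∈ (I ⊔ Ideal.span {a}) • (⊤ : Submodule A F₁) := by
    refine b₁.mem_smul_top_of_smul_mem hq ?_
    have e' : q • v = a • ψ u - ψ c := by
      rw [← hψφ, ← map_smul, e, map_add, add_sub_cancel_left]
    rw [e', Submodule.sup_smul]
    refine Submodule.sub_mem _ (Submodule.mem_sup_right
      (Submodule.smul_mem_smul (Ideal.mem_span_singleton_self a) Submodule.mem_top))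
      (Submodule.mem_sup_left ?_)
    have : ψ c ∈ (I • (⊤ : Submodule A F₀)).map ψ := Submodule.mem_map_of_mem hc
    rw [Submodule.map_smul''] at this
    exact Submodule.smul_mono le_rfl le_top this
  rw [Submodule.sup_smul, Submodule.mem_sup] at hv
  obtain ⟨v₁, hv₁, v₂, hv₂, rfl⟩ := hv
  rw [Submodule.ideal_span_singleton_smul] at hv₂
  obtain ⟨v', -, rfl⟩ := hv₂
  rw [mem_smul_top_of_surjective π hπ]
  refine ⟨u - φ v', b₀.mem_smul_top_of_smul_mem ha ?_, φ v', ?_, by abel⟩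
  · have : a • (u - φ v') = c + φ v₁ := by
      rw [smul_sub, e, map_add]
      change c + (φ v₁ + φ (a • v')) - _ = _
      rw [map_smul]; abel
    rw [this]
    refine Submodule.add_mem _ hc ?_
    have : φ v₁ ∈ (I • (⊤ : Submodule A F₁)).map φ := Submodule.mem_map_of_mem hv₁
    rw [Submodule.map_smul''] at this
    exact Submodule.smul_mono le_rfl le_top this
  · rw [hker]; exact ⟨v', rfl⟩

/-! ### Ideals generated by initial segments of the variables -/

section Vars

variable (𝕜 : Type) [Field 𝕜] (N : ℕ)

/-- The substitution `λ_j ↦ 0` for `j < t`. -/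
noncomputable def killVars (t : ℕ) : MvPolynomial (Fin N) 𝕜 →ₐ[𝕜] MvPolynomial (Fin N) 𝕜 :=
  aeval fun j => if j.val < t then 0 else X j

/-- The ideal `⟨λ_j | j < t⟩`. -/
noncomputable def varIdeal (t : ℕ) : Ideal (MvPolynomial (Fin N) 𝕜) :=
  Ideal.span (X '' {j : Fin N | j.val < t})

variable {𝕜 N}

/-- A polynomial and its image under the substitution differ by an element of the ideal. Being the
kernel of a map to a domain, the ideal allows cancellation of any factor outside it. -/
theorem mem_varIdeal_iff {t : ℕ} {r : MvPolynomial (Fin N) 𝕜} :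
    r ∈ varIdeal 𝕜 N t ↔ killVars 𝕜 N t r = 0 := by
  constructor
  · intro h
    have : varIdeal 𝕜 N t ≤ RingHom.ker (killVars 𝕜 N t) := by
      rw [varIdeal, Ideal.span_le]
      rintro _ ⟨j, hj, rfl⟩
      simp only [SetLike.mem_coe, RingHom.mem_ker, killVars, aeval_X]
      exact if_pos hj
    exact this h
  · intro h
    have key : ∀ p : MvPolynomial (Fin N) 𝕜, p - killVars 𝕜 N t p ∈ varIdeal 𝕜 N t := by
      intro p
      induction p using MvPolynomial.induction_on with
      | C a => simp [killVars]
      | add p q hp hq =>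
        rw [map_add, add_sub_add_comm]
        exact Ideal.add_mem _ hp hq
      | mul_X p j hp =>
        by_cases hj : j.val < t
        · have : killVars 𝕜 N t (X j) = 0 := by simp [killVars, hj]
          rw [map_mul, this, mul_zero, sub_zero]
          exact Ideal.mul_mem_left _ _ (Ideal.subset_span ⟨j, hj, rfl⟩)
        · have : killVars 𝕜 N t (X j) = X j := by simp [killVars, hj]
          rw [map_mul, this, ← sub_mul]
          exact Ideal.mul_mem_right _ _ hp
    simpa [h] using key r

theorem mem_varIdeal_of_mul_mem {t : ℕ} {a r : MvPolynomial (Fin N) 𝕜} (ha : a ∉ varIdeal 𝕜 N t)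
    (h : a * r ∈ varIdeal 𝕜 N t) : r ∈ varIdeal 𝕜 N t := by
  rw [mem_varIdeal_iff] at ha h ⊢
  rw [map_mul] at h
  exact (mul_eq_zero.1 h).resolve_left ha

theorem notMem_varIdeal_of_eval {t : ℕ} {a : MvPolynomial (Fin N) 𝕜} (s : Fin N)
    (hs : t ≤ s.val) (ha : eval (Pi.single s 1) a ≠ 0) : a ∉ varIdeal 𝕜 N t := by
  intro h
  have : varIdeal 𝕜 N t ≤ RingHom.ker (eval (Pi.single s (1 : 𝕜))) := by
    rw [varIdeal, Ideal.span_le]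
    rintro _ ⟨j, hj, rfl⟩
    have hne : j ≠ s := by rintro rfl; exact absurd hj (by simpa using hs)
    simp [hne]
  exact ha (this h)

theorem eval_single_qPoly (s : Fin N) : eval (Pi.single s 1) (qPoly 𝕜 N) = 1 := by
  simp [qPoly, Pi.single_apply]

theorem qPoly_notMem_varIdeal {t : ℕ} (ht : t < N) : qPoly 𝕜 N ∉ varIdeal 𝕜 N t :=
  notMem_varIdeal_of_eval ⟨t, ht⟩ le_rfl (by simp [eval_single_qPoly])

theorem X_notMem_varIdeal (s : Fin N) : (X s : MvPolynomial (Fin N) 𝕜) ∉ varIdeal 𝕜 N s :=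
  notMem_varIdeal_of_eval s le_rfl (by simp)

theorem qPoly_ne_zero (hN : 0 < N) : qPoly 𝕜 N ≠ 0 := fun h => by
  simpa [h] using eval_single_qPoly (𝕜 := 𝕜) (⟨0, hN⟩ : Fin N)

theorem varIdeal_sup (s : Fin N) :
    varIdeal 𝕜 N s ⊔ Ideal.span {X s} = varIdeal 𝕜 N (s + 1) := by
  rw [varIdeal, varIdeal, ← Ideal.span_union]
  congr 1
  ext x
  simp only [Set.mem_union, Set.mem_image, Set.mem_ofPred_eq, Set.mem_singleton_iff]
  constructor
  · rintro (⟨j, hj, rfl⟩ | rfl)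
    · exact ⟨j, by omega, rfl⟩
    · exact ⟨s, by omega, rfl⟩
  · rintro ⟨j, hj, rfl⟩
    rcases Nat.lt_succ_iff_lt_or_eq.1 hj with h | h
    · exact Or.inl ⟨j, h, rfl⟩
    · exact Or.inr (by rw [Fin.ext h])

variable (𝕜 N) in
/-- The variables `λ_j` with `j < t`, as a list. -/
noncomputable def varList (t : ℕ) : List (MvPolynomial (Fin N) 𝕜) :=
  ((List.finRange N).take t).map X

theorem length_varList {t : ℕ} (ht : t ≤ N) : (varList 𝕜 N t).length = t := by
  simp [varList, ht]

theorem ofList_varList (t : ℕ) : Ideal.ofList (varList 𝕜 N t) = varIdeal 𝕜 N t := by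
  rw [Ideal.ofList, varIdeal]
  congr 1
  ext x
  simp only [varList, List.mem_map, Set.mem_ofPred_eq, Set.mem_image, List.mem_take_iff_getElem]
  constructor
  · rintro ⟨j, ⟨i, hi, rfl⟩, rfl⟩
    refine ⟨_, ?_, rfl⟩
    simp at hi ⊢
    omega
  · rintro ⟨j, hj, rfl⟩
    exact ⟨j, ⟨j, by simp; omega, by simp⟩, rfl⟩

theorem take_varList {t i : ℕ} (h : i ≤ t) : (varList 𝕜 N t).take i = varList 𝕜 N i := by
  rw [varList, varList, ← List.map_take, List.take_take, min_eq_left h]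

theorem mem_varList {t : ℕ} {x : MvPolynomial (Fin N) 𝕜} (h : x ∈ varList 𝕜 N t) :
    ∃ j, x = X j := by
  obtain ⟨j, -, rfl⟩ := List.mem_map.1 h
  exact ⟨j, rfl⟩

/-- The sequence stops at `N - 1` because the criterion needs `q_N` to be nonzero modulo the
variables used so far together with the next one, so at least one variable must survive. -/
theorem isWeaklyRegular_varList_of_factorization {F₀ F₁ M ι κ : Type*}
    [AddCommGroup F₀] [Module (MvPolynomial (Fin N) 𝕜) F₀] [AddCommGroup F₁]
    [Module (MvPolynomial (Fin N) 𝕜) F₁] [AddCommGroup M] [Module (MvPolynomial (Fin N) 𝕜) M]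
    [Fintype ι] [Fintype κ] (b₀ : Module.Basis ι (MvPolynomial (Fin N) 𝕜) F₀)
    (b₁ : Module.Basis κ (MvPolynomial (Fin N) 𝕜) F₁)
    (φ : F₁ →ₗ[MvPolynomial (Fin N) 𝕜] F₀) (ψ : F₀ →ₗ[MvPolynomial (Fin N) 𝕜] F₁)
    (hψφ : ∀ x, ψ (φ x) = qPoly 𝕜 N • x)
    (π : F₀ →ₗ[MvPolynomial (Fin N) 𝕜] M) (hπ : Function.Surjective π)
    (hker : LinearMap.ker π = LinearMap.range φ) :
    RingTheory.Sequence.IsWeaklyRegular M (varList 𝕜 N (N - 1)) := by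
  refine ⟨fun i hi => ?_⟩
  have hi' : i < N - 1 := by rwa [length_varList (Nat.sub_le N 1)] at hi
  rw [take_varList hi'.le, ofList_varList]
  have e : (varList 𝕜 N (N - 1))[i] = X ⟨i, by omega⟩ := by simp [varList]
  rw [e]
  refine isSMulRegular_coker_of_factorization b₀ b₁ φ ψ _ hψφ π hπ hker _ _
    (fun r => mem_varIdeal_of_mul_mem (X_notMem_varIdeal (⟨i, by omega⟩ : Fin N))) fun r => ?_
  rw [varIdeal_sup ⟨i, by omega⟩]
  exact mem_varIdeal_of_mul_mem (qPoly_notMem_varIdeal (by simp; omega))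

end Vars

/-! ### Depth and dimension -/

/-- A regular element avoids the minimal primes of the support, so each member of the sequence
lowers the dimension of the support by at least one. -/
theorem RingTheory.Sequence.IsRegular.length_le_supportDim {A : Type*} [CommRing A]
    [IsNoetherianRing A] (rs : List A) (M : Type*) [AddCommGroup M] [Module A M]
    [Module.Finite A M] (h : RingTheory.Sequence.IsRegular M rs) :
    (rs.length : WithBot ℕ∞) ≤ Module.supportDim A M := by
  induction rs generalizing M with
  | nil =>
    have := h.nontrivial
    have h0 := Module.supportDim_ne_bot_of_nontrivial A M
    rw [List.length_nil, Nat.cast_zero, ← WithBot.coe_unbot _ h0]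
    exact WithBot.coe_le_coe.2 zero_le
  | cons r rs ih =>
    rw [RingTheory.Sequence.isRegular_cons_iff] at h
    have h1 := ih (QuotSMulTop r M) h.2
    have h2 : Module.supportDim A (QuotSMulTop r M) + 1 ≤ Module.supportDim A M :=
      Module.supportDim_quotSMulTop_succ_le_of_notMem_minimalPrimes
        fun _ => h.1.notMem_of_mem_minimalPrimes
    refine le_trans ?_ h2
    rw [List.length_cons, Nat.cast_add, Nat.cast_one]
    exact add_le_add h1 le_rfl

section YDepth

variable {𝕜 : Type} [Field 𝕜] {N : ℕ}

/-- The evaluation of `R / ⟨q_N⟩` at the origin. -/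
noncomputable def evalY (𝕜 : Type) [Field 𝕜] (N : ℕ) : YRing 𝕜 N →+* 𝕜 :=
  Ideal.Quotient.lift _ constantCoeff fun a ha => by
    have : Ideal.span {qPoly 𝕜 N} ≤ RingHom.ker constantCoeff := by
      rw [Ideal.span_le, Set.singleton_subset_iff]
      simp [qPoly]
    exact this ha

@[simp]
theorem evalY_toY (r : MvPolynomial (Fin N) 𝕜) : evalY 𝕜 N (toY 𝕜 N r) = constantCoeff r := rfl

theorem irrelevantY_le_ker : irrelevantY 𝕜 N ≤ RingHom.ker (evalY 𝕜 N) := by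
  rw [irrelevantY, Ideal.span_le]
  rintro _ ⟨i, rfl⟩
  simp

theorem isRegular_of_smul_ne_top {A M : Type*} [CommRing A] [AddCommGroup M] [Module A M]
    {J : Ideal A} (hJ : J • (⊤ : Submodule A M) ≠ ⊤) {rs : List A} (hrs : ∀ r ∈ rs, r ∈ J)
    (h : RingTheory.Sequence.IsWeaklyRegular M rs) : RingTheory.Sequence.IsRegular M rs :=
  ⟨h, fun e => hJ (top_le_iff.1 (e.le.trans
    (Submodule.smul_mono_left (Ideal.span_le.2 hrs))))⟩

theorem isRegular_varList_of_factorization {F₀ F₁ M ι κ : Type*}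
    [AddCommGroup F₀] [Module (MvPolynomial (Fin N) 𝕜) F₀] [AddCommGroup F₁]
    [Module (MvPolynomial (Fin N) 𝕜) F₁] [AddCommGroup M] [Module (MvPolynomial (Fin N) 𝕜) M]
    [Module (YRing 𝕜 N) M] [IsScalarTower (MvPolynomial (Fin N) 𝕜) (YRing 𝕜 N) M]
    [Fintype ι] [Fintype κ] (b₀ : Module.Basis ι (MvPolynomial (Fin N) 𝕜) F₀)
    (b₁ : Module.Basis κ (MvPolynomial (Fin N) 𝕜) F₁)
    (φ : F₁ →ₗ[MvPolynomial (Fin N) 𝕜] F₀) (ψ : F₀ →ₗ[MvPolynomial (Fin N) 𝕜] F₁)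
    (hψφ : ∀ x, ψ (φ x) = qPoly 𝕜 N • x)
    (π : F₀ →ₗ[MvPolynomial (Fin N) 𝕜] M) (hπ : Function.Surjective π)
    (hker : LinearMap.ker π = LinearMap.range φ)
    (hJ : irrelevantY 𝕜 N • (⊤ : Submodule (YRing 𝕜 N) M) ≠ ⊤) :
    RingTheory.Sequence.IsRegular M ((varList 𝕜 N (N - 1)).map (toY 𝕜 N)) := by
  refine isRegular_of_smul_ne_top hJ ?_ ?_
  · intro r hr
    obtain ⟨x, hx, rfl⟩ := List.mem_map.1 hr
    obtain ⟨j, rfl⟩ := mem_varList hx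
    exact Ideal.subset_span ⟨j, rfl⟩
  · exact (RingTheory.Sequence.isWeaklyRegular_map_algebraMap_iff (YRing 𝕜 N) M _).2
      (isWeaklyRegular_varList_of_factorization b₀ b₁ φ ψ hψφ π hπ hker)

/-- Dividing by the nonzerodivisor `q_N` lowers the dimension by at least one. Conversely, the ring
is the cokernel of the trivial factorization `q_N = q_N · 1`, so it carries a regular sequence of
length `N - 1`. -/
theorem ringKrullDim_YRing (hN : 0 < N) :
    ringKrullDim (YRing 𝕜 N) = ((N - 1 : ℕ) : WithBot ℕ∞) := by
  apply le_antisymm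
  · have h1 : ringKrullDim (YRing 𝕜 N) + 1 ≤ ringKrullDim (MvPolynomial (Fin N) 𝕜) :=
      ringKrullDim_quotient_succ_le_of_nonZeroDivisor
        (mem_nonZeroDivisors_of_ne_zero (qPoly_ne_zero hN))
    rw [MvPolynomial.ringKrullDim_of_isNoetherianRing, ringKrullDim_eq_zero_of_field, zero_add,
      Nat.card_eq_fintype_card, Fintype.card_fin] at h1
    obtain ⟨n, rfl⟩ : ∃ n, N = n + 1 := ⟨N - 1, by omega⟩
    push_cast at h1
    simpa using (ENat.WithBot.add_le_add_natCast_right_iff (c := 1)).1 (by simpa using h1)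
  · have hJ : irrelevantY 𝕜 N • (⊤ : Submodule (YRing 𝕜 N) (YRing 𝕜 N)) ≠ ⊤ := by
      rw [smul_eq_mul, Ideal.mul_top, Ne, Ideal.eq_top_iff_one]
      intro h
      simpa using irrelevantY_le_ker h
    have h := isRegular_varList_of_factorization (M := YRing 𝕜 N)
      (Module.Basis.singleton Unit (MvPolynomial (Fin N) 𝕜))
      (Module.Basis.singleton Unit (MvPolynomial (Fin N) 𝕜))
      (LinearMap.lsmul _ _ (qPoly 𝕜 N)) LinearMap.id (fun x => rfl)
      (Ideal.span {qPoly 𝕜 N}).mkQ (Submodule.mkQ_surjective _)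
      (by
        rw [Submodule.ker_mkQ]
        ext x
        rw [Ideal.mem_span_singleton', LinearMap.mem_range]
        simp [mul_comm]) hJ
    have h2 := h.length_le_supportDim
    rwa [List.length_map, length_varList (Nat.sub_le N 1), Module.supportDim_self_eq_ringKrullDim]
      at h2

theorem depthAt_eq_of_isRegular {A : Type*} [CommRing A] [IsNoetherianRing A] (J : Ideal A)
    (M : Type*) [AddCommGroup M] [Module A M] [Module.Finite A M] {n : ℕ}
    (hn : ringKrullDim A = (n : WithBot ℕ∞)) {rs : List A} (hrs : ∀ r ∈ rs, r ∈ J)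
    (h : RingTheory.Sequence.IsRegular M rs) (hl : rs.length = n) : depthAt J M = n := by
  apply le_antisymm
  · refine iSup_le fun rs' => ?_
    have h1 := rs'.2.2.length_le_supportDim.trans (Module.supportDim_le_ringKrullDim A M)
    rw [hn] at h1
    exact_mod_cast h1
  · rw [← hl]
    exact le_iSup (fun rs : {rs : List A // (∀ r ∈ rs, r ∈ J) ∧
      RingTheory.Sequence.IsRegular M rs} => (rs.1.length : ℕ∞)) ⟨rs, hrs, h⟩

/-- A finite supremum of lengths is attained. For `n = 0` the witness is the empty sequence, which
is regular only because `M` is nonzero. -/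
theorem exists_isRegular_of_depthAt_eq {A : Type*} [CommRing A] (J : Ideal A)
    (M : Type*) [AddCommGroup M] [Module A M] [Nontrivial M] {n : ℕ} (h : depthAt J M = n) :
    ∃ rs : List A, (∀ r ∈ rs, r ∈ J) ∧ RingTheory.Sequence.IsRegular M rs ∧ n ≤ rs.length := by
  by_contra! hc
  rcases Nat.eq_zero_or_pos n with rfl | hn
  · exact absurd (hc [] (by simp) (RingTheory.Sequence.IsRegular.nil A M)) (by simp)
  · have : depthAt J M ≤ ((n - 1 : ℕ) : ℕ∞) := by
      refine iSup_le fun rs => ?_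
      have := hc rs.1 rs.2.1 rs.2.2
      exact_mod_cast Nat.le_sub_one_of_lt this
    rw [h] at this
    have : n ≤ n - 1 := by exact_mod_cast this
    omega

end YDepth

/-! ### The integer grading -/

section HomZ

variable {𝕜 : Type} [Field 𝕜] {N : ℕ} {V V' : Type*} [AddCommGroup V] [Module 𝕜 V]
  [AddCommGroup V'] [Module 𝕜 V']

/-- The homogeneous components on `R ⊗ V`, indexed by the integers. -/
noncomputable def homZ (N : ℕ) (V : Type*) [AddCommGroup V] [Module 𝕜 V] (n : ℤ) :
    (MvPolynomial (Fin N) 𝕜 ⊗[𝕜] V) →ₗ[𝕜] (MvPolynomial (Fin N) 𝕜 ⊗[𝕜] V) :=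
  if 0 ≤ n then homComp N V n.toNat else 0

@[simp]
theorem homZ_natCast (n : ℕ) : homZ (𝕜 := 𝕜) N V n = homComp N V n := by simp [homZ]

theorem homZ_of_neg {n : ℤ} (h : n < 0) : homZ (𝕜 := 𝕜) N V n = 0 := if_neg (not_le.2 h)

theorem homZ_homZ (m n : ℤ) (x : MvPolynomial (Fin N) 𝕜 ⊗[𝕜] V) :
    homZ N V m (homZ N V n x) = if m = n then homZ N V n x else 0 := by
  rcases lt_or_ge n 0 with hn | hn
  · simp [homZ_of_neg hn]
  rcases lt_or_ge m 0 with hm | hm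
  · rw [homZ_of_neg hm, if_neg (by omega)]; rfl
  lift m to ℕ using hm
  lift n to ℕ using hn
  simp [homComp_homComp]

theorem homZ_linForm (a : Fin N → V →ₗ[𝕜] V') (n : ℤ) (x : MvPolynomial (Fin N) 𝕜 ⊗[𝕜] V) :
    homZ N V' n (linForm a x) = linForm a (homZ N V (n - 1) x) := by
  rcases lt_or_ge n 0 with hn | hn
  · rw [homZ_of_neg hn, homZ_of_neg (by omega)]; simp
  lift n to ℕ using hn
  cases n with
  | zero =>
    rw [homZ_of_neg (n := ((0 : ℕ) : ℤ) - 1) (by simp), homZ_natCast, homComp_zero_linForm]; simp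
  | succ n =>
    have : ((n + 1 : ℕ) : ℤ) - 1 = (n : ℕ) := by push_cast; ring
    rw [this, homZ_natCast, homZ_natCast, homComp_linForm]

theorem homComp_smul_of_lt {a : MvPolynomial (Fin N) 𝕜} {m : ℕ} (ha : a.IsHomogeneous m) {n : ℕ}
    (hn : n < m) (x : MvPolynomial (Fin N) 𝕜 ⊗[𝕜] V) : homComp N V n (a • x) = 0 := by
  induction x with
  | zero => simp
  | tmul r v =>
    simp [TensorProduct.smul_tmul', homogeneousComponent_mul_of_isHomogeneous_of_lt ha hn]
  | add x y hx hy => simp only [smul_add, map_add, hx, hy, add_zero]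

theorem homZ_smul {a : MvPolynomial (Fin N) 𝕜} {m : ℕ} (ha : a.IsHomogeneous m) (n : ℤ)
    (x : MvPolynomial (Fin N) 𝕜 ⊗[𝕜] V) :
    homZ N V (m + n) (a • x) = a • homZ N V n x := by
  rcases lt_or_ge n 0 with hn | hn
  · rw [homZ_of_neg hn]
    rcases lt_or_ge (m + n) 0 with h | h
    · rw [homZ_of_neg h]; simp
    · obtain ⟨k, hk⟩ := Int.eq_ofNat_of_zero_le h
      rw [hk, homZ_natCast, homComp_smul_of_lt ha (by omega)]; simp
  lift n to ℕ using hn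
  rw [← Nat.cast_add, homZ_natCast, homZ_natCast, homComp_smul ha]

theorem exists_sum_homZ (x : MvPolynomial (Fin N) 𝕜 ⊗[𝕜] V) :
    ∃ d : ℕ, x = ∑ n ∈ Finset.range d, homZ N V n x := by
  obtain ⟨D, hD⟩ := exists_sum_homComp x
  exact ⟨D, by simp [hD D le_rfl]⟩

@[simp]
theorem homZ_zero_one_tmul (v : V) :
    homZ N V 0 ((1 : MvPolynomial (Fin N) 𝕜) ⊗ₜ[𝕜] v) = 1 ⊗ₜ v := by
  have := homZ_natCast (𝕜 := 𝕜) (N := N) (V := V) 0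
  rw [Nat.cast_zero] at this
  rw [this, homComp_tmul, homogeneousComponent_zero]
  simp

/-- The image of a linear form lives in positive degrees. Consequently `W₀` embeds in `coker φ_W`.
-/
theorem eq_zero_of_one_tmul_mem_range_linForm (a : Fin N → V →ₗ[𝕜] V') {v : V'}
    (h : (1 : MvPolynomial (Fin N) 𝕜) ⊗ₜ[𝕜] v ∈ LinearMap.range (linForm a)) : v = 0 := by
  obtain ⟨z, hz⟩ := h
  apply one_tmul_injective (𝕜 := 𝕜) N V'
  have := congrArg (homComp N V' 0) hz
  rw [homComp_zero_linForm, homComp_tmul, homogeneousComponent_zero] at this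
  simpa using this.symm

end HomZ

/-- Applied to the sum of a family, `P k` returns its `k`-th member, so the sum determines the
family. -/
theorem isInternal_of_projections {ι M : Type*} [DecidableEq ι] [AddCommGroup M]
    (gr : ι → AddSubgroup M) (P : ι → M →+ M) (h₁ : ∀ n, ∀ m ∈ gr n, P n m = m)
    (h₂ : ∀ n k, k ≠ n → ∀ m ∈ gr n, P k m = 0) (h₃ : ∀ m, m ∈ ⨆ n, gr n) :
    DirectSum.IsInternal gr := by
  constructor
  · rw [injective_iff_map_eq_zero]
    intro x hx
    ext k
    have : ∀ y : DirectSum ι fun i => gr i,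
        P k (DirectSum.coeAddMonoidHom gr y) = (y k : M) := by
      intro y
      induction y using DirectSum.induction_on with
      | zero => simp
      | of i z =>
        rw [DirectSum.coeAddMonoidHom_of]
        by_cases hk : k = i
        · subst hk
          simp [h₁ k z z.2]
        · rw [h₂ i k hk z z.2, DirectSum.of_eq_of_ne _ _ _ hk]; rfl
      | add y z hy hz => rw [map_add, map_add, hy, hz]; rfl
    rw [← this, hx, map_zero]; rfl
  · intro m
    refine AddSubgroup.iSup_induction gr (C := fun m => ∃ a, DirectSum.coeAddMonoidHom gr a = m)
      (h₃ m) (fun i x hx => ?_) ?_ ?_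
    · exact ⟨DirectSum.of (fun i => gr i) i ⟨x, hx⟩, by simp⟩
    · exact ⟨0, by simp⟩
    · rintro _ _ ⟨a, rfl⟩ ⟨b, rfl⟩
      exact ⟨a + b, by simp⟩

/-! ### Clifford relations -/

section Clifford

variable {𝕜 : Type} [Field 𝕜] {N : ℕ}

theorem Cl.gen_mul_gen_add (i j : Fin N) :
    Cl.gen 𝕜 N i * Cl.gen 𝕜 N j + Cl.gen 𝕜 N j * Cl.gen 𝕜 N i =
      algebraMap 𝕜 (Cl 𝕜 N) (if i = j then 2 else 0) := by
  rw [Cl.gen, Cl.gen, CliffordAlgebra.ι_mul_ι_add_swap]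
  congr 1
  simp only [QuadraticMap.polar, QuadraticMap.weightedSumSquares_apply, Pi.add_apply, one_smul,
    ← Finset.sum_sub_distrib]
  have : ∀ k : Fin N, (Pi.single i (1 : 𝕜) + Pi.single j 1 : Fin N → 𝕜) k *
      (Pi.single i (1 : 𝕜) + Pi.single j 1 : Fin N → 𝕜) k -
      Pi.single (M := fun _ => 𝕜) i 1 k * Pi.single (M := fun _ => 𝕜) i 1 k -
      Pi.single (M := fun _ => 𝕜) j 1 k * Pi.single (M := fun _ => 𝕜) j 1 k =
      if k = i then (if i = j then 2 else 0) else 0 := by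
    intro k
    by_cases hi : k = i
    · subst hi
      by_cases hj : k = j
      · subst hj; simp; ring
      · simp [hj]
    · by_cases hj : k = j
      · subst hj; simp [hi]
      · simp [hi, hj]
  simp only [Pi.add_apply] at this
  simp [this]

theorem Cl.gen_mul_self [CharZero 𝕜] (i : Fin N) : Cl.gen 𝕜 N i * Cl.gen 𝕜 N i = 1 := by
  rw [Cl.gen, CliffordAlgebra.ι_sq_scalar]
  simp [Pi.single_apply]

theorem Cl.mem_span_gen (v : Fin N → 𝕜) :
    CliffordAlgebra.ι (qForm 𝕜 N) v = ∑ i, v i • Cl.gen 𝕜 N i := by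
  conv_lhs => rw [← Finset.univ_sum_single v]
  rw [map_sum]
  refine Finset.sum_congr rfl fun i _ => ?_
  rw [Cl.gen, ← map_smul]
  congr 1
  ext j
  simp [Pi.single_apply]

theorem Cl.map_smul_of_gen {M M' : Type*} [AddCommGroup M] [Module 𝕜 M] [Module (Cl 𝕜 N) M]
    [IsScalarTower 𝕜 (Cl 𝕜 N) M] [AddCommGroup M'] [Module 𝕜 M'] [Module (Cl 𝕜 N) M']
    [IsScalarTower 𝕜 (Cl 𝕜 N) M'] (f : M →ₗ[𝕜] M')
    (h : ∀ i x, f (Cl.gen 𝕜 N i • x) = Cl.gen 𝕜 N i • f x) (c : Cl 𝕜 N) (x : M) :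
    f (c • x) = c • f x := by
  induction c using CliffordAlgebra.induction generalizing x with
  | algebraMap r => rw [algebraMap_smul, algebraMap_smul, map_smul]
  | ι v =>
    rw [Cl.mem_span_gen, Finset.sum_smul, Finset.sum_smul, map_sum]
    refine Finset.sum_congr rfl fun i _ => ?_
    rw [smul_assoc, smul_assoc, map_smul, h]
  | mul a b ha hb => rw [mul_smul, mul_smul, ha, hb]
  | add a b ha hb => rw [add_smul, add_smul, map_add, ha, hb]

end Clifford

/-! ### The generators as maps between the even and odd parts -/

namespace GrClMod

variable {𝕜 : Type} [Field 𝕜] {N : ℕ}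

/-- The action `W₀ → W₁` of the generator `e_i`. -/
noncomputable def actUp (W : GrClMod.{w} 𝕜 N) (i : Fin N) : W.gr 0 →ₗ[𝕜] W.gr 1 :=
  LinearMap.codRestrict (W.gr 1)
    ((Algebra.lsmul 𝕜 𝕜 W.carrier (Cl.gen 𝕜 N i)) ∘ₗ (W.gr 0).subtype)
    (fun m => W.smul_mem 1 0 (Cl.gen 𝕜 N i) m
      (CliffordAlgebra.ι_mem_evenOdd_one (qForm 𝕜 N) _) m.2)

@[simp]
theorem coe_act (W : GrClMod.{w} 𝕜 N) (i : Fin N) (x : W.gr 1) :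
    (W.act i x : W.carrier) = Cl.gen 𝕜 N i • (x : W.carrier) := rfl

@[simp]
theorem coe_actUp (W : GrClMod.{w} 𝕜 N) (i : Fin N) (x : W.gr 0) :
    (W.actUp i x : W.carrier) = Cl.gen 𝕜 N i • (x : W.carrier) := rfl

theorem gen_smul_gen_smul_add (W : GrClMod.{w} 𝕜 N) (i j : Fin N) (x : W.carrier) :
    Cl.gen 𝕜 N i • Cl.gen 𝕜 N j • x + Cl.gen 𝕜 N j • Cl.gen 𝕜 N i • x =
      if i = j then (2 : 𝕜) • x else 0 := by
  rw [← mul_smul, ← mul_smul, ← add_smul, Cl.gen_mul_gen_add, algebraMap_smul]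
  split_ifs <;> simp

theorem act_actUp_add (W : GrClMod.{w} 𝕜 N) (i j : Fin N) (x : W.gr 0) :
    W.act i (W.actUp j x) + W.act j (W.actUp i x) = if i = j then (2 : 𝕜) • x else 0 := by
  apply Subtype.ext
  have := W.gen_smul_gen_smul_add i j x
  split_ifs at this ⊢ <;> simpa using this

theorem actUp_act_add (W : GrClMod.{w} 𝕜 N) (i j : Fin N) (x : W.gr 1) :
    W.actUp i (W.act j x) + W.actUp j (W.act i x) = if i = j then (2 : 𝕜) • x else 0 := by
  apply Subtype.ext
  have := W.gen_smul_gen_smul_add i j x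
  split_ifs at this ⊢ <;> simpa using this

theorem phi_eq_linForm (W : GrClMod.{w} 𝕜 N) : W.phi = linForm W.act := rfl

variable [CharZero 𝕜]

theorem act_actUp (W : GrClMod.{w} 𝕜 N) (i : Fin N) (x : W.gr 0) : W.act i (W.actUp i x) = x := by
  apply Subtype.ext
  simp [← mul_smul, Cl.gen_mul_self]

theorem actUp_act (W : GrClMod.{w} 𝕜 N) (i : Fin N) (x : W.gr 1) : W.actUp i (W.act i x) = x := by
  apply Subtype.ext
  simp [← mul_smul, Cl.gen_mul_self]

theorem phi_linForm_actUp (W : GrClMod.{w} 𝕜 N) (x) :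
    W.phi (linForm W.actUp x) = qPoly 𝕜 N • x := by
  have := linForm_comp W.act W.actUp LinearMap.id fun i j x => by
    simpa using W.act_actUp_add i j x
  rw [phi_eq_linForm]
  simpa using LinearMap.congr_fun this x

theorem linForm_actUp_phi (W : GrClMod.{w} 𝕜 N) (x) :
    linForm W.actUp (W.phi x) = qPoly 𝕜 N • x := by
  have := linForm_comp W.actUp W.act LinearMap.id fun i j x => by
    simpa using W.actUp_act_add i j x
  rw [phi_eq_linForm]
  simpa using LinearMap.congr_fun this x

/-- The generator `e_i` as an isomorphism `W₁ ≃ W₀`. -/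
noncomputable def actEquiv (W : GrClMod.{w} 𝕜 N) (i : Fin N) : W.gr 1 ≃ₗ[𝕜] W.gr 0 :=
  LinearEquiv.ofLinearMap (W.act i) (W.actUp i) (LinearMap.ext (W.act_actUp i))
    (LinearMap.ext (W.actUp_act i))

end GrClMod

/-! ### The cokernel of `φ_W` as a graded module over `R / ⟨q_N⟩` -/

namespace GrClMod

variable {𝕜 : Type} [Field 𝕜] {N : ℕ}

/-- The cokernel of `φ_W`. -/
def Cok (W : GrClMod.{w} 𝕜 N) : Type w :=
  (MvPolynomial (Fin N) 𝕜 ⊗[𝕜] W.gr 0) ⧸ LinearMap.range W.phi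

noncomputable instance (W : GrClMod.{w} 𝕜 N) : AddCommGroup W.Cok :=
  inferInstanceAs (AddCommGroup ((MvPolynomial (Fin N) 𝕜 ⊗[𝕜] W.gr 0) ⧸ LinearMap.range W.phi))

noncomputable instance (W : GrClMod.{w} 𝕜 N) : Module (MvPolynomial (Fin N) 𝕜) W.Cok :=
  inferInstanceAs (Module (MvPolynomial (Fin N) 𝕜)
    ((MvPolynomial (Fin N) 𝕜 ⊗[𝕜] W.gr 0) ⧸ LinearMap.range W.phi))

/-- The projection `R ⊗ W₀ → coker φ_W`. -/
noncomputable def toCok (W : GrClMod.{w} 𝕜 N) :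
    (MvPolynomial (Fin N) 𝕜 ⊗[𝕜] W.gr 0) →ₗ[MvPolynomial (Fin N) 𝕜] W.Cok :=
  (LinearMap.range W.phi).mkQ

theorem toCok_surjective (W : GrClMod.{w} 𝕜 N) : Function.Surjective W.toCok :=
  Submodule.mkQ_surjective _

theorem ker_toCok (W : GrClMod.{w} 𝕜 N) : LinearMap.ker W.toCok = LinearMap.range W.phi :=
  Submodule.ker_mkQ _

theorem toCok_eq_zero_iff (W : GrClMod.{w} 𝕜 N) {x} :
    W.toCok x = 0 ↔ ∃ z, W.phi z = x := by
  rw [← LinearMap.mem_ker, ker_toCok]; rfl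

@[simp]
theorem toCok_phi (W : GrClMod.{w} 𝕜 N) (z) : W.toCok (W.phi z) = 0 :=
  W.toCok_eq_zero_iff.2 ⟨z, rfl⟩

/-- The homogeneous components on `coker φ_W`. -/
noncomputable def cokProj (W : GrClMod.{w} 𝕜 N) (n : ℤ) : W.Cok →+ W.Cok :=
  QuotientAddGroup.map (LinearMap.range W.phi).toAddSubgroup (LinearMap.range W.phi).toAddSubgroup
    (homZ N (W.gr 0) n).toAddMonoidHom fun x ⟨z, hz⟩ =>
      ⟨homZ N (W.gr 1) (n - 1) z, by
        rw [phi_eq_linForm] at hz ⊢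
        rw [← homZ_linForm, hz]; rfl⟩

/-- The grading on `coker φ_W`, with `W₀` in degree `0`. -/
noncomputable def cokGr (W : GrClMod.{w} 𝕜 N) (n : ℤ) : AddSubgroup W.Cok :=
  (W.toCok.toAddMonoidHom.comp (homZ N (W.gr 0) n).toAddMonoidHom).range

theorem toCok_one_tmul_mem (W : GrClMod.{w} 𝕜 N) (v : W.gr 0) :
    W.toCok (1 ⊗ₜ v) ∈ W.cokGr 0 := ⟨1 ⊗ₜ v, by simp⟩

theorem exists_of_mem_cokGr_zero (W : GrClMod.{w} 𝕜 N) {m : W.Cok} (h : m ∈ W.cokGr 0) :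
    ∃ v : W.gr 0, W.toCok (1 ⊗ₜ v) = m := by
  obtain ⟨x, rfl⟩ := h
  obtain ⟨v, hv⟩ := exists_homComp_zero_eq x
  refine ⟨v, ?_⟩
  rw [← hv, ← homZ_natCast]; rfl

theorem toCok_one_tmul_eq_zero (W : GrClMod.{w} 𝕜 N) {v : W.gr 0} (h : W.toCok (1 ⊗ₜ v) = 0) :
    v = 0 := by
  rw [← LinearMap.mem_ker, ker_toCok] at h
  exact eq_zero_of_one_tmul_mem_range_linForm _ h

theorem isInternal_cokGr (W : GrClMod.{w} 𝕜 N) : DirectSum.IsInternal W.cokGr := by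
  refine isInternal_of_projections _ W.cokProj ?_ ?_ ?_
  · rintro n _ ⟨x, rfl⟩
    exact congrArg W.toCok ((homZ_homZ n n x).trans (if_pos rfl))
  · rintro n k hk _ ⟨x, rfl⟩
    exact (congrArg W.toCok ((homZ_homZ k n x).trans (if_neg hk))).trans (map_zero _)
  · intro m
    obtain ⟨x, rfl⟩ := W.toCok_surjective m
    obtain ⟨d, hd⟩ := exists_sum_homZ x
    rw [hd, map_sum]
    exact AddSubgroup.sum_mem _ fun n _ => AddSubgroup.mem_iSup_of_mem (n : ℤ) ⟨x, rfl⟩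

theorem tcoeff_zero_phi (W : GrClMod.{w} 𝕜 N) (z) : tcoeff N (W.gr 0) 0 (W.phi z) = 0 := by
  rw [phi_eq_linForm]
  induction z with
  | zero => simp
  | tmul r v => simp [linForm_tmul, ← constantCoeff_eq]
  | add x y hx hy => simp only [map_add, hx, hy, add_zero]

theorem tcoeff_zero_smul {V : Type*} [AddCommGroup V] [Module 𝕜 V] (r : MvPolynomial (Fin N) 𝕜)
    (x : MvPolynomial (Fin N) 𝕜 ⊗[𝕜] V) :
    tcoeff N V 0 (r • x) = constantCoeff r • tcoeff N V 0 x := by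
  induction x with
  | zero => simp
  | tmul s v => simp [TensorProduct.smul_tmul', ← constantCoeff_eq, mul_smul]
  | add x y hx hy => simp only [smul_add, map_add, hx, hy]

variable [CharZero 𝕜]

theorem isTorsionBySet_cok (W : GrClMod.{w} 𝕜 N) :
    Module.IsTorsionBySet (MvPolynomial (Fin N) 𝕜) W.Cok
      (Ideal.span {qPoly 𝕜 N} : Ideal (MvPolynomial (Fin N) 𝕜)) := by
  rw [← Module.isTorsionBySet_iff_is_torsion_by_span, Module.isTorsionBySet_singleton_iff]
  intro m
  obtain ⟨x, rfl⟩ := W.toCok_surjective m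
  rw [← map_smul, ← phi_linForm_actUp, toCok_phi]

noncomputable instance (W : GrClMod.{w} 𝕜 N) : Module (YRing 𝕜 N) W.Cok :=
  W.isTorsionBySet_cok.module

theorem toY_smul (W : GrClMod.{w} 𝕜 N) (r : MvPolynomial (Fin N) 𝕜) (m : W.Cok) :
    toY 𝕜 N r • m = r • m := rfl

instance (W : GrClMod.{w} 𝕜 N) : IsScalarTower (MvPolynomial (Fin N) 𝕜) (YRing 𝕜 N) W.Cok where
  smul_assoc r a m := by
    obtain ⟨a, rfl⟩ := Ideal.Quotient.mk_surjective a
    exact mul_smul r a m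

theorem isGradedY_cok (W : GrClMod.{w} 𝕜 N) : IsGradedY 𝕜 N W.cokGr := by
  refine ⟨W.isInternal_cokGr, ?_⟩
  rintro i j _ _ ⟨r, hr, rfl⟩ ⟨x, rfl⟩
  refine ⟨r • x, ?_⟩
  change W.toCok (homZ N (W.gr 0) (i + j) (r • x)) = _
  rw [homZ_smul hr, map_smul]; rfl

instance (W : GrClMod.{w} 𝕜 N) : Module.Finite (MvPolynomial (Fin N) 𝕜) W.Cok :=
  inferInstanceAs (Module.Finite (MvPolynomial (Fin N) 𝕜)
    ((MvPolynomial (Fin N) 𝕜 ⊗[𝕜] W.gr 0) ⧸ LinearMap.range W.phi))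

instance (W : GrClMod.{w} 𝕜 N) : Module.Finite (YRing 𝕜 N) W.Cok :=
  Module.Finite.of_restrictScalars_finite (MvPolynomial (Fin N) 𝕜) _ _

/-- Since `φ_W` has no constant terms, the constant coefficient descends to the cokernel. It
vanishes on multiples of the variables but not on a nonzero vector of `W₀`. -/
theorem irrelevantY_smul_cok_ne_top (W : GrClMod.{w} 𝕜 N) [Nontrivial (W.gr 0)] :
    irrelevantY 𝕜 N • (⊤ : Submodule (YRing 𝕜 N) W.Cok) ≠ ⊤ := by
  intro htop
  have key : ∀ m ∈ irrelevantY 𝕜 N • (⊤ : Submodule (YRing 𝕜 N) W.Cok),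
      ∀ x, W.toCok x = m → tcoeff N (W.gr 0) 0 x = 0 := by
    have wd : ∀ x y, W.toCok x = W.toCok y →
        tcoeff N (W.gr 0) 0 x = tcoeff N (W.gr 0) 0 y := by
      intro x y h
      rw [← sub_eq_zero, ← map_sub] at h ⊢
      obtain ⟨z, hz⟩ := W.toCok_eq_zero_iff.1 h
      rw [← hz, tcoeff_zero_phi]
    intro m hm
    refine Submodule.smul_induction_on hm (fun a ha n _ x hx => ?_) fun m n hm hn x hx => ?_
    · obtain ⟨r, rfl⟩ := Ideal.Quotient.mk_surjective a
      obtain ⟨y, rfl⟩ := W.toCok_surjective n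
      have hr : constantCoeff r = 0 := irrelevantY_le_ker ha
      rw [wd x (r • y) (by rw [hx, map_smul]; rfl), tcoeff_zero_smul, hr, zero_smul]
    · obtain ⟨y, rfl⟩ := W.toCok_surjective m
      obtain ⟨z, rfl⟩ := W.toCok_surjective n
      rw [wd x (y + z) (by rw [hx, map_add]), map_add, hm y rfl, hn z rfl, add_zero]
  obtain ⟨v, hv⟩ := exists_ne (0 : W.gr 0)
  apply hv
  simpa using key (W.toCok (1 ⊗ₜ v)) (by rw [htop]; exact Submodule.mem_top) _ rfl

theorem isMCM_cok (hN : 0 < N) (W : GrClMod.{w} 𝕜 N) : IsMCM 𝕜 N W.Cok := by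
  refine ⟨inferInstance, ?_⟩
  rcases subsingleton_or_nontrivial (W.gr 0) with h | h
  · left
    refine ⟨fun x y => ?_⟩
    obtain ⟨x, rfl⟩ := W.toCok_surjective x
    obtain ⟨y, rfl⟩ := W.toCok_surjective y
    rw [Subsingleton.elim x y]
  · right
    have hreg := isRegular_varList_of_factorization
      (Algebra.TensorProduct.basis (MvPolynomial (Fin N) 𝕜) (Module.finBasis 𝕜 (W.gr 0)))
      (Algebra.TensorProduct.basis (MvPolynomial (Fin N) 𝕜) (Module.finBasis 𝕜 (W.gr 1)))
      W.phi (linForm W.actUp) W.linForm_actUp_phi W.toCok W.toCok_surjective W.ker_toCok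
      W.irrelevantY_smul_cok_ne_top
    rw [ringKrullDim_YRing hN, depthAt_eq_of_isRegular (irrelevantY 𝕜 N) W.Cok
      (ringKrullDim_YRing hN) (rs := (varList 𝕜 N (N - 1)).map (toY 𝕜 N)) ?_ hreg]
    · rfl
    · rw [List.length_map, length_varList (Nat.sub_le N 1)]
    · intro r hr
      obtain ⟨x, hx, rfl⟩ := List.mem_map.1 hr
      obtain ⟨j, rfl⟩ := mem_varList hx
      exact Ideal.subset_span ⟨j, rfl⟩

/-- Lift the functional to `g : R ⊗ W₀ → R`; then `g φ = q_N h` for some values `h`. From `φψ = q_N`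
and the linearity of `ψ`, `q_N g(v)` equals `q_N` times a combination of the variables, and `q_N`
cancels. A projection onto a free summand would take the value `1`. -/
theorem evalY_eq_zero_of_hom (hN : 0 < N) (W : GrClMod.{w} 𝕜 N)
    (f : W.Cok →ₗ[YRing 𝕜 N] YRing 𝕜 N) (m : W.Cok) : evalY 𝕜 N (f m) = 0 := by
  let fR : (MvPolynomial (Fin N) 𝕜 ⊗[𝕜] W.gr 0) →ₗ[MvPolynomial (Fin N) 𝕜] YRing 𝕜 N :=
    (f.restrictScalars (MvPolynomial (Fin N) 𝕜)) ∘ₗ W.toCok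
  obtain ⟨g, hg⟩ := Module.projective_lifting_property
    (Ideal.span {qPoly 𝕜 N}).mkQ fR (Submodule.mkQ_surjective _)
  have hg' : ∀ x, toY 𝕜 N (g x) = f (W.toCok x) := fun x => LinearMap.congr_fun hg x
  have hphi : ∀ z, ∃ h, g (W.phi z) = qPoly 𝕜 N * h := by
    intro z
    have : toY 𝕜 N (g (W.phi z)) = 0 := by rw [hg', toCok_phi, map_zero]
    exact Ideal.mem_span_singleton.1 (Ideal.Quotient.eq_zero_iff_mem.1 this)
  have h1 : ∀ v : W.gr 0, constantCoeff (g (1 ⊗ₜ v)) = 0 := by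
    intro v
    choose h hh using fun i => hphi (1 ⊗ₜ W.actUp i v)
    -- Both sides are `g (φ (ψ (1 ⊗ v)))`, where `ψ (1 ⊗ v) = ∑ λ_i ⊗ e_i v`.
    have e : qPoly 𝕜 N * g (1 ⊗ₜ v) = qPoly 𝕜 N * ∑ i, X i * h i := by
      rw [← smul_eq_mul, ← map_smul, ← phi_linForm_actUp, linForm_one_tmul, map_sum, map_sum,
        Finset.mul_sum]
      refine Finset.sum_congr rfl fun i _ => ?_
      have : (X i : MvPolynomial (Fin N) 𝕜) ⊗ₜ[𝕜] W.actUp i v =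
          (X i : MvPolynomial (Fin N) 𝕜) • (1 ⊗ₜ[𝕜] W.actUp i v) := by
        simp [TensorProduct.smul_tmul']
      rw [this, map_smul, map_smul, hh, smul_eq_mul]; ring
    rw [mul_left_cancel₀ (qPoly_ne_zero hN) e]
    simp
  obtain ⟨x, rfl⟩ := W.toCok_surjective m
  rw [← hg', evalY_toY]
  induction x with
  | zero => simp
  | tmul r v =>
    have : r ⊗ₜ[𝕜] v = r • ((1 : MvPolynomial (Fin N) 𝕜) ⊗ₜ[𝕜] v) := by
      simp [TensorProduct.smul_tmul']
    rw [this, map_smul, smul_eq_mul, map_mul, h1, mul_zero]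
  | add x y hx hy => simp only [map_add, hx, hy, add_zero]

theorem noFreeSummand_cok (hN : 0 < N) (W : GrClMod.{w} 𝕜 N) :
    NoFreeSummand (YRing 𝕜 N) W.Cok := by
  rintro ⟨P, Q, hPQ, ⟨e⟩⟩
  have := W.evalY_eq_zero_of_hom hN (e.toLinearMap ∘ₗ Submodule.projectionOnto P Q hPQ)
    (e.symm 1)
  rw [LinearMap.comp_apply, Submodule.projectionOnto_apply_left] at this
  simp at this

end GrClMod

/-! ### The functor from Clifford modules to linear MCM modules -/

namespace GrClMod

variable {𝕜 : Type} [Field 𝕜] {N : ℕ}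

/-- The matrix of `φ_W` with respect to bases of `W₁` and `W₀`. -/
noncomputable def phiMatrix (W : GrClMod.{w} 𝕜 N) {ι κ : Type*} (b₀ : Module.Basis ι 𝕜 (W.gr 0))
    (b₁ : Module.Basis κ 𝕜 (W.gr 1)) : Matrix ι κ (MvPolynomial (Fin N) 𝕜) :=
  Matrix.of fun i j => ∑ k, C (b₀.repr (W.act k (b₁ j)) i) * X k

theorem isHomogeneous_phiMatrix (W : GrClMod.{w} 𝕜 N) {ι κ : Type*}
    (b₀ : Module.Basis ι 𝕜 (W.gr 0)) (b₁ : Module.Basis κ 𝕜 (W.gr 1)) (i : ι) (j : κ) :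
    (W.phiMatrix b₀ b₁ i j).IsHomogeneous 1 :=
  IsHomogeneous.sum Finset.univ (fun k => C (b₀.repr (W.act k (b₁ j)) i) * X k) _ fun _ _ =>
    isHomogeneous_C_mul_X _ _

theorem phi_sum_tmul (W : GrClMod.{w} 𝕜 N) {ι κ : Type*} [Fintype ι] [Fintype κ]
    (b₀ : Module.Basis ι 𝕜 (W.gr 0)) (b₁ : Module.Basis κ 𝕜 (W.gr 1))
    (s : κ → MvPolynomial (Fin N) 𝕜) :
    W.phi (∑ j, s j ⊗ₜ b₁ j) = ∑ i, ((W.phiMatrix b₀ b₁).mulVec s i) ⊗ₜ b₀ i := by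
  have h : ∀ j, W.phi (s j ⊗ₜ b₁ j) = ∑ i, (W.phiMatrix b₀ b₁ i j * s j) ⊗ₜ b₀ i := by
    intro j
    rw [phi_eq_linForm, linForm_tmul]
    simp only [phiMatrix, Matrix.of_apply, Finset.sum_mul, TensorProduct.sum_tmul]
    rw [Finset.sum_comm]
    refine Finset.sum_congr rfl fun k _ => ?_
    conv_lhs => rw [← b₀.sum_repr (W.act k (b₁ j)), TensorProduct.tmul_sum]
    refine Finset.sum_congr rfl fun i _ => ?_
    rw [← TensorProduct.smul_tmul, smul_eq_C_mul, mul_assoc]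
  simp only [map_sum, h, Matrix.mulVec, dotProduct, TensorProduct.sum_tmul]
  rw [Finset.sum_comm]

theorem exists_sum_tmul {V ι : Type*} [AddCommGroup V] [Module 𝕜 V] [Fintype ι]
    (b : Module.Basis ι 𝕜 V) (x : MvPolynomial (Fin N) 𝕜 ⊗[𝕜] V) :
    ∃ s : ι → MvPolynomial (Fin N) 𝕜, x = ∑ i, s i ⊗ₜ b i :=
  ⟨_, (((Algebra.TensorProduct.basis (MvPolynomial (Fin N) 𝕜) b).sum_repr x).symm.trans
    (Finset.sum_congr rfl fun i _ => by
      rw [Algebra.TensorProduct.basis_apply, TensorProduct.smul_tmul', smul_eq_mul, mul_one]))⟩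

theorem sum_tmul_injective {V ι : Type*} [AddCommGroup V] [Module 𝕜 V] [Fintype ι]
    (b : Module.Basis ι 𝕜 V) {s t : ι → MvPolynomial (Fin N) 𝕜}
    (h : ∑ i, s i ⊗ₜ[𝕜] b i = ∑ i, t i ⊗ₜ[𝕜] b i) : s = t := by
  classical
  have key : ∀ s : ι → MvPolynomial (Fin N) 𝕜, ∑ i, s i ⊗ₜ[𝕜] b i =
      ∑ i, s i • Algebra.TensorProduct.basis (MvPolynomial (Fin N) 𝕜) b i := fun s =>
    Finset.sum_congr rfl fun i _ => by
      rw [Algebra.TensorProduct.basis_apply, TensorProduct.smul_tmul', smul_eq_mul, mul_one]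
  rw [key, key] at h
  funext i
  have := congrArg (fun y => (Algebra.TensorProduct.basis (MvPolynomial (Fin N) 𝕜) b).repr y i) h
  simpa [Finsupp.single_apply] using this

variable [CharZero 𝕜]

theorem hasLinearPresentation_cok (hN : 0 < N) (W : GrClMod.{w} 𝕜 N) :
    HasLinearPresentation 𝕜 N W.cokGr := by
  let b₀ := Module.finBasis 𝕜 (W.gr 0)
  -- Transporting the basis along the isomorphism `e₀ : W₁ ≃ W₀` makes the presentation matrix
  -- square; this is where a generator must exist.
  let b₁ : Module.Basis (Fin (Module.finrank 𝕜 (W.gr 0))) 𝕜 (W.gr 1) :=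
    b₀.map (W.actEquiv ⟨0, hN⟩).symm
  let Φ := (W.phiMatrix b₀ b₁).map (toY 𝕜 N)
  let p := Fintype.linearCombination (YRing 𝕜 N) fun i => W.toCok (1 ⊗ₜ b₀ i)
  have hp : ∀ s : Fin (Module.finrank 𝕜 (W.gr 0)) → MvPolynomial (Fin N) 𝕜,
      p (fun i => toY 𝕜 N (s i)) = W.toCok (∑ i, s i ⊗ₜ b₀ i) := by
    intro s
    rw [Fintype.linearCombination_apply, map_sum]
    refine Finset.sum_congr rfl fun i _ => ?_
    rw [toY_smul, ← map_smul, TensorProduct.smul_tmul', smul_eq_mul, mul_one]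
  have hlift : ∀ y : Fin (Module.finrank 𝕜 (W.gr 0)) → YRing 𝕜 N,
      ∃ s : Fin (Module.finrank 𝕜 (W.gr 0)) → MvPolynomial (Fin N) 𝕜,
        (fun i => toY 𝕜 N (s i)) = y := by
    intro y
    choose s hs using fun i => Ideal.Quotient.mk_surjective (y i)
    exact ⟨s, funext hs⟩
  have hΦ : ∀ s : Fin (Module.finrank 𝕜 (W.gr 0)) → MvPolynomial (Fin N) 𝕜,
      Φ.mulVec (fun i => toY 𝕜 N (s i)) =
        fun i => toY 𝕜 N ((W.phiMatrix b₀ b₁).mulVec s i) := by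
    intro s
    funext i
    simp only [Φ, Matrix.mulVec, dotProduct, map_sum, map_mul, Matrix.map_apply]
  refine ⟨_, Φ, p, fun i j => ⟨_, W.isHomogeneous_phiMatrix b₀ b₁ i j, rfl⟩, fun i => ?_, ?_, ?_⟩
  · simp only [p, Fintype.linearCombination_apply_single, one_smul]
    exact W.toCok_one_tmul_mem _
  · intro m
    obtain ⟨x, rfl⟩ := W.toCok_surjective m
    obtain ⟨s, rfl⟩ := exists_sum_tmul b₀ x
    exact ⟨_, hp s⟩
  · ext y
    obtain ⟨r, rfl⟩ := hlift y
    rw [LinearMap.mem_ker, hp, toCok_eq_zero_iff, LinearMap.mem_range]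
    constructor
    · rintro ⟨t, ht⟩
      obtain ⟨s, rfl⟩ := hlift t
      rw [Matrix.mulVecLin_apply, hΦ] at ht
      have h0 : W.toCok (∑ i, r i ⊗ₜ b₀ i) = 0 := by
        rw [← hp, ← ht, hp, ← phi_sum_tmul, toCok_phi]
      exact W.toCok_eq_zero_iff.1 h0
    · rintro ⟨z, hz⟩
      obtain ⟨s, rfl⟩ := exists_sum_tmul b₁ z
      rw [W.phi_sum_tmul b₀ b₁] at hz
      have := sum_tmul_injective b₀ hz
      exact ⟨fun i => toY 𝕜 N (s i), by rw [Matrix.mulVecLin_apply, hΦ, this]⟩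

/-- The linear MCM module `coker φ_W`. -/
noncomputable def toLinMCM (hN : 0 < N) (W : GrClMod.{w} 𝕜 N) : LinMCM.{w} 𝕜 N where
  carrier := W.Cok
  gr := W.cokGr
  isGraded := W.isGradedY_cok
  isMCM := W.isMCM_cok hN
  noFree := W.noFreeSummand_cok hN
  linear := W.hasLinearPresentation_cok hN

/-- The even part of a morphism. -/
noncomputable def Hom.even {W W' : GrClMod.{w} 𝕜 N} (f : Hom W W') : W.gr 0 →ₗ[𝕜] W'.gr 0 :=
  (f.toLin.restrictScalars 𝕜).restrict (f.map_gr 0)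

/-- The odd part of a morphism. -/
noncomputable def Hom.odd {W W' : GrClMod.{w} 𝕜 N} (f : Hom W W') : W.gr 1 →ₗ[𝕜] W'.gr 1 :=
  (f.toLin.restrictScalars 𝕜).restrict (f.map_gr 1)

omit [CharZero 𝕜] in
theorem baseChange_even_phi {W W' : GrClMod.{w} 𝕜 N} (f : Hom W W') (z) :
    f.even.baseChange (MvPolynomial (Fin N) 𝕜) (W.phi z) =
      W'.phi (f.odd.baseChange (MvPolynomial (Fin N) 𝕜) z) := by
  rw [phi_eq_linForm, phi_eq_linForm]
  induction z with
  | zero => simp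
  | tmul r v =>
    simp only [linForm_tmul, map_sum, LinearMap.baseChange_tmul]
    refine Finset.sum_congr rfl fun i _ => ?_
    congr 1
    apply Subtype.ext
    exact map_smul f.toLin _ _
  | add x y hx hy => simp only [map_add, hx, hy]

/-- The map of cokernels induced by a morphism of Clifford modules. -/
noncomputable def Hom.cokMap {W W' : GrClMod.{w} 𝕜 N} (f : Hom W W') :
    W.Cok →ₗ[MvPolynomial (Fin N) 𝕜] W'.Cok :=
  Submodule.mapQ (LinearMap.range W.phi) (LinearMap.range W'.phi)
    (f.even.baseChange (MvPolynomial (Fin N) 𝕜)) (by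
      rintro _ ⟨z, rfl⟩
      exact ⟨_, (baseChange_even_phi f z).symm⟩)

omit [CharZero 𝕜] in
theorem homZ_baseChange {V V' : Type*} [AddCommGroup V] [Module 𝕜 V] [AddCommGroup V']
    [Module 𝕜 V'] (f : V →ₗ[𝕜] V') (n : ℤ) (x : MvPolynomial (Fin N) 𝕜 ⊗[𝕜] V) :
    homZ N V' n (f.baseChange (MvPolynomial (Fin N) 𝕜) x) =
      f.baseChange (MvPolynomial (Fin N) 𝕜) (homZ N V n x) := by
  rcases lt_or_ge n 0 with hn | hn
  · simp [homZ_of_neg hn]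
  lift n to ℕ using hn
  induction x with
  | zero => simp
  | tmul r v => simp
  | add x y hx hy => simp only [map_add, hx, hy]

/-- The morphism of linear MCM modules induced by a morphism of Clifford modules. -/
noncomputable def Hom.toLinMCMHom (hN : 0 < N) {W W' : GrClMod.{w} 𝕜 N} (f : Hom W W') :
    LinMCM.Hom (W.toLinMCM hN) (W'.toLinMCM hN) where
  toLin :=
    { toFun := f.cokMap
      map_add' := map_add f.cokMap
      map_smul' := fun a m => by
        obtain ⟨r, rfl⟩ := Ideal.Quotient.mk_surjective a
        exact f.cokMap.map_smul r m }
  map_gr := by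
    rintro n _ ⟨x, rfl⟩
    exact ⟨f.even.baseChange _ x, congrArg W'.toCok (homZ_baseChange f.even n x)⟩

theorem linMCMHom_ext (hN : 0 < N) {W : GrClMod.{w} 𝕜 N} {M : LinMCM.{w} 𝕜 N}
    {f g : LinMCM.Hom (W.toLinMCM hN) M}
    (h : ∀ v : W.gr 0, f.toLin (W.toCok (1 ⊗ₜ v)) = g.toLin (W.toCok (1 ⊗ₜ v))) : f = g := by
  apply LinMCM.Hom.ext
  ext m
  obtain ⟨x, rfl⟩ := W.toCok_surjective m
  induction x with
  | zero =>
    rw [map_zero]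
    exact (map_zero f.toLin).trans (map_zero g.toLin).symm
  | tmul r v =>
    have : W.toCok (r ⊗ₜ[𝕜] v) = toY 𝕜 N r • W.toCok (1 ⊗ₜ[𝕜] v) := by
      rw [toY_smul, ← map_smul, TensorProduct.smul_tmul', smul_eq_mul, mul_one]
    rw [this]
    exact (map_smul f.toLin _ _).trans ((congrArg _ (h v)).trans (map_smul g.toLin _ _).symm)
  | add x y hx hy =>
    rw [map_add]
    exact (map_add f.toLin _ _).trans ((congrArg₂ _ hx hy).trans (map_add g.toLin _ _).symm)

/-- The functor `W ↦ coker φ_W`. -/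
noncomputable def cokFunctor (𝕜 : Type) [Field 𝕜] [CharZero 𝕜] (N : ℕ) (hN : 0 < N) :
    GrClMod.{w} 𝕜 N ⥤ LinMCM.{w} 𝕜 N where
  obj W := W.toLinMCM hN
  map f := Hom.toLinMCMHom hN f
  map_id _ := linMCMHom_ext hN fun _ => rfl
  map_comp _ _ := linMCMHom_ext hN fun _ => rfl

/-- A degree `0` map `coker φ_W → M` is determined on `W₀`, and maps `W₀` to the degree `0` part
of `coker φ_W'`, which is `W'₀`. -/
theorem exists_even_of_hom (hN : 0 < N) {W W' : GrClMod.{w} 𝕜 N}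
    (g : LinMCM.Hom (W.toLinMCM hN) (W'.toLinMCM hN)) :
    ∃ f₀ : W.gr 0 →ₗ[𝕜] W'.gr 0, ∀ v, g.toLin (W.toCok (1 ⊗ₜ v)) = W'.toCok (1 ⊗ₜ f₀ v) := by
  have h : ∀ v : W.gr 0, ∃ u : W'.gr 0, g.toLin (W.toCok (1 ⊗ₜ v)) = W'.toCok (1 ⊗ₜ u) := by
    intro v
    obtain ⟨u, hu⟩ := W'.exists_of_mem_cokGr_zero (g.map_gr 0 _ (W.toCok_one_tmul_mem v))
    exact ⟨u, hu.symm⟩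
  choose f hf using h
  have inj : ∀ u u' : W'.gr 0, W'.toCok (1 ⊗ₜ u) = W'.toCok (1 ⊗ₜ u') → u = u' := by
    intro u u' e
    rw [← sub_eq_zero, ← map_sub, ← TensorProduct.tmul_sub] at e
    exact sub_eq_zero.1 (W'.toCok_one_tmul_eq_zero e)
  have hsmul : ∀ (U : GrClMod.{w} 𝕜 N) (c : 𝕜) (u : U.gr 0),
      U.toCok (1 ⊗ₜ (c • u)) = toY 𝕜 N (C c) • U.toCok (1 ⊗ₜ u) := by
    intro U c u
    rw [toY_smul, ← map_smul, TensorProduct.smul_tmul', smul_eq_mul, ← smul_eq_C_mul,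
      TensorProduct.smul_tmul]
  refine ⟨{ toFun := f, map_add' := fun u v => inj _ _ ?_, map_smul' := fun c v => inj _ _ ?_ }, hf⟩
  · rw [← hf, TensorProduct.tmul_add, TensorProduct.tmul_add, map_add, map_add, ← hf, ← hf]
    exact map_add g.toLin _ _
  · rw [← hf, RingHom.id_apply, hsmul, hsmul, ← hf]
    exact map_smul g.toLin _ _

omit [CharZero 𝕜] in
theorem iSup_gr (W : GrClMod.{w} 𝕜 N) : W.gr 0 ⊔ W.gr 1 = ⊤ := by
  rw [← W.isInternal.submodule_iSup_eq_top]
  apply le_antisymm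
  · exact sup_le (le_iSup W.gr 0) (le_iSup W.gr 1)
  · refine iSup_le fun i => ?_
    fin_cases i
    · exact le_sup_left
    · exact le_sup_right

omit [CharZero 𝕜] in
theorem hom_ext (W : GrClMod.{w} 𝕜 N) {M : Type*} [AddCommGroup M] [Module (Cl 𝕜 N) M]
    {f g : W.carrier →ₗ[Cl 𝕜 N] M} (h₀ : ∀ v : W.gr 0, f v = g v) (h₁ : ∀ v : W.gr 1, f v = g v) :
    f = g := by
  ext x
  have hx : x ∈ W.gr 0 ⊔ W.gr 1 := by rw [iSup_gr]; trivial
  obtain ⟨y, hy, z, hz, rfl⟩ := Submodule.mem_sup.1 hx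
  rw [map_add, map_add, h₀ ⟨y, hy⟩, h₁ ⟨z, hz⟩]

omit [CharZero 𝕜] in
theorem isCompl_gr (W : GrClMod.{w} 𝕜 N) : IsCompl (W.gr 0) (W.gr 1) :=
  ⟨W.isInternal.submodule_iSupIndep.pairwiseDisjoint (by decide : (0 : ZMod 2) ≠ 1),
    codisjoint_iff.2 W.iSup_gr⟩

/-- A linear map `W₀ → W'₀` extends to a morphism if it maps the image of `φ_W` in degree `1`
to the image of `φ_W'`. -/
theorem exists_hom_of_even (hN : 0 < N) (W : GrClMod.{w} 𝕜 N) {W' : GrClMod.{w} 𝕜 N}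
    (f₀ : W.gr 0 →ₗ[𝕜] W'.gr 0)
    (h : ∀ u : W.gr 1, ∃ z, W'.phi z = ∑ i, (X i : MvPolynomial (Fin N) 𝕜) ⊗ₜ f₀ (W.act i u)) :
    ∃ f : Hom W W', ∀ v, f.even v = f₀ v := by
  have h1 : ∀ u : W.gr 1, ∃ u' : W'.gr 1, ∀ i, f₀ (W.act i u) = W'.act i u' := by
    intro u
    obtain ⟨z, hz⟩ := h u
    obtain ⟨u', hu'⟩ := exists_homComp_zero_eq z
    refine ⟨u', eq_of_sum_X_tmul_eq (𝕜 := 𝕜) ?_⟩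
    -- In degree `1` only the constant part `1 ⊗ u'` of `z` contributes, and the coefficients of the
    -- separate variables can then be compared.
    have := congrArg (homComp N (W'.gr 0) 1) hz
    rw [phi_eq_linForm, homComp_linForm W'.act 0, hu', linForm_one_tmul] at this
    rw [this, map_sum]
    refine Finset.sum_congr rfl fun i _ => ?_
    rw [homComp_tmul, homogeneousComponent_eq_self (isHomogeneous_X 𝕜 i)]
  -- Since `e₀² = 1`, commutation with `e₀` alone forces this odd part; the vector `u'` above shows
  -- that it is compatible with the other generators too.
  let f₁ : W.gr 1 →ₗ[𝕜] W'.gr 1 := W'.actUp ⟨0, hN⟩ ∘ₗ f₀ ∘ₗ W.act ⟨0, hN⟩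
  have h2 : ∀ i u, f₀ (W.act i u) = W'.act i (f₁ u) := by
    intro i u
    obtain ⟨u', hu'⟩ := h1 u
    have : f₁ u = u' := by
      change W'.actUp ⟨0, hN⟩ (f₀ (W.act ⟨0, hN⟩ u)) = u'
      rw [hu', actUp_act]
    rw [this, hu']
  have h3 : ∀ i v, f₁ (W.actUp i v) = W'.actUp i (f₀ v) := by
    intro i v
    rw [← actUp_act W' i (f₁ _), ← h2, act_actUp]
  let F : W.carrier →ₗ[𝕜] W'.carrier := LinearMap.ofIsCompl W.isCompl_gr
    ((W'.gr 0).subtype ∘ₗ f₀) ((W'.gr 1).subtype ∘ₗ f₁)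
  have hF0 : ∀ v : W.gr 0, F v = f₀ v := fun v => LinearMap.ofIsCompl_apply_left _ _
  have hF1 : ∀ v : W.gr 1, F v = f₁ v := fun v => LinearMap.ofIsCompl_apply_right _ _
  have hgen : ∀ i x, F (Cl.gen 𝕜 N i • x) = Cl.gen 𝕜 N i • F x := by
    intro i x
    have hx : x ∈ W.gr 0 ⊔ W.gr 1 := by rw [iSup_gr]; trivial
    obtain ⟨y, hy, z, hz, rfl⟩ := Submodule.mem_sup.1 hx
    rw [smul_add, map_add, map_add, smul_add]
    congr 1
    · have := hF1 (W.actUp i ⟨y, hy⟩)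
      rw [h3] at this
      exact this.trans (congrArg _ (hF0 ⟨y, hy⟩).symm)
    · have := hF0 (W.act i ⟨z, hz⟩)
      rw [h2] at this
      exact this.trans (congrArg _ (hF1 ⟨z, hz⟩).symm)
  refine ⟨{ toLin := { F with map_smul' := Cl.map_smul_of_gen F hgen }, map_gr := ?_ },
    fun v => Subtype.ext (hF0 v)⟩
  intro i
  fin_cases i
  · exact fun m hm => (hF0 ⟨m, hm⟩).symm ▸ (f₀ _).2
  · exact fun m hm => (hF1 ⟨m, hm⟩).symm ▸ (f₁ _).2

variable {hN : 0 < N}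

instance : (cokFunctor.{w} 𝕜 N hN).Faithful where
  map_injective {W W'} f g h := by
    have h0 : ∀ v : W.gr 0, f.toLin v = g.toLin v := by
      intro v
      have e : W'.toCok (1 ⊗ₜ Hom.even f v) = W'.toCok (1 ⊗ₜ Hom.even g v) :=
        congrArg (fun k : LinMCM.Hom (W.toLinMCM hN) (W'.toLinMCM hN) =>
          k.toLin (W.toCok (1 ⊗ₜ v))) h
      rw [← sub_eq_zero, ← map_sub, ← TensorProduct.tmul_sub] at e
      exact congrArg Subtype.val (sub_eq_zero.1 (W'.toCok_one_tmul_eq_zero e))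
    have h1 : ∀ v : W.gr 1, f.toLin v = g.toLin v := by
      intro v
      rw [← W.actUp_act ⟨0, hN⟩ v, coe_actUp]
      exact (map_smul f.toLin _ _).trans ((congrArg _ (h0 _)).trans (map_smul g.toLin _ _).symm)
    exact Hom.ext (W.hom_ext h0 h1)

/-- A morphism of cokernels carries the relation `∑ λ_i e_i u = 0` to `∑ λ_i f₀(e_i u) = 0`, which
is the extension criterion of `exists_hom_of_even`. -/
instance : (cokFunctor.{w} 𝕜 N hN).Full where
  map_surjective {W W'} g := by
    obtain ⟨f₀, hf₀⟩ := exists_even_of_hom hN g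
    obtain ⟨f, hf⟩ := W.exists_hom_of_even hN f₀ fun u => by
      have : g.toLin (W.toCok (W.phi (1 ⊗ₜ u))) = 0 := by
        rw [toCok_phi]; exact map_zero g.toLin
      rw [phi_eq_linForm, linForm_one_tmul, map_sum] at this
      have h2 : ∀ i, g.toLin (W.toCok (X i ⊗ₜ W.act i u)) =
          W'.toCok (X i ⊗ₜ f₀ (W.act i u)) := by
        intro i
        have h3 : ∀ (U : GrClMod.{w} 𝕜 N) (v : U.gr 0), U.toCok (X i ⊗ₜ v) =
            toY 𝕜 N (X i) • U.toCok (1 ⊗ₜ v) := by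
          intro U v
          rw [toY_smul, ← map_smul, TensorProduct.smul_tmul', smul_eq_mul, mul_one]
        rw [h3, h3, ← hf₀]
        exact map_smul g.toLin _ _
      have h4 := (map_sum g.toLin (fun i => W.toCok (X i ⊗ₜ W.act i u)) Finset.univ).symm.trans this
      rw [← W'.toCok_eq_zero_iff, map_sum]
      exact (Finset.sum_congr rfl fun i _ => (h2 i).symm).trans h4
    exact ⟨f, linMCMHom_ext hN fun v => ((hf₀ v).trans (by rw [← hf v]; rfl)).symm⟩

end GrClMod

/-! ### Regular sequences of linear forms -/

section LinearRegular

variable {𝕜 : Type} [Field 𝕜] {N : ℕ}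

/-- The linear form with given coefficients. -/
noncomputable def linPoly (𝕜 : Type) [Field 𝕜] (N : ℕ) :
    (Fin N → 𝕜) →ₗ[𝕜] MvPolynomial (Fin N) 𝕜 :=
  Fintype.linearCombination 𝕜 X

theorem linPoly_single (i : Fin N) : linPoly 𝕜 N (Pi.single i 1) = X i := by
  simp [linPoly, Fintype.linearCombination_apply_single]

theorem isHomogeneous_linPoly (c : Fin N → 𝕜) : (linPoly 𝕜 N c).IsHomogeneous 1 := by
  rw [linPoly, Fintype.linearCombination_apply]
  refine IsHomogeneous.sum _ _ _ fun i _ => ?_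
  rw [smul_eq_C_mul]
  exact isHomogeneous_C_mul_X _ _

theorem linPoly_mem_idealOfVars (c : Fin N → 𝕜) : linPoly 𝕜 N c ∈ idealOfVars (Fin N) 𝕜 := by
  rw [linPoly, Fintype.linearCombination_apply]
  refine Ideal.sum_mem _ fun i _ => ?_
  rw [smul_eq_C_mul]
  exact Ideal.mul_mem_left _ _ (Ideal.subset_span ⟨i, rfl⟩)

theorem eq_idealOfVars_of_isPrime {P : Ideal (MvPolynomial (Fin N) 𝕜)} [hP : P.IsPrime]
    (h : idealOfVars (Fin N) 𝕜 ≤ P) : P = idealOfVars (Fin N) 𝕜 := by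
  refine le_antisymm (fun p hp => ?_) h
  have hc : p - C (constantCoeff p) ∈ idealOfVars (Fin N) 𝕜 := by
    rw [← pow_one (idealOfVars (Fin N) 𝕜), mem_pow_idealOfVars_iff']
    intro x hx
    have : x = 0 := (Finsupp.degree_eq_zero_iff x).1 (by simpa using hx)
    subst this
    simp [constantCoeff_eq]
  by_cases h0 : constantCoeff p = 0
  · simpa [h0] using hc
  · exfalso
    apply hP.ne_top
    have h1 : C (constantCoeff p) ∈ P := by
      have := P.sub_mem hp (h hc)
      rwa [sub_sub_cancel] at this
    exact Ideal.eq_top_of_isUnit_mem _ h1 ((IsUnit.mk0 _ h0).map C)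

/-- The linear forms inside an associated prime `P` form a proper subspace: otherwise `P` is the
irrelevant ideal and embeds the residue field in `L`. A space over an infinite field is not a finite
union of proper subspaces, so some form avoids all of these and `U`. -/
theorem exists_linPoly_isSMulRegular [Infinite 𝕜] (L : Type*) [AddCommGroup L]
    [Module (MvPolynomial (Fin N) 𝕜) L] [Module.Finite (MvPolynomial (Fin N) 𝕜) L]
    (hL : Subsingleton ((MvPolynomial (Fin N) 𝕜 ⧸ idealOfVars (Fin N) 𝕜)
      →ₗ[MvPolynomial (Fin N) 𝕜] L))
    (U : Submodule 𝕜 (Fin N → 𝕜)) (hU : U ≠ ⊤) :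
    ∃ c ∉ U, IsSMulRegular L (linPoly 𝕜 N c) := by
  classical
  let S : Ideal (MvPolynomial (Fin N) 𝕜) → Submodule 𝕜 (Fin N → 𝕜) := fun P =>
    (P.restrictScalars 𝕜).comap (linPoly 𝕜 N)
  have hfin := associatedPrimes.finite (MvPolynomial (Fin N) 𝕜) L
  let s : Finset (Subspace 𝕜 (Fin N → 𝕜)) := insert U (hfin.toFinset.image S)
  have hs : (⊤ : Subspace 𝕜 (Fin N → 𝕜)) ∉ s := by
    simp only [s, Finset.mem_insert, Finset.mem_image, Set.Finite.mem_toFinset, not_or, not_exists,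
      not_and]
    refine ⟨hU.symm, fun P hP hPS => ?_⟩
    have hP' := hP
    rw [AssociatedPrimes.mem_iff, isAssociatedPrime_iff_exists_injective_linearMap] at hP'
    obtain ⟨hprime, f, hf⟩ := hP'
    have hle : idealOfVars (Fin N) 𝕜 ≤ P := by
      rw [idealOfVars, Ideal.span_le]
      rintro _ ⟨i, rfl⟩
      have : Pi.single i 1 ∈ S P := by rw [hPS]; trivial
      rw [← linPoly_single]
      exact this
    obtain rfl := eq_idealOfVars_of_isPrime hle
    have h1 : f 1 = 0 := by rw [Subsingleton.elim f 0]; rfl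
    exact hprime.ne_top ((Ideal.eq_top_iff_one _).2
      (Ideal.Quotient.eq_zero_iff_mem.1 (hf (h1.trans (map_zero f).symm))))
  have := Subspace.biUnion_ne_univ_of_top_notMem hs
  obtain ⟨c, hc⟩ := (Set.ne_univ_iff_exists_notMem _).1 this
  simp only [s, Set.mem_iUnion, Finset.mem_insert, Finset.mem_image, Set.Finite.mem_toFinset,
    not_exists] at hc
  refine ⟨c, fun h => hc U (Or.inl rfl) h, ?_⟩
  by_contra hreg
  have : linPoly 𝕜 N c ∈ {r : MvPolynomial (Fin N) 𝕜 | IsSMulRegular L r}ᶜ := hreg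
  rw [← biUnion_associatedPrimes_eq_compl_regular] at this
  simp only [Set.mem_iUnion] at this
  obtain ⟨P, hP, hcP⟩ := this
  exact hc (S P) (Or.inr ⟨P, hP, rfl⟩) hcP

-- Dividing by a regular element costs one degree of `Ext` vanishing, by the long exact sequence.
-- The subspace `U` collects the forms already chosen, so that the new ones stay independent and `N`
-- of them generate the irrelevant ideal.
open Abelian in
theorem exists_linPoly_isWeaklyRegular [Infinite 𝕜] (r : ℕ)
    (L : ModuleCat.{0} (MvPolynomial (Fin N) 𝕜)) [Module.Finite (MvPolynomial (Fin N) 𝕜) L]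
    (U : Submodule 𝕜 (Fin N → 𝕜)) (hU : Module.finrank 𝕜 U + r ≤ N)
    (hE : ∀ i < r, Subsingleton (Ext (ModuleCat.of (MvPolynomial (Fin N) 𝕜)
      (MvPolynomial (Fin N) 𝕜 ⧸ idealOfVars (Fin N) 𝕜)) L i)) :
    ∃ cs : List (Fin N → 𝕜), cs.length = r ∧
      RingTheory.Sequence.IsWeaklyRegular L (cs.map (linPoly 𝕜 N)) ∧
      Module.finrank 𝕜 (U ⊔ Submodule.span 𝕜 {c | c ∈ cs} : Submodule 𝕜 (Fin N → 𝕜)) =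
        Module.finrank 𝕜 U + r := by
  induction r generalizing L U with
  | zero =>
    have h : {c : Fin N → 𝕜 | c ∈ ([] : List (Fin N → 𝕜))} = ∅ := by ext; simp
    exact ⟨[], rfl, by simp, by rw [h, Submodule.span_empty, sup_bot_eq, add_zero]⟩
  | succ r ih =>
    have h0 : Subsingleton ((MvPolynomial (Fin N) 𝕜 ⧸ idealOfVars (Fin N) 𝕜)
        →ₗ[MvPolynomial (Fin N) 𝕜] L) := by
      have := hE 0 (Nat.succ_pos r)
      exact (Ext.addEquiv₀.trans (ModuleCat.homAddEquiv (M := ModuleCat.of _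
        (MvPolynomial (Fin N) 𝕜 ⧸ idealOfVars (Fin N) 𝕜)) (N := L))).symm.toEquiv.subsingleton
    have hUtop : U ≠ ⊤ := by
      rintro rfl
      rw [finrank_top, Module.finrank_fin_fun] at hU
      omega
    obtain ⟨c, hcU, hc⟩ := exists_linPoly_isSMulRegular L h0 U hUtop
    have hfr : Module.finrank 𝕜 (U ⊔ Submodule.span 𝕜 {c} : Submodule 𝕜 (Fin N → 𝕜)) =
        Module.finrank 𝕜 U + 1 := Submodule.finrank_sup_span_singleton hcU
    obtain ⟨cs, hl, hreg, hf⟩ := ih (ModuleCat.of _ (QuotSMulTop (linPoly 𝕜 N c) L))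
      (U ⊔ Submodule.span 𝕜 {c}) (by omega) (by
        intro i hi
        have zero1 := AddCommGrpCat.isZero_of_iff_subsingleton.mpr (hE i (by omega))
        have zero2 := AddCommGrpCat.isZero_of_iff_subsingleton.mpr (hE (i + 1) (by omega))
        exact AddCommGrpCat.subsingleton_of_isZero <| ShortComplex.Exact.isZero_of_both_zeros
          ((Ext.covariant_sequence_exact₃' _ hc.smulShortComplex_shortExact) i (i + 1) rfl)
          (zero1.eq_zero_of_src _) (zero2.eq_zero_of_tgt _))
    refine ⟨c :: cs, by simp [hl], ?_, ?_⟩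
    · rw [List.map_cons, RingTheory.Sequence.isWeaklyRegular_cons_iff]
      exact ⟨hc, hreg⟩
    · have : {d | d ∈ c :: cs} = {c} ∪ {d | d ∈ cs} := by ext; simp
      rw [this, Submodule.span_union, ← sup_assoc, hf, hfr]
      omega

theorem ofList_map_linPoly {cs : List (Fin N → 𝕜)}
    (h : Submodule.span 𝕜 {c | c ∈ cs} = ⊤) :
    Ideal.ofList (cs.map (linPoly 𝕜 N)) = idealOfVars (Fin N) 𝕜 := by
  apply le_antisymm
  · rw [Ideal.ofList, Ideal.span_le]
    intro x hx
    obtain ⟨c, -, rfl⟩ := List.mem_map.1 hx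
    exact linPoly_mem_idealOfVars c
  · rw [idealOfVars, Ideal.span_le]
    rintro _ ⟨i, rfl⟩
    have hi : Pi.single i 1 ∈ Submodule.span 𝕜 {c | c ∈ cs} := by rw [h]; trivial
    have : Submodule.span 𝕜 {c | c ∈ cs} ≤
        ((Ideal.ofList (cs.map (linPoly 𝕜 N))).restrictScalars 𝕜).comap (linPoly 𝕜 N) := by
      rw [Submodule.span_le]
      intro c hc
      exact Ideal.subset_span (List.mem_map.2 ⟨c, hc, rfl⟩)
    have := this hi
    rwa [Submodule.mem_comap, linPoly_single] at this

theorem isWeaklyRegular_varList_pi (n : ℕ) :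
    RingTheory.Sequence.IsWeaklyRegular (Fin n → MvPolynomial (Fin N) 𝕜) (varList 𝕜 N N) := by
  refine ⟨fun i hi => ?_⟩
  have hi' : i < N := by rwa [length_varList le_rfl] at hi
  rw [take_varList hi'.le, ofList_varList, isSMulRegular_quotient_iff_mem_of_smul_mem]
  have e : (varList 𝕜 N N)[i] = X ⟨i, by omega⟩ := by simp [varList]
  rw [e]
  exact fun x hx => (Pi.basisFun _ _).mem_smul_top_of_smul_mem
    (fun r => mem_varIdeal_of_mul_mem (X_notMem_varIdeal (⟨i, by omega⟩ : Fin N))) hx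

-- This is the depth lemma for `0 → K → F → M → 0`. `Ext` into `F` vanishes below `N` because all
-- the variables form a regular sequence, and into `M` below `N - 1`; the connecting map gives `K`
-- one degree more than `M`.
open Abelian in
theorem subsingleton_ext_ker (hN : 0 < N) {n : ℕ} {M : Type} [AddCommGroup M]
    [Module (MvPolynomial (Fin N) 𝕜) M]
    (π : (Fin n → MvPolynomial (Fin N) 𝕜) →ₗ[MvPolynomial (Fin N) 𝕜] M)
    (hπ : Function.Surjective π)
    (hM : idealOfVars (Fin N) 𝕜 • (⊤ : Submodule (MvPolynomial (Fin N) 𝕜) M) ≠ ⊤)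
    {rs : List (MvPolynomial (Fin N) 𝕜)} (hrs : ∀ r ∈ rs, r ∈ idealOfVars (Fin N) 𝕜)
    (hreg : RingTheory.Sequence.IsWeaklyRegular M rs) (hl : N - 1 ≤ rs.length) (i : ℕ)
    (hi : i < N) :
    Subsingleton (Ext (ModuleCat.of (MvPolynomial (Fin N) 𝕜)
      (MvPolynomial (Fin N) 𝕜 ⧸ idealOfVars (Fin N) 𝕜))
      (ModuleCat.of (MvPolynomial (Fin N) 𝕜) (LinearMap.ker π)) i) := by
  have : Module.Finite (MvPolynomial (Fin N) 𝕜) M := Module.Finite.of_surjective π hπ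
  have hsupp : Module.support (MvPolynomial (Fin N) 𝕜)
      (MvPolynomial (Fin N) 𝕜 ⧸ idealOfVars (Fin N) 𝕜) ⊆
      PrimeSpectrum.zeroLocus (idealOfVars (Fin N) 𝕜) := by
    rw [Module.support_eq_zeroLocus, Ideal.annihilator_quotient]
  have hF : idealOfVars (Fin N) 𝕜 •
      (⊤ : Submodule (MvPolynomial (Fin N) 𝕜) (Fin n → MvPolynomial (Fin N) 𝕜)) ≠ ⊤ := by
    intro h
    apply hM
    rw [← LinearMap.range_eq_top.2 hπ, ← Submodule.map_top, ← Submodule.map_smul'', h]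
  have hEM := ModuleCat.subsingleton_ext_of_exists_isRegular (idealOfVars (Fin N) 𝕜)
    (ModuleCat.of _ (MvPolynomial (Fin N) 𝕜 ⧸ idealOfVars (Fin N) 𝕜)) hsupp
    (ModuleCat.of _ M) hM.lt_top rs hrs (isRegular_of_smul_ne_top hM hrs hreg)
  have hv : ∀ r ∈ varList 𝕜 N N, r ∈ idealOfVars (Fin N) 𝕜 := by
    intro r hr
    obtain ⟨j, rfl⟩ := mem_varList hr
    exact Ideal.subset_span ⟨j, rfl⟩
  have hEF := ModuleCat.subsingleton_ext_of_exists_isRegular (idealOfVars (Fin N) 𝕜)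
    (ModuleCat.of _ (MvPolynomial (Fin N) 𝕜 ⧸ idealOfVars (Fin N) 𝕜)) hsupp
    (ModuleCat.of _ (Fin n → MvPolynomial (Fin N) 𝕜)) hF.lt_top _ hv
    (isRegular_of_smul_ne_top hF hv (isWeaklyRegular_varList_pi n)) i
    (by rwa [length_varList le_rfl])
  have hS := LinearMap.shortExact_shortComplexKer hπ
  cases i with
  | zero =>
    have := hS.mono_f
    exact (Ext.postcomp_mk₀_injective_of_mono _ π.shortComplexKer.f).subsingleton
  | succ i =>
    refine ⟨fun x y => ?_⟩
    rw [← sub_eq_zero]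
    obtain ⟨z, hz⟩ := Ext.covariant_sequence_exact₁ _ hS (x - y) (hEF.elim _ _) rfl
    have := hEM i (by omega)
    rw [← hz, Subsingleton.elim z 0, Ext.zero_comp]

end LinearRegular

/-! ### Homogeneous vectors over the polynomial ring -/

section HomogeneousVectors

variable {𝕜 : Type} [Field 𝕜] {N : ℕ} {ι : Type*}

/-- The componentwise homogeneous component of a vector of polynomials. -/
noncomputable def vecComp (𝕜 : Type) [Field 𝕜] (N : ℕ) (ι : Type*) (d : ℕ) :
    (ι → MvPolynomial (Fin N) 𝕜) →ₗ[𝕜] (ι → MvPolynomial (Fin N) 𝕜) :=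
  (homogeneousComponent d).compLeft ι

@[simp]
theorem vecComp_apply (d : ℕ) (x : ι → MvPolynomial (Fin N) 𝕜) (i : ι) :
    vecComp 𝕜 N ι d x i = homogeneousComponent d (x i) := rfl

theorem vecComp_smul_of_isHomogeneous {a : MvPolynomial (Fin N) 𝕜} {e : ℕ}
    (ha : a.IsHomogeneous e) (d : ℕ) (x : ι → MvPolynomial (Fin N) 𝕜) :
    vecComp 𝕜 N ι d (a • x) = if e ≤ d then a • vecComp 𝕜 N ι (d - e) x else 0 := by
  funext i
  split_ifs with h
  · obtain ⟨k, rfl⟩ := Nat.exists_eq_add_of_le h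
    simp [homogeneousComponent_mul_of_isHomogeneous ha]
  · simp [homogeneousComponent_mul_of_isHomogeneous_of_lt ha (not_le.1 h)]

theorem vecComp_smul_mem {P : Submodule (MvPolynomial (Fin N) 𝕜) (ι → MvPolynomial (Fin N) 𝕜)}
    {x : ι → MvPolynomial (Fin N) 𝕜} (hx : ∀ d, vecComp 𝕜 N ι d x ∈ P)
    (a : MvPolynomial (Fin N) 𝕜) (d : ℕ) : vecComp 𝕜 N ι d (a • x) ∈ P := by
  rw [← sum_homogeneousComponent a, Finset.sum_smul, map_sum]
  refine P.sum_mem fun e _ => ?_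
  rw [vecComp_smul_of_isHomogeneous (homogeneousComponent_isHomogeneous e a)]
  split_ifs
  · exact P.smul_mem _ (hx _)
  · exact P.zero_mem

theorem vecComp_mem_span {s : Set (ι → MvPolynomial (Fin N) 𝕜)}
    (hs : ∀ x ∈ s, ∃ e, ∀ i, (x i).IsHomogeneous e) {x : ι → MvPolynomial (Fin N) 𝕜}
    (hx : x ∈ Submodule.span (MvPolynomial (Fin N) 𝕜) s) (d : ℕ) :
    vecComp 𝕜 N ι d x ∈ Submodule.span (MvPolynomial (Fin N) 𝕜) s := by
  induction hx using Submodule.span_induction generalizing d with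
  | mem x hx =>
    obtain ⟨e, he⟩ := hs x hx
    by_cases hd : d = e
    · have : vecComp 𝕜 N ι d x = x := by
        funext i
        rw [vecComp_apply, homogeneousComponent_of_mem (he i), if_pos hd]
      rw [this]
      exact Submodule.subset_span hx
    · have : vecComp 𝕜 N ι d x = 0 := by
        funext i
        rw [vecComp_apply, homogeneousComponent_of_mem (he i), if_neg hd]
        rfl
      rw [this]
      exact Submodule.zero_mem _
  | zero => simp
  | add x y _ _ hx hy => rw [map_add]; exact Submodule.add_mem _ (hx d) (hy d)
  | smul a x _ hx => exact vecComp_smul_mem hx a d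

theorem exists_sum_vecComp [Finite ι] (x : ι → MvPolynomial (Fin N) 𝕜) :
    ∃ D, ∑ d ∈ Finset.range D, vecComp 𝕜 N ι d x = x := by
  have := Fintype.ofFinite ι
  refine ⟨Finset.univ.sup (fun i => (x i).totalDegree) + 1, ?_⟩
  funext i
  rw [Finset.sum_apply]
  conv_rhs => rw [← sum_homogeneousComponent (x i)]
  symm
  apply Finset.sum_subset
  · intro j hj
    have := Finset.le_sup (f := fun i => (x i).totalDegree) (Finset.mem_univ i)
    simp only [Finset.mem_range] at hj ⊢
    omega
  · intro j _ hj
    apply homogeneousComponent_eq_zero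
    simpa using hj

/-- This is a Krull intersection argument without localization: vectors in the `D`-th power of the
irrelevant ideal have no components of degree below `D`, so each component of `x` is a component of
an element of `P`. -/
theorem mem_of_forall_mem_sup_pow [Finite ι]
    {P : Submodule (MvPolynomial (Fin N) 𝕜) (ι → MvPolynomial (Fin N) 𝕜)}
    (hP : ∀ x ∈ P, ∀ d, vecComp 𝕜 N ι d x ∈ P) {x : ι → MvPolynomial (Fin N) 𝕜}
    (hx : ∀ k, x ∈ P ⊔ idealOfVars (Fin N) 𝕜 ^ k • ⊤) : x ∈ P := by
  have := Fintype.ofFinite ι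
  obtain ⟨D, hD⟩ := exists_sum_vecComp x
  rw [← hD]
  refine P.sum_mem fun d hd => ?_
  obtain ⟨p, hp, y, hy, rfl⟩ := Submodule.mem_sup.1 (hx D)
  have : vecComp 𝕜 N ι d y = 0 := by
    funext i
    have hi := ((Pi.basisFun _ ι).mem_ideal_smul_top_iff _ y).1 hy i
    rw [Pi.basisFun_repr, mem_pow_idealOfVars_iff'] at hi
    ext m
    rw [vecComp_apply, coeff_homogeneousComponent]
    split_ifs with hm
    · rw [hi m (by rw [hm]; exact Finset.mem_range.1 hd)]; simp
    · simp
  rw [map_add, this, add_zero]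
  exact hP p hp d

theorem vecComp_mem_ideal_smul_top [Finite ι] {I : Ideal (MvPolynomial (Fin N) 𝕜)}
    {s : Set (MvPolynomial (Fin N) 𝕜)} (hI : I = Ideal.span s)
    (hs : ∀ x ∈ s, ∃ e, x.IsHomogeneous e) {x : ι → MvPolynomial (Fin N) 𝕜}
    (hx : x ∈ I • (⊤ : Submodule (MvPolynomial (Fin N) 𝕜) (ι → MvPolynomial (Fin N) 𝕜)))
    (d : ℕ) : vecComp 𝕜 N ι d x ∈
      I • (⊤ : Submodule (MvPolynomial (Fin N) 𝕜) (ι → MvPolynomial (Fin N) 𝕜)) := by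
  subst hI
  refine Submodule.smul_induction_on hx (fun r hr y _ => ?_) fun y z hy hz => ?_
  · induction hr using Submodule.span_induction generalizing y d with
    | mem a ha =>
      obtain ⟨e, he⟩ := hs a ha
      rw [vecComp_smul_of_isHomogeneous he]
      split_ifs
      · exact Submodule.smul_mem_smul (Ideal.subset_span ha) trivial
      · exact Submodule.zero_mem _
    | zero => simp
    | add a b _ _ ha hb =>
      rw [add_smul, map_add]
      exact Submodule.add_mem _ (ha d y trivial) (hb d y trivial)
    | smul a b _ hb =>
      rw [smul_eq_mul, mul_comm, mul_smul]
      exact hb d (a • y) trivial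
  · rw [map_add]
    exact Submodule.add_mem _ hy hz

end HomogeneousVectors

/-! ### A graded module with a full regular sequence of linear forms is free -/

section GradedFree

variable {𝕜 : Type} [Field 𝕜] {N : ℕ} {ι κ : Type*}

theorem sub_C_constantCoeff_mem (p : MvPolynomial (Fin N) 𝕜) :
    p - C (constantCoeff p) ∈ idealOfVars (Fin N) 𝕜 := by
  rw [← pow_one (idealOfVars (Fin N) 𝕜), mem_pow_idealOfVars_iff']
  intro x hx
  have : x = 0 := (Finsupp.degree_eq_zero_iff x).1 (by simpa using hx)
  subst this
  simp [constantCoeff_eq]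

/-- Graded Nakayama: iterating the inclusion places `K` in the span up to arbitrarily high powers of
the irrelevant ideal, and a span of homogeneous vectors is closed under components. -/
theorem span_eq_of_le_sup_smul [Finite ι]
    {K : Submodule (MvPolynomial (Fin N) 𝕜) (ι → MvPolynomial (Fin N) 𝕜)}
    {s : Set (ι → MvPolynomial (Fin N) 𝕜)} (hs : ∀ x ∈ s, ∃ e, ∀ i, (x i).IsHomogeneous e)
    (hK : K ≤ Submodule.span _ s ⊔ idealOfVars (Fin N) 𝕜 • K) :
    K ≤ Submodule.span _ s := by
  have h : ∀ k : ℕ, K ≤ Submodule.span _ s ⊔ idealOfVars (Fin N) 𝕜 ^ k • K := by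
    intro k
    induction k with
    | zero => simp
    | succ k ih =>
      refine ih.trans (sup_le le_sup_left ?_)
      calc idealOfVars (Fin N) 𝕜 ^ k • K
          ≤ idealOfVars (Fin N) 𝕜 ^ k • (Submodule.span _ s ⊔ idealOfVars (Fin N) 𝕜 • K) :=
            Submodule.smul_mono le_rfl hK
        _ ≤ _ := by
            rw [Submodule.smul_sup, ← Submodule.mul_smul, ← pow_succ]
            exact sup_le_sup_right Submodule.smul_le_right _
  intro x hx
  refine mem_of_forall_mem_sup_pow (fun y hy d => vecComp_mem_span hs hy d) fun k => ?_
  have hle : Submodule.span _ s ⊔ idealOfVars (Fin N) 𝕜 ^ k • K ≤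
      Submodule.span _ s ⊔ idealOfVars (Fin N) 𝕜 ^ k • ⊤ :=
    sup_le_sup le_rfl (Submodule.smul_mono le_rfl le_top)
  exact hle (h k hx)

/-- This is the inductive form of linear independence, removing one member of the regular sequence
at a time. For the full sequence it is independence modulo the irrelevant ideal; for the empty
sequence it says that relations among the `v j` are trivial. -/
theorem mem_ofList_smul_top_of_sum_mem [Fintype κ]
    {K : Submodule (MvPolynomial (Fin N) 𝕜) (ι → MvPolynomial (Fin N) 𝕜)}
    {ys : List (MvPolynomial (Fin N) 𝕜)} (hys : ∀ y ∈ ys, y.IsHomogeneous 1)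
    (hm : Ideal.ofList ys = idealOfVars (Fin N) 𝕜)
    (hreg : RingTheory.Sequence.IsWeaklyRegular K ys) (v : κ → ι → MvPolynomial (Fin N) 𝕜)
    (hv : ∀ j, v j ∈ K)
    (h0 : ∀ c : κ → 𝕜, ∑ j, (C (c j) : MvPolynomial (Fin N) 𝕜) • v j ∈ idealOfVars (Fin N) 𝕜 • K →
      c = 0) (t : ℕ) (f : κ → MvPolynomial (Fin N) 𝕜)
    (hf : ∑ j, f j • v j ∈ Ideal.ofList (ys.take (ys.length - t)) • K) :
    f ∈ Ideal.ofList (ys.take (ys.length - t)) •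
      (⊤ : Submodule (MvPolynomial (Fin N) 𝕜) (κ → MvPolynomial (Fin N) 𝕜)) := by
  induction t generalizing f with
  | zero =>
    rw [Nat.sub_zero, List.take_length, hm] at hf ⊢
    rw [(Pi.basisFun _ κ).mem_ideal_smul_top_iff]
    have h1 : ∑ j, (C (constantCoeff (f j)) : MvPolynomial (Fin N) 𝕜) • v j ∈
        idealOfVars (Fin N) 𝕜 • K := by
      have h2 : ∑ j, (f j - C (constantCoeff (f j))) • v j ∈ idealOfVars (Fin N) 𝕜 • K :=
        Submodule.sum_mem _ fun j _ =>
          Submodule.smul_mem_smul (sub_C_constantCoeff_mem _) (hv j)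
      have := Submodule.sub_mem _ hf h2
      rw [← Finset.sum_sub_distrib] at this
      simpa [sub_smul] using this
    have h2 := h0 _ h1
    intro j
    have := sub_C_constantCoeff_mem (f j)
    rw [show constantCoeff (f j) = 0 from congrFun h2 j] at this
    simpa using this
  | succ t ih =>
    -- The subtraction is truncated, so beyond the length of the list the claim no longer changes.
    rcases Nat.lt_or_ge t ys.length with hlt | hge
    swap
    · rw [show ys.length - (t + 1) = ys.length - t by omega] at hf ⊢
      exact ih f hf
    set i := ys.length - (t + 1) with hi
    have hil : i < ys.length := by omega
    have hi1 : ys.length - t = i + 1 := by omega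
    have hI : Ideal.ofList (ys.take (i + 1)) =
        Ideal.ofList (ys.take i) ⊔ Ideal.span {ys[i]} := by
      rw [List.take_succ_eq_append_getElem hil, Ideal.ofList_append, Ideal.ofList_singleton]
    have hy : ys[i] ∈ idealOfVars (Fin N) 𝕜 := by
      rw [← hm]; exact Ideal.subset_span (List.getElem_mem hil)
    have hregi : ∀ z ∈ K, ys[i] • z ∈ Ideal.ofList (ys.take i) • K →
        z ∈ Ideal.ofList (ys.take i) • K := by
      intro z hz hyz
      have := hreg.regular_mod_prev i hil
      rw [isSMulRegular_quotient_iff_mem_of_smul_mem] at this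
      have := this ⟨z, hz⟩ (by rw [Submodule.mem_smul_top_iff]; exact hyz)
      rwa [Submodule.mem_smul_top_iff] at this
    -- Write `f = h + y g` with `h` already in the smaller ideal. Regularity of `y` shows that `g`
    -- satisfies the hypothesis on `f`, so the decomposition repeats and the error is pushed into
    -- ever higher powers of the irrelevant ideal.
    refine mem_of_forall_mem_sup_pow (fun x hx d => vecComp_mem_ideal_smul_top rfl
      (fun y hy => ⟨1, hys y (List.mem_of_mem_take hy)⟩) hx d) fun k => ?_
    induction k generalizing f with
    | zero =>
      rw [pow_zero, Ideal.one_eq_top, Submodule.top_smul, sup_top_eq]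
      trivial
    | succ k ihk =>
      have h1 : f ∈ Ideal.ofList (ys.take (i + 1)) •
          (⊤ : Submodule (MvPolynomial (Fin N) 𝕜) (κ → MvPolynomial (Fin N) 𝕜)) := by
        rw [← hi1]
        refine ih f ?_
        rw [hi1, hI, Submodule.sup_smul]
        exact Submodule.mem_sup_left hf
      rw [hI, Submodule.sup_smul] at h1
      obtain ⟨h, hh, g, hg, rfl⟩ := Submodule.mem_sup.1 h1
      rw [Submodule.ideal_span_singleton_smul] at hg
      obtain ⟨g, -, rfl⟩ := Submodule.mem_smul_pointwise_iff_exists _ _ _ |>.1 hg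
      have hhK : ∑ j, h j • v j ∈ Ideal.ofList (ys.take i) • K := by
        rw [(Pi.basisFun _ κ).mem_ideal_smul_top_iff] at hh
        exact Submodule.sum_mem _ fun j _ => Submodule.smul_mem_smul (hh j) (hv j)
      have hgK : ∑ j, g j • v j ∈ Ideal.ofList (ys.take i) • K := by
        refine hregi _ (Submodule.sum_mem _ fun j _ => K.smul_mem _ (hv j)) ?_
        have := Submodule.sub_mem _ hf hhK
        rw [← Finset.sum_sub_distrib] at this
        simpa [add_smul, Finset.smul_sum, mul_smul] using this
      refine Submodule.add_mem _ (Submodule.mem_sup_left hh) ?_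
      obtain ⟨a, ha, b, hb, hab⟩ := Submodule.mem_sup.1 (ihk g hgK)
      rw [← hab, smul_add]
      refine Submodule.add_mem _ (Submodule.mem_sup_left (Submodule.smul_mem _ _ ha))
        (Submodule.mem_sup_right ?_)
      rw [pow_succ', Submodule.mul_smul]
      exact Submodule.smul_mem_smul hy hb

/-- Select generators whose classes modulo the irrelevant ideal are a basis over `𝕜`. They generate
by graded Nakayama and are independent by `mem_ofList_smul_top_of_sum_mem`. That the basis is a
subfamily of `g` matters later, when its members must be identified as linear columns. -/
theorem exists_linearIndependent_span_eq {ι κ : Type} [Finite ι] [Finite κ]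
    {K : Submodule (MvPolynomial (Fin N) 𝕜) (ι → MvPolynomial (Fin N) 𝕜)}
    {ys : List (MvPolynomial (Fin N) 𝕜)} (hys : ∀ y ∈ ys, y.IsHomogeneous 1)
    (hm : Ideal.ofList ys = idealOfVars (Fin N) 𝕜)
    (hreg : RingTheory.Sequence.IsWeaklyRegular K ys) (g : κ → ι → MvPolynomial (Fin N) 𝕜)
    (hg : ∀ j, ∃ e, ∀ i, (g j i).IsHomogeneous e)
    (hK : K = Submodule.span (MvPolynomial (Fin N) 𝕜) (Set.range g)) :
    ∃ (r : ℕ) (a : Fin r → κ), LinearIndependent (MvPolynomial (Fin N) 𝕜) (g ∘ a) ∧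
      Submodule.span (MvPolynomial (Fin N) 𝕜) (Set.range (g ∘ a)) = K := by
  have hgK : ∀ j, g j ∈ K := fun j => hK ▸ Submodule.subset_span ⟨j, rfl⟩
  let B := idealOfVars (Fin N) 𝕜 • K
  obtain ⟨τ, a', ha', hspan, hind⟩ := exists_linearIndependent' 𝕜 (fun j => B.mkQ (g j))
  have : Finite τ := Finite.of_injective a' ha'
  obtain ⟨r, ⟨e⟩⟩ := Finite.exists_equiv_fin τ
  let a : Fin r → κ := a' ∘ e.symm
  have hind' := hind.comp e.symm e.symm.injective
  have hC : ∀ (c : 𝕜) (x : ι → MvPolynomial (Fin N) 𝕜),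
      B.mkQ ((C c : MvPolynomial (Fin N) 𝕜) • x) = c • B.mkQ x := by
    intro c x
    rw [map_smul, ← algebraMap_eq, algebraMap_smul]
  have hspan' : K ≤ Submodule.span _ (Set.range (g ∘ a)) := by
    apply span_eq_of_le_sup_smul
    · rintro _ ⟨j, rfl⟩; exact hg _
    · conv_lhs => rw [hK]
      rw [Submodule.span_le]
      rintro _ ⟨j, rfl⟩
      have hj : B.mkQ (g j) ∈ Submodule.span 𝕜 (Set.range fun i => B.mkQ (g (a i))) := by
        have : B.mkQ (g j) ∈ Submodule.span 𝕜 (Set.range fun j => B.mkQ (g j)) :=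
          Submodule.subset_span ⟨j, rfl⟩
        rw [← hspan] at this
        have he : (Set.range fun i => B.mkQ (g (a i))) =
            Set.range ((fun j => B.mkQ (g j)) ∘ a') :=
          e.symm.surjective.range_comp ((fun j => B.mkQ (g j)) ∘ a')
        rwa [he]
      obtain ⟨c, hc⟩ := (Submodule.mem_span_range_iff_exists_fun 𝕜).1 hj
      have h2 : g j - ∑ i, (C (c i) : MvPolynomial (Fin N) 𝕜) • g (a i) ∈ B := by
        rw [← Submodule.ker_mkQ B, LinearMap.mem_ker, map_sub, map_sum]
        simp only [hC, hc, sub_self]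
      rw [← sub_add_cancel (g j) (∑ i, (C (c i) : MvPolynomial (Fin N) 𝕜) • g (a i))]
      refine Submodule.add_mem _ (Submodule.mem_sup_right h2) (Submodule.mem_sup_left ?_)
      exact Submodule.sum_mem _ fun i _ =>
        Submodule.smul_mem _ _ (Submodule.subset_span ⟨i, rfl⟩)
  refine ⟨r, a, ?_, le_antisymm ?_ hspan'⟩
  · rw [Fintype.linearIndependent_iff]
    intro f hf
    have := mem_ofList_smul_top_of_sum_mem hys hm hreg (fun j => g (a j)) (fun j => hgK _) (by
      intro c hc
      have h2 : ∑ i, c i • B.mkQ (g (a i)) = 0 := by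
        simp only [← hC, ← map_sum]
        rwa [← LinearMap.mem_ker, Submodule.ker_mkQ]
      funext j
      exact Fintype.linearIndependent_iff.1 hind' c h2 j) ys.length f (by
        rw [show ∑ j, f j • g (a j) = 0 from hf]
        exact Submodule.zero_mem _)
    rw [Nat.sub_self, List.take_zero, Ideal.ofList_nil, Submodule.bot_smul,
      Submodule.mem_bot] at this
    exact fun i => congrFun this i
  · rw [Submodule.span_le]
    rintro _ ⟨j, rfl⟩
    exact hgK _

end GradedFree

/-! ### Linear graded MCM modules come from matrix factorizations -/

/-- The functional splits the inclusion of the submodule generated by `m`, with its kernel as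
complement. -/
theorem not_noFreeSummand_of_eq_one {A M : Type*} [CommRing A] [AddCommGroup M] [Module A M]
    (f : M →ₗ[A] A) {m : M} (h : f m = 1) : ¬ NoFreeSummand A M := by
  intro hM
  have hf : f ∘ₗ LinearMap.toSpanSingleton A M m = LinearMap.id := by
    ext; simp [h]
  have hinj : Function.Injective (LinearMap.toSpanSingleton A M m) :=
    Function.LeftInverse.injective (g := f) fun x => LinearMap.congr_fun hf x
  refine hM ⟨LinearMap.range (LinearMap.toSpanSingleton A M m), LinearMap.ker f, ⟨?_, ?_⟩,
    ⟨(LinearEquiv.ofInjective _ hinj).symm⟩⟩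
  · rw [Submodule.disjoint_def]
    rintro _ ⟨a, rfl⟩ ha
    have : a = 0 := (LinearMap.congr_fun hf a).symm.trans ha
    rw [this, map_zero]
  · rw [codisjoint_iff, Submodule.eq_top_iff']
    intro x
    refine Submodule.mem_sup.2 ⟨_, ⟨f x, rfl⟩, x - f x • m, ?_, by simp⟩
    simp [h]

/-! ### Completing a linear matrix to a factorization -/

section

variable {𝕜 : Type} [Field 𝕜] {N : ℕ}

theorem isHomogeneous_qPoly : (qPoly 𝕜 N).IsHomogeneous 2 :=
  IsHomogeneous.sum _ _ _ fun i _ => (isHomogeneous_X 𝕜 i).pow 2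

theorem MvPolynomial.IsHomogeneous.mem_idealOfVars {σ : Type*} {K : Type*} [CommRing K]
    {p : MvPolynomial σ K} {d : ℕ} (hp : p.IsHomogeneous d) (hd : 0 < d) :
    p ∈ idealOfVars σ K := by
  rw [← pow_one (idealOfVars σ K), mem_pow_idealOfVars_iff']
  intro x hx
  refine hp.coeff_eq_zero ?_
  omega

theorem exists_list_map_toY {rs : List (YRing 𝕜 N)} (h : ∀ r ∈ rs, r ∈ irrelevantY 𝕜 N) :
    ∃ rs' : List (MvPolynomial (Fin N) 𝕜), (∀ r ∈ rs', r ∈ idealOfVars (Fin N) 𝕜) ∧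
      rs'.map (toY 𝕜 N) = rs := by
  have hmap : irrelevantY 𝕜 N = (idealOfVars (Fin N) 𝕜).map (toY 𝕜 N) := by
    rw [idealOfVars, Ideal.map_span, ← Set.range_comp]; rfl
  induction rs with
  | nil => exact ⟨[], by simp, rfl⟩
  | cons r rs ih =>
    obtain ⟨rs', h1, rfl⟩ := ih fun x hx => h x (List.mem_cons_of_mem _ hx)
    have hr := h r List.mem_cons_self
    rw [hmap, Ideal.mem_map_iff_of_surjective _ Ideal.Quotient.mk_surjective] at hr
    obtain ⟨x, hx, rfl⟩ := hr
    exact ⟨x :: rs', by simpa using ⟨hx, h1⟩, rfl⟩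

theorem exists_factorization_of_columns {n r : ℕ} {φ : Matrix (Fin n) (Fin r) (MvPolynomial (Fin N) 𝕜)}
    (hφ : ∀ i j, (φ i j).IsHomogeneous 1)
    (hind : LinearIndependent (MvPolynomial (Fin N) 𝕜) φ.col)
    (hq : ∀ i, qPoly 𝕜 N • Pi.single i 1 ∈
      Submodule.span (MvPolynomial (Fin N) 𝕜) (Set.range φ.col)) :
    ∃ ψ : Matrix (Fin r) (Fin n) (MvPolynomial (Fin N) 𝕜), (∀ i j, (ψ i j).IsHomogeneous 1) ∧
      φ * ψ = qPoly 𝕜 N • 1 ∧ ψ * φ = qPoly 𝕜 N • 1 := by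
  simp only [Submodule.mem_span_range_iff_exists_fun] at hq
  choose f hf using hq
  -- As `φ` is linear and `q_N` quadratic, only the degree `1` part of the coefficients contributes
  -- to the product.
  let ψ : Matrix (Fin r) (Fin n) (MvPolynomial (Fin N) 𝕜) :=
    Matrix.of fun j i => homogeneousComponent 1 (f i j)
  have h1 : φ * ψ = qPoly 𝕜 N • 1 := by
    ext1 l i
    have := congrArg (homogeneousComponent 2) (congrFun (hf i) l)
    rw [Finset.sum_apply, map_sum] at this
    rw [Matrix.mul_apply]
    calc ∑ j, φ l j * ψ j i = ∑ j, homogeneousComponent 2 ((f i j • φ.col j) l) := by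
          refine Finset.sum_congr rfl fun j _ => ?_
          change φ l j * homogeneousComponent 1 (f i j) = homogeneousComponent 2 (f i j * φ l j)
          rw [mul_comm (f i j)]
          exact (homogeneousComponent_mul_of_isHomogeneous (hφ l j) 1 (f i j)).symm
      _ = homogeneousComponent 2 ((qPoly 𝕜 N • Pi.single i 1 : Fin n → MvPolynomial (Fin N) 𝕜) l) :=
          this
      _ = _ := by
          rw [Pi.smul_apply, Matrix.smul_apply, Matrix.one_apply, Pi.single_apply]
          split_ifs
          · rw [smul_eq_mul, mul_one, homogeneousComponent_of_mem isHomogeneous_qPoly, if_pos rfl]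
          · simp
  have hinj : ∀ x : Fin r → MvPolynomial (Fin N) 𝕜, φ.mulVec x = 0 → x = 0 := by
    intro x hx
    funext j
    refine Fintype.linearIndependent_iff.1 hind x ?_ j
    rw [← hx]
    funext l
    simp [Matrix.mulVec, dotProduct, mul_comm]
  refine ⟨ψ, fun i j => homogeneousComponent_isHomogeneous _ _, h1, ?_⟩
  -- The second identity follows from the first because independent columns make `φ` injective.
  have h2 : φ * (ψ * φ - qPoly 𝕜 N • 1) = 0 := by
    rw [Matrix.mul_sub, ← Matrix.mul_assoc, h1]
    simp
  rw [← sub_eq_zero]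
  ext1 l i
  exact congrFun (hinj (fun l => (ψ * φ - qPoly 𝕜 N • 1 : Matrix _ _ _) l i) (by
    funext k
    exact congrFun (congrFun h2 k) i)) l

end

/-! ### The factorization attached to a linear MCM module -/

section

variable {𝕜 : Type} [Field 𝕜] [CharZero 𝕜] {N : ℕ}

/-- Each hypothesis has its own role: maximal depth makes the syzygy module over `R` free, the
linear presentation gives it generators of degrees `1` and `2`, and the absence of free summands
keeps the generators of degree `2` out of the basis. -/
theorem LinMCM.exists_factorization_of_nontrivial (hN : 0 < N) (M : LinMCM.{w} 𝕜 N)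
    [Nontrivial M.carrier] :
    ∃ (n r : ℕ) (φ : Matrix (Fin n) (Fin r) (MvPolynomial (Fin N) 𝕜))
      (ψ : Matrix (Fin r) (Fin n) (MvPolynomial (Fin N) 𝕜))
      (π : (Fin n → MvPolynomial (Fin N) 𝕜) →ₛₗ[toY 𝕜 N] M.carrier),
      (∀ i j, (φ i j).IsHomogeneous 1) ∧ (∀ i j, (ψ i j).IsHomogeneous 1) ∧
      φ * ψ = qPoly 𝕜 N • 1 ∧ ψ * φ = qPoly 𝕜 N • 1 ∧ Function.Surjective π ∧
      LinearMap.ker π = LinearMap.range φ.mulVecLin ∧ ∀ i, π (Pi.single i 1) ∈ M.gr 0 := by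
  obtain ⟨n, Φ, p, hΦ, hp0, hp, hker⟩ := M.linear
  choose Φ' hΦ' hΦY using hΦ
  let : Module (MvPolynomial (Fin N) 𝕜) M.carrier := Module.compHom _ (toY 𝕜 N)
  have htow : IsScalarTower (MvPolynomial (Fin N) 𝕜) (YRing 𝕜 N) M.carrier :=
    ⟨fun r a m => (congrArg (· • m) (Algebra.smul_def r a)).trans (mul_smul _ _ _)⟩
  let π : (Fin n → MvPolynomial (Fin N) 𝕜) →ₗ[MvPolynomial (Fin N) 𝕜] M.carrier :=
    { toFun := fun x => p fun i => toY 𝕜 N (x i)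
      map_add' := fun x y => by rw [← map_add]; congr 1
      map_smul' := fun r x => by
        rw [RingHom.id_apply]
        refine Eq.trans ?_ (map_smul p (toY 𝕜 N r) _)
        congr 1 }
  have hπ : Function.Surjective π := fun m => by
    obtain ⟨y, rfl⟩ := hp m
    choose x hx using fun i => Ideal.Quotient.mk_surjective (y i)
    exact ⟨x, congrArg p (funext hx)⟩
  have hπs : ∀ i, π (Pi.single i 1) = p (Pi.single i 1) := by
    intro i
    refine congrArg p ?_
    funext j
    by_cases h : j = i
    · subst h; simp
    · simp [h]
  -- Over `R` the relations are the lifted columns together with those saying that `q_N` acts by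
  -- zero.
  let g : Fin n ⊕ Fin n → Fin n → MvPolynomial (Fin N) 𝕜 :=
    Sum.elim (fun j i => Φ' i j) (fun j => qPoly 𝕜 N • Pi.single j 1)
  have hgK : ∀ j, π (g j) = 0 := by
    rintro (j | j)
    · have : (fun i => toY 𝕜 N (Φ' i j)) ∈ LinearMap.ker p := by
        rw [← hker]
        refine ⟨Pi.single j 1, ?_⟩
        funext i
        simp [hΦY]
      exact this
    · have h0 : toY 𝕜 N (qPoly 𝕜 N) = 0 :=
        Ideal.Quotient.eq_zero_iff_mem.2 (Ideal.mem_span_singleton_self _)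
      rw [show g (Sum.inr j) = qPoly 𝕜 N • Pi.single j 1 from rfl, map_smul]
      exact (congrArg (fun a : YRing 𝕜 N => a • (π (Pi.single j 1) : M.carrier)) h0).trans
        (zero_smul (YRing 𝕜 N) (π (Pi.single j 1) : M.carrier))
  have hK0 : LinearMap.ker π = Submodule.span (MvPolynomial (Fin N) 𝕜) (Set.range g) := by
    apply le_antisymm
    · intro x hx
      have hx' : (fun i => toY 𝕜 N (x i)) ∈ LinearMap.range Φ.mulVecLin := by rw [hker]; exact hx
      obtain ⟨u, hu⟩ := hx'
      choose u' hu' using fun i => Ideal.Quotient.mk_surjective (u i)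
      have h1 : ∀ i, ∃ s, x i - ∑ j, u' j * Φ' i j = s * qPoly 𝕜 N := by
        intro i
        have : x i - ∑ j, u' j * Φ' i j ∈ Ideal.span {qPoly 𝕜 N} := by
          rw [← Ideal.Quotient.eq_zero_iff_mem, map_sub, map_sum, sub_eq_zero]
          have := congrFun hu i
          simp only [Matrix.mulVecLin_apply, Matrix.mulVec, dotProduct] at this
          rw [← this]
          refine Finset.sum_congr rfl fun j _ => ?_
          rw [map_mul, hu', mul_comm, ← hΦY]
        obtain ⟨s, hs⟩ := Ideal.mem_span_singleton'.1 this
        exact ⟨s, hs.symm⟩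
      choose s hs using h1
      have hx2 : x = ∑ j, u' j • g (Sum.inl j) + ∑ j, s j • g (Sum.inr j) := by
        funext i
        rw [sub_eq_iff_eq_add'.1 (hs i)]
        simp [g, Finset.sum_apply, Pi.single_apply]
      rw [hx2]
      exact Submodule.add_mem _
        (Submodule.sum_mem _ fun j _ => Submodule.smul_mem _ _ (Submodule.subset_span ⟨_, rfl⟩))
        (Submodule.sum_mem _ fun j _ => Submodule.smul_mem _ _ (Submodule.subset_span ⟨_, rfl⟩))
    · rw [Submodule.span_le]
      rintro _ ⟨j, rfl⟩
      exact hgK j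
  have hgdeg : ∀ j, ∃ e, 0 < e ∧ ∀ i, (g j i).IsHomogeneous e := by
    rintro (j | j)
    · exact ⟨1, one_pos, fun i => hΦ' i j⟩
    · refine ⟨2, two_pos, fun i => ?_⟩
      by_cases h : i = j
      · subst h
        simpa [g] using isHomogeneous_qPoly
      · simpa [g, h] using isHomogeneous_zero _ _ _
  -- Replacing `M` by the quotient of `R^n` moves the argument to universe `0`, where the `Ext`
  -- lemmas are stated.
  set K : Submodule (MvPolynomial (Fin N) 𝕜) (Fin n → MvPolynomial (Fin N) 𝕜) :=
    LinearMap.ker (LinearMap.ker π).mkQ with hKdef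
  have hKπ : K = LinearMap.ker π := Submodule.ker_mkQ _
  have hK : K = Submodule.span _ (Set.range g) := hKπ.trans hK0
  let eM := π.quotKerEquivOfSurjective hπ
  have hn : Nonempty (Fin n) := by
    by_contra hne
    rw [not_nonempty_iff] at hne
    have : Subsingleton M.carrier := hπ.subsingleton
    exact not_subsingleton M.carrier this
  obtain ⟨i₀⟩ := hn
  have hM : idealOfVars (Fin N) 𝕜 • (⊤ : Submodule (MvPolynomial (Fin N) 𝕜)
      ((Fin n → MvPolynomial (Fin N) 𝕜) ⧸ LinearMap.ker π)) ≠ ⊤ := by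
    intro h
    have h1 : (LinearMap.ker π).mkQ (Pi.single i₀ 1) ∈ idealOfVars (Fin N) 𝕜 •
        (⊤ : Submodule (MvPolynomial (Fin N) 𝕜)
          ((Fin n → MvPolynomial (Fin N) 𝕜) ⧸ LinearMap.ker π)) := by rw [h]; trivial
    rw [mem_smul_top_of_surjective _ (Submodule.mkQ_surjective _)] at h1
    obtain ⟨a, ha, k, hk, hak⟩ := h1
    have hKle : K ≤ idealOfVars (Fin N) 𝕜 •
        (⊤ : Submodule (MvPolynomial (Fin N) 𝕜) (Fin n → MvPolynomial (Fin N) 𝕜)) := by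
      rw [hK, Submodule.span_le]
      rintro _ ⟨j, rfl⟩
      obtain ⟨e, he, hj⟩ := hgdeg j
      rw [SetLike.mem_coe, (Pi.basisFun _ _).mem_ideal_smul_top_iff]
      exact fun i => (hj i).mem_idealOfVars he
    have h2 := Submodule.add_mem _ ha (hKle hk)
    rw [← hak, (Pi.basisFun _ _).mem_ideal_smul_top_iff] at h2
    have h3 := h2 i₀
    rw [Pi.basisFun_repr, Pi.single_eq_same, ← pow_one (idealOfVars (Fin N) 𝕜),
      mem_pow_idealOfVars_iff'] at h3
    simpa using h3 0 (by simp)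
  obtain ⟨rs, hrs, hreg, hlen⟩ : ∃ rs : List (MvPolynomial (Fin N) 𝕜),
      (∀ r ∈ rs, r ∈ idealOfVars (Fin N) 𝕜) ∧ RingTheory.Sequence.IsWeaklyRegular
        ((Fin n → MvPolynomial (Fin N) 𝕜) ⧸ LinearMap.ker π) rs ∧ N - 1 ≤ rs.length := by
    have hd := M.isMCM.2.resolve_left (not_subsingleton _)
    rw [ringKrullDim_YRing hN] at hd
    obtain ⟨rs, h1, h2, h3⟩ := exists_isRegular_of_depthAt_eq (irrelevantY 𝕜 N) M.carrier
      (n := N - 1) (WithBot.coe_injective hd)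
    obtain ⟨rs', h4, rfl⟩ := exists_list_map_toY h1
    refine ⟨rs', h4, ?_, by simpa using h3⟩
    rw [eM.isWeaklyRegular_congr]
    exact (RingTheory.Sequence.isWeaklyRegular_map_algebraMap_iff (YRing 𝕜 N) M.carrier rs').1
      h2.toIsWeaklyRegular
  obtain ⟨cs, hcl, hcreg, hcf⟩ := exists_linPoly_isWeaklyRegular N
    (ModuleCat.of (MvPolynomial (Fin N) 𝕜) K) ⊥ (by simp)
    (fun i hi => subsingleton_ext_ker hN _ (Submodule.mkQ_surjective _) hM hrs hreg hlen i hi)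
  -- The `N` forms are independent, so they span all linear forms and generate the irrelevant ideal.
  have hcs : Submodule.span 𝕜 {c | c ∈ cs} = ⊤ := by
    rw [bot_sup_eq, finrank_bot, zero_add] at hcf
    exact Submodule.eq_top_of_finrank_eq (by rw [hcf, Module.finrank_fin_fun])
  obtain ⟨r, a, hind, hspan⟩ := exists_linearIndependent_span_eq (K := K)
    (ys := cs.map (linPoly 𝕜 N))
    (by
      intro y hy
      obtain ⟨c, -, rfl⟩ := List.mem_map.1 hy
      exact isHomogeneous_linPoly c)
    (ofList_map_linPoly hcs) hcreg g (fun j => (hgdeg j).imp fun e he => he.2) hK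
  have hqK : ∀ x : Fin n → MvPolynomial (Fin N) 𝕜,
      qPoly 𝕜 N • x ∈ Submodule.span (MvPolynomial (Fin N) 𝕜) (Set.range (g ∘ a)) := by
    intro x
    rw [hspan, hK, ← Finset.univ_sum_single x, Finset.smul_sum]
    refine Submodule.sum_mem _ fun i _ => ?_
    have : qPoly 𝕜 N • (Pi.single i (x i) : Fin n → MvPolynomial (Fin N) 𝕜) =
        x i • g (Sum.inr i) := by
      funext l
      by_cases h : l = i
      · subst h
        simp [g, mul_comm]
      · simp [g, h]
    rw [this]
    exact Submodule.smul_mem _ _ (Submodule.subset_span ⟨_, rfl⟩)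
  have hinl : ∀ j, ∃ i, a j = Sum.inl i := by
    intro j
    cases haj : a j with
    | inl i => exact ⟨i, rfl⟩
    | inr i =>
      exfalso
      let b := Module.Basis.span hind
      -- If `q_N e_i` is the basis vector `b_j`, send `x` to the `b_j`-coordinate of `q_N x` modulo
      -- `q_N`. On `K` this coordinate is a multiple of `q_N`, so the map descends to `M`; it takes
      -- `e_i` to `1`, which contradicts the absence of free summands.
      let χ : (Fin n → MvPolynomial (Fin N) 𝕜) →ₗ[MvPolynomial (Fin N) 𝕜] YRing 𝕜 N :=
        (Ideal.span {qPoly 𝕜 N}).mkQ ∘ₗ b.coord j ∘ₗ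
          (LinearMap.codRestrict _ (qPoly 𝕜 N • LinearMap.id) hqK)
      have hχ : LinearMap.ker π ≤ LinearMap.ker χ := by
        intro x hx
        rw [← hKπ, ← hspan] at hx
        have : (LinearMap.codRestrict _ (qPoly 𝕜 N • LinearMap.id) hqK) x =
            qPoly 𝕜 N • (⟨x, hx⟩ : Submodule.span (MvPolynomial (Fin N) 𝕜) (Set.range (g ∘ a))) :=
          rfl
        rw [LinearMap.mem_ker, LinearMap.comp_apply, LinearMap.comp_apply, this, map_smul,
          Submodule.mkQ_apply, Submodule.Quotient.mk_eq_zero, smul_eq_mul]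
        exact Ideal.mul_mem_right _ _ (Ideal.mem_span_singleton_self _)
      let f : M.carrier →ₗ[YRing 𝕜 N] YRing 𝕜 N :=
        LinearMap.extendScalarsOfSurjective
          (show Function.Surjective (algebraMap (MvPolynomial (Fin N) 𝕜) (YRing 𝕜 N)) from
            Ideal.Quotient.mk_surjective)
          ((LinearMap.ker π).liftQ χ hχ ∘ₗ eM.symm.toLinearMap)
      refine not_noFreeSummand_of_eq_one f (m := π (Pi.single i 1)) ?_ M.noFree
      have h1 : eM.symm (π (Pi.single i 1)) = (LinearMap.ker π).mkQ (Pi.single i 1) := by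
        rw [LinearEquiv.symm_apply_eq]; rfl
      have h2 : (LinearMap.codRestrict _ (qPoly 𝕜 N • LinearMap.id) hqK) (Pi.single i 1) = b j := by
        apply Subtype.ext
        rw [Module.Basis.span_apply]
        simp [g, haj]
      change (LinearMap.ker π).liftQ χ hχ (eM.symm (π (Pi.single i 1))) = 1
      rw [h1, Submodule.mkQ_apply, Submodule.liftQ_apply, LinearMap.comp_apply,
        LinearMap.comp_apply, h2, Module.Basis.coord_apply, Module.Basis.repr_self,
        Finsupp.single_eq_same]
      rfl
  choose c hc using hinl
  let φ : Matrix (Fin n) (Fin r) (MvPolynomial (Fin N) 𝕜) := Matrix.of fun i j => Φ' i (c j)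
  have hcol : φ.col = g ∘ a := by
    funext j i
    simp [φ, g, hc]
  obtain ⟨ψ, hψ, h1, h2⟩ := exists_factorization_of_columns (φ := φ) (fun i j => hΦ' i (c j))
    (by rw [hcol]; exact hind) (fun i => by rw [hcol]; exact hqK _)
  refine ⟨n, r, φ, ψ, ⟨π.toAddHom, fun r x => map_smul π r x⟩, fun i j => hΦ' i (c j), hψ, h1, h2,
    hπ, ?_, fun i => ?_⟩
  · rw [Matrix.range_mulVecLin, hcol, hspan, hKπ]
    rfl
  · have := hp0 i
    rw [← hπs] at this
    exact this

theorem LinMCM.exists_factorization (hN : 0 < N) (M : LinMCM.{w} 𝕜 N) :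
    ∃ (n r : ℕ) (φ : Matrix (Fin n) (Fin r) (MvPolynomial (Fin N) 𝕜))
      (ψ : Matrix (Fin r) (Fin n) (MvPolynomial (Fin N) 𝕜))
      (π : (Fin n → MvPolynomial (Fin N) 𝕜) →ₛₗ[toY 𝕜 N] M.carrier),
      (∀ i j, (φ i j).IsHomogeneous 1) ∧ (∀ i j, (ψ i j).IsHomogeneous 1) ∧
      φ * ψ = qPoly 𝕜 N • 1 ∧ ψ * φ = qPoly 𝕜 N • 1 ∧ Function.Surjective π ∧
      LinearMap.ker π = LinearMap.range φ.mulVecLin ∧ ∀ i, π (Pi.single i 1) ∈ M.gr 0 := by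
  rcases subsingleton_or_nontrivial M.carrier with h | h
  · refine ⟨0, 0, 0, 0, 0, nofun, nofun, Subsingleton.elim _ _, Subsingleton.elim _ _,
      fun m => ⟨0, Subsingleton.elim _ _⟩, Subsingleton.elim _ _, nofun⟩
  · exact M.exists_factorization_of_nontrivial hN

end

/-! ### Clifford modules from operators and from matrix factorizations -/

section Operators

variable {𝕜 : Type} [Field 𝕜] {N : ℕ}

/-- The graded Clifford module given by odd operators squaring to the quadratic form. -/
noncomputable def GrClMod.ofOperators {E : Type w} [AddCommGroup E] [Module 𝕜 E]
    [Module.Finite 𝕜 E] (f : (Fin N → 𝕜) →ₗ[𝕜] Module.End 𝕜 E)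
    (hf : ∀ c, f c * f c = algebraMap 𝕜 (Module.End 𝕜 E) (qForm 𝕜 N c))
    (gr : ZMod 2 → Submodule 𝕜 E) (hint : DirectSum.IsInternal gr)
    (hgr : ∀ c j, ∀ m ∈ gr j, f c m ∈ gr (j + 1)) : GrClMod.{w} 𝕜 N :=
  letI : Module (Cl 𝕜 N) E :=
    Module.compHom E (CliffordAlgebra.lift (qForm 𝕜 N) ⟨f, hf⟩).toRingHom
  { carrier := E
    tower := ⟨fun r a m => by
      change CliffordAlgebra.lift (qForm 𝕜 N) ⟨f, hf⟩ (r • a) m =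
        r • CliffordAlgebra.lift (qForm 𝕜 N) ⟨f, hf⟩ a m
      rw [map_smul]; rfl⟩
    gr := gr
    isInternal := hint
    smul_mem := by
      -- The even and odd parts of the Clifford algebra are suprema of powers of the space of
      -- vectors, so parity is checked on these powers.
      have key : ∀ (n : ℕ) (c : Cl 𝕜 N), c ∈ LinearMap.range (CliffordAlgebra.ι (qForm 𝕜 N)) ^ n →
          ∀ j, ∀ m ∈ gr j, CliffordAlgebra.lift (qForm 𝕜 N) ⟨f, hf⟩ c m ∈ gr (n + j) := by
        intro n c hc
        induction hc using Submodule.pow_induction_on_left' with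
        | algebraMap r =>
          intro j m hm
          rw [AlgHom.commutes]
          simpa using (gr j).smul_mem r hm
        | add x y n _ _ hx hy =>
          intro j m hm
          rw [map_add]
          exact Submodule.add_mem _ (hx j m hm) (hy j m hm)
        | mem_mul x hx n y _ hy =>
          intro j m hm
          obtain ⟨v, rfl⟩ := hx
          rw [map_mul, CliffordAlgebra.lift_ι_apply, Module.End.mul_apply]
          have := hgr v _ _ (hy j m hm)
          rwa [show ((n.succ : ℕ) : ZMod 2) + j = n + j + 1 by push_cast; ring]
      intro i j c m hc hm
      change CliffordAlgebra.lift (qForm 𝕜 N) ⟨f, hf⟩ c m ∈ gr (i + j)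
      have hle : CliffordAlgebra.evenOdd (qForm 𝕜 N) i ≤ (gr (i + j)).comap
          (LinearMap.applyₗ m ∘ₗ (CliffordAlgebra.lift (qForm 𝕜 N) ⟨f, hf⟩).toLinearMap) := by
        refine iSup_le fun n x hx => ?_
        have := key n x hx j m hm
        rwa [n.2] at this
      exact hle hc }

theorem GrClMod.ofOperators_gen_smul {E : Type w} [AddCommGroup E] [Module 𝕜 E]
    [Module.Finite 𝕜 E] (f : (Fin N → 𝕜) →ₗ[𝕜] Module.End 𝕜 E)
    (hf : ∀ c, f c * f c = algebraMap 𝕜 (Module.End 𝕜 E) (qForm 𝕜 N c))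
    (gr : ZMod 2 → Submodule 𝕜 E) (hint : DirectSum.IsInternal gr)
    (hgr : ∀ c j, ∀ m ∈ gr j, f c m ∈ gr (j + 1)) (i : Fin N) (x : E) :
    (Cl.gen 𝕜 N i • (show (ofOperators f hf gr hint hgr).carrier from x)) =
      f (Pi.single i 1) x := by
  change CliffordAlgebra.lift (qForm 𝕜 N) ⟨f, hf⟩ (CliffordAlgebra.ι _ _) x = _
  rw [CliffordAlgebra.lift_ι_apply]

/-- A `ℤ/2`-grading is a decomposition into two complementary subspaces. -/
theorem isInternal_zmod_two_iff {E : Type*} [AddCommGroup E] [Module 𝕜 E]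
    (gr : ZMod 2 → Submodule 𝕜 E) : DirectSum.IsInternal gr ↔ IsCompl (gr 0) (gr 1) :=
  DirectSum.isInternal_submodule_iff_isCompl gr (by decide) (by
    have : ∀ i : ZMod 2, i = 0 ∨ i = 1 := by decide
    ext i; simpa using this i)

theorem MvPolynomial.IsHomogeneous.eq_sum_of_one {p : MvPolynomial (Fin N) 𝕜}
    (hp : p.IsHomogeneous 1) : p = ∑ i, C (coeff (Finsupp.single i 1) p) * X i := by
  ext m
  by_cases hm : m.degree = 1
  · obtain ⟨i, rfl⟩ := (Finsupp.sum_eq_one_iff m).1 hm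
    rw [coeff_sum, Finset.sum_eq_single i]
    · simp
    · intro j _ hj
      rw [coeff_C_mul, coeff_X, if_neg, mul_zero]
      exact fun h => hj (Finsupp.single_left_injective one_ne_zero h)
    · simp
  · rw [hp.coeff_eq_zero hm]
    refine ((IsHomogeneous.sum _ _ _ fun i _ => isHomogeneous_C_mul_X _ _).coeff_eq_zero hm).symm

/-- The operator coefficients of a matrix of linear forms. -/
noncomputable def linCoeff {ι κ : Type*} (φ : Matrix ι κ (MvPolynomial (Fin N) 𝕜)) :
    (Fin N → 𝕜) →ₗ[𝕜] Matrix ι κ 𝕜 where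
  toFun c := Matrix.of fun a b => ∑ i, c i * coeff (Finsupp.single i 1) (φ a b)
  map_add' c d := by ext; simp [add_mul, Finset.sum_add_distrib]
  map_smul' r c := by ext; simp [Finset.mul_sum, mul_assoc]

theorem linCoeff_eq_map {ι κ : Type*} {φ : Matrix ι κ (MvPolynomial (Fin N) 𝕜)}
    (hφ : ∀ a b, (φ a b).IsHomogeneous 1) (c : Fin N → 𝕜) : linCoeff φ c = φ.map (eval c) := by
  ext a b
  have h := congrArg (eval c) (hφ a b).eq_sum_of_one
  simp only [map_sum, map_mul, eval_C, eval_X] at h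
  rw [Matrix.map_apply, h]
  change ∑ i, c i * coeff (Finsupp.single i 1) (φ a b) = _
  exact Finset.sum_congr rfl fun i _ => mul_comm (c i) (coeff (Finsupp.single i 1) (φ a b))

/-- Evaluate the polynomial identity at the point `c`: a matrix of linear forms evaluates to the
corresponding combination of its coefficient matrices. -/
theorem linCoeff_mul {ι κ : Type*} [Fintype κ] [DecidableEq ι]
    {φ : Matrix ι κ (MvPolynomial (Fin N) 𝕜)} {ψ : Matrix κ ι (MvPolynomial (Fin N) 𝕜)}
    (hφ : ∀ a b, (φ a b).IsHomogeneous 1) (hψ : ∀ a b, (ψ a b).IsHomogeneous 1)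
    (h : φ * ψ = qPoly 𝕜 N • 1) (c : Fin N → 𝕜) :
    linCoeff φ c * linCoeff ψ c = qForm 𝕜 N c • 1 := by
  rw [linCoeff_eq_map hφ, linCoeff_eq_map hψ, ← Matrix.map_mul, h]
  ext a b
  simp only [Matrix.map_apply, Matrix.smul_apply, Matrix.one_apply, smul_eq_mul, map_mul]
  split_ifs
  · simp [qPoly, QuadraticMap.weightedSumSquares_apply, sq]
  · simp

/-- The values of `φ` and `ψ` at a vector `c` are the blocks of an odd operator whose square is
`q_N(c)`, so the universal property of the Clifford algebra applies. -/
theorem exists_grClMod_of_factorization {ι κ : Type} [Fintype ι] [Fintype κ] [DecidableEq ι]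
    [DecidableEq κ]
    {φ : Matrix ι κ (MvPolynomial (Fin N) 𝕜)} {ψ : Matrix κ ι (MvPolynomial (Fin N) 𝕜)}
    (hφ : ∀ a b, (φ a b).IsHomogeneous 1) (hψ : ∀ a b, (ψ a b).IsHomogeneous 1)
    (h₀ : φ * ψ = qPoly 𝕜 N • 1) (h₁ : ψ * φ = qPoly 𝕜 N • 1) :
    ∃ (W : GrClMod.{w} 𝕜 N) (b₀ : Module.Basis ι 𝕜 (W.gr 0)) (b₁ : Module.Basis κ 𝕜 (W.gr 1)),
      ∀ k, W.phi (1 ⊗ₜ b₁ k) = ∑ l, φ l k ⊗ₜ b₀ l := by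
  -- The lift only places the module in the universe `w` required by the equivalence.
  let b₀ : Module.Basis ι 𝕜 (ULift.{w} ι → 𝕜) := (Pi.basisFun 𝕜 _).reindex Equiv.ulift
  let b₁ : Module.Basis κ 𝕜 (ULift.{w} κ → 𝕜) := (Pi.basisFun 𝕜 _).reindex Equiv.ulift
  let E : Type w := (ULift.{w} ι → 𝕜) × (ULift.{w} κ → 𝕜)
  let f : (Fin N → 𝕜) →ₗ[𝕜] Module.End 𝕜 E :=
    { toFun := fun c => offDiag (Matrix.toLin b₁ b₀ (linCoeff φ c))
        (Matrix.toLin b₀ b₁ (linCoeff ψ c))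
      map_add' := fun c d => by
        apply LinearMap.ext; intro x
        simp only [map_add]; rfl
      map_smul' := fun r c => by
        apply LinearMap.ext; intro x
        simp only [map_smul]; rfl }
  have hf : ∀ c, f c * f c = algebraMap 𝕜 (Module.End 𝕜 E) (qForm 𝕜 N c) := by
    intro c
    have e₀ : ∀ x, Matrix.toLin b₁ b₀ (linCoeff φ c) (Matrix.toLin b₀ b₁ (linCoeff ψ c) x) =
        qForm 𝕜 N c • x := fun x => by
      rw [← Matrix.toLin_mul_apply, linCoeff_mul hφ hψ h₀, map_smul, Matrix.toLin_one]; rfl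
    have e₁ : ∀ x, Matrix.toLin b₀ b₁ (linCoeff ψ c) (Matrix.toLin b₁ b₀ (linCoeff φ c) x) =
        qForm 𝕜 N c • x := fun x => by
      rw [← Matrix.toLin_mul_apply, linCoeff_mul hψ hφ h₁, map_smul, Matrix.toLin_one]; rfl
    apply LinearMap.ext
    rintro ⟨x, y⟩
    exact Prod.ext (e₀ x) (e₁ y)
  let gr : ZMod 2 → Submodule 𝕜 E := fun i =>
    if i = 0 then LinearMap.range (LinearMap.inl 𝕜 _ _) else LinearMap.range (LinearMap.inr 𝕜 _ _)
  have hgr : ∀ c j, ∀ m ∈ gr j, f c m ∈ gr (j + 1) := by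
    intro c j m hm
    fin_cases j
    · obtain ⟨x, rfl⟩ := hm
      exact ⟨Matrix.toLin b₀ b₁ (linCoeff ψ c) x,
        Prod.ext (map_zero (Matrix.toLin b₁ b₀ (linCoeff φ c))).symm rfl⟩
    · obtain ⟨x, rfl⟩ := hm
      exact ⟨Matrix.toLin b₁ b₀ (linCoeff φ c) x,
        Prod.ext rfl (map_zero (Matrix.toLin b₀ b₁ (linCoeff ψ c))).symm⟩
  let W : GrClMod.{w} 𝕜 N := GrClMod.ofOperators f hf gr
    ((isInternal_zmod_two_iff gr).2 LinearMap.isCompl_range_inl_inr) hgr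
  let B₀ : Module.Basis ι 𝕜 (W.gr 0) :=
    b₀.map (LinearEquiv.ofInjective (LinearMap.inl 𝕜 _ (ULift.{w} κ → 𝕜)) LinearMap.inl_injective)
  let B₁ : Module.Basis κ 𝕜 (W.gr 1) :=
    b₁.map (LinearEquiv.ofInjective (LinearMap.inr 𝕜 (ULift.{w} ι → 𝕜) _) LinearMap.inr_injective)
  have hact : ∀ i k, W.act i (B₁ k) = ∑ l, coeff (Finsupp.single i 1) (φ l k) • B₀ l := by
    intro i k
    have e : W.act i (B₁ k) = LinearEquiv.ofInjective
        (LinearMap.inl 𝕜 _ (ULift.{w} κ → 𝕜)) LinearMap.inl_injective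
        (Matrix.toLin b₁ b₀ (linCoeff φ (Pi.single i 1)) (b₁ k)) := by
      apply Subtype.ext
      refine (GrClMod.ofOperators_gen_smul f hf gr _ hgr i _).trans ?_
      exact Prod.ext rfl (map_zero (Matrix.toLin b₀ b₁ (linCoeff ψ (Pi.single i 1))))
    rw [e, Matrix.toLin_self, map_sum]
    refine Finset.sum_congr rfl fun l _ => ?_
    rw [map_smul]
    congr 1
    simp [linCoeff, Pi.single_apply]
  refine ⟨W, B₀, B₁, fun k => ?_⟩
  rw [GrClMod.phi_eq_linForm, linForm_one_tmul]
  calc ∑ i, (X i : MvPolynomial (Fin N) 𝕜) ⊗ₜ[𝕜] W.act i (B₁ k)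
      = ∑ i, ∑ l, (C (coeff (Finsupp.single i 1) (φ l k)) * X i) ⊗ₜ[𝕜] B₀ l := by
        refine Finset.sum_congr rfl fun i _ => ?_
        rw [hact, TensorProduct.tmul_sum]
        refine Finset.sum_congr rfl fun l _ => ?_
        rw [← TensorProduct.smul_tmul, smul_eq_C_mul]
    _ = _ := by
        rw [Finset.sum_comm]
        refine Finset.sum_congr rfl fun l _ => ?_
        rw [← TensorProduct.sum_tmul, ← (hφ l k).eq_sum_of_one]

end Operators

/-! ### Presentations of the cokernel in coordinates -/

namespace GrClMod

variable {𝕜 : Type} [Field 𝕜] {N : ℕ} {ι κ : Type*} [Fintype ι] [Fintype κ]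

/-- Coordinates on `R ⊗ V` given by a basis of `V`. -/
noncomputable def coordEquiv {V : Type*} [AddCommGroup V] [Module 𝕜 V] (N : ℕ)
    (b : Module.Basis ι 𝕜 V) :
    (MvPolynomial (Fin N) 𝕜 ⊗[𝕜] V) ≃ₗ[MvPolynomial (Fin N) 𝕜] (ι → MvPolynomial (Fin N) 𝕜) :=
  (b.baseChange (MvPolynomial (Fin N) 𝕜)).equivFun

theorem coordEquiv_one_tmul [DecidableEq ι] {V : Type*} [AddCommGroup V] [Module 𝕜 V]
    (b : Module.Basis ι 𝕜 V) (i : ι) : coordEquiv N b (1 ⊗ₜ b i) = Pi.single i 1 := by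
  funext j
  rw [coordEquiv, ← Module.Basis.baseChange_apply, Module.Basis.equivFun_self, Pi.single_apply]
  simp only [eq_comm]

theorem coordEquiv_tmul {V : Type*} [AddCommGroup V] [Module 𝕜 V]
    (b : Module.Basis ι 𝕜 V) (r : MvPolynomial (Fin N) 𝕜) (v : V) (i : ι) :
    coordEquiv N b (r ⊗ₜ v) i = b.repr v i • r := by
  simp [coordEquiv, Module.Basis.equivFun_apply]

theorem coordEquiv_homComp {V : Type*} [AddCommGroup V] [Module 𝕜 V]
    (b : Module.Basis ι 𝕜 V) (n : ℕ) (x : MvPolynomial (Fin N) 𝕜 ⊗[𝕜] V) (i : ι) :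
    coordEquiv N b (homComp N V n x) i = homogeneousComponent n (coordEquiv N b x i) := by
  induction x with
  | zero => simp
  | tmul r v => rw [homComp_tmul, coordEquiv_tmul, coordEquiv_tmul, map_smul]
  | add x y hx hy => simp only [map_add, Pi.add_apply, hx, hy]

theorem coordEquiv_map [DecidableEq ι] [DecidableEq κ] {V V' : Type*} [AddCommGroup V] [Module 𝕜 V]
    [AddCommGroup V'] [Module 𝕜 V'] (b : Module.Basis ι 𝕜 V) (b' : Module.Basis κ 𝕜 V')
    (F : (MvPolynomial (Fin N) 𝕜 ⊗[𝕜] V') →ₗ[MvPolynomial (Fin N) 𝕜]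
      (MvPolynomial (Fin N) 𝕜 ⊗[𝕜] V))
    {φ : Matrix ι κ (MvPolynomial (Fin N) 𝕜)}
    (h : ∀ k, F (1 ⊗ₜ b' k) = ∑ l, φ l k ⊗ₜ b l) (z) :
    coordEquiv N b (F z) = φ.mulVec (coordEquiv N b' z) := by
  have : (coordEquiv N b).toLinearMap ∘ₗ F = φ.mulVecLin ∘ₗ (coordEquiv N b').toLinearMap := by
    refine (b'.baseChange (MvPolynomial (Fin N) 𝕜)).ext fun k => ?_
    rw [Module.Basis.baseChange_apply]
    simp only [LinearMap.comp_apply, LinearEquiv.coe_coe, h, map_sum, Matrix.mulVecLin_apply,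
      coordEquiv_one_tmul, Matrix.mulVec_single_one]
    funext i
    rw [Finset.sum_apply]
    simp [coordEquiv_tmul, Finsupp.single_apply]
  exact LinearMap.congr_fun this z

theorem isCokernel_of_matrix [DecidableEq ι] [DecidableEq κ] {W : GrClMod.{w} 𝕜 N}
    {M : LinMCM.{w} 𝕜 N} (b₀ : Module.Basis ι 𝕜 (W.gr 0))
    (b₁ : Module.Basis κ 𝕜 (W.gr 1)) {φ : Matrix ι κ (MvPolynomial (Fin N) 𝕜)}
    (hφ : ∀ k, W.phi (1 ⊗ₜ b₁ k) = ∑ l, φ l k ⊗ₜ b₀ l)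
    (π : (ι → MvPolynomial (Fin N) 𝕜) →ₛₗ[toY 𝕜 N] M.carrier) (hπ : Function.Surjective π)
    (hker : LinearMap.ker π = LinearMap.range φ.mulVecLin) (h0 : ∀ i, π (Pi.single i 1) ∈ M.gr 0)
    (hC : ∀ (c : 𝕜) (m : M.carrier), m ∈ M.gr 0 → toY 𝕜 N (C c) • m ∈ M.gr 0) :
    W.IsCokernel M (π.comp (coordEquiv N b₀).toLinearMap) where
  surjective := hπ.comp (coordEquiv N b₀).surjective
  ker_eq := by
    ext x
    rw [LinearMap.mem_ker, LinearMap.comp_apply, ← LinearMap.mem_ker, hker]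
    constructor
    · rintro ⟨y, hy⟩
      refine ⟨(coordEquiv N b₁).symm y, (coordEquiv N b₀).injective ?_⟩
      rw [coordEquiv_map b₀ b₁ W.phi hφ, LinearEquiv.apply_symm_apply]
      exact hy
    · rintro ⟨z, rfl⟩
      exact ⟨coordEquiv N b₁ z, (coordEquiv_map b₀ b₁ W.phi hφ z).symm⟩
  degree_zero x := by
    rw [← b₀.sum_repr x, TensorProduct.tmul_sum, map_sum]
    refine AddSubgroup.sum_mem _ fun i _ => ?_
    rw [← TensorProduct.smul_tmul, ← mul_one (b₀.repr x i • (1 : MvPolynomial (Fin N) 𝕜)),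
      ← smul_eq_mul, ← TensorProduct.smul_tmul', LinearMap.map_smulₛₗ, smul_eq_C_mul, mul_one]
    refine hC _ _ ?_
    rw [LinearMap.comp_apply, LinearEquiv.coe_coe, coordEquiv_one_tmul]
    exact h0 i

end GrClMod

theorem LinMCM.C_smul_mem {𝕜 : Type} [Field 𝕜] {N : ℕ} (M : LinMCM.{w} 𝕜 N) (c : 𝕜)
    (m : M.carrier) {n : ℤ} (hm : m ∈ M.gr n) : toY 𝕜 N (C c) • m ∈ M.gr n := by
  have := M.isGraded.smul_mem 0 n _ m ⟨C c, isHomogeneous_C _ _, rfl⟩ hm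
  simpa using this

/-! ### Uniqueness of the cokernel and the equivalence -/

theorem LinMCM.eq_of_eq_sum {𝕜 : Type} [Field 𝕜] {N : ℕ} (M : LinMCM.{w} 𝕜 N)
    {d : ℕ} {y : ℕ → M.carrier} (hy : ∀ k : ℕ, y k ∈ M.gr k) {n : ℤ} {m : M.carrier}
    (hm : m ∈ M.gr n) (h : m = ∑ k ∈ Finset.range d, y k) :
    m = ∑ k ∈ Finset.range d, if (k : ℤ) = n then y k else 0 := by
  have h1 : DirectSum.of (fun i => M.gr i) n ⟨m, hm⟩ =
      ∑ k ∈ Finset.range d, DirectSum.of (fun i => M.gr i) (k : ℤ) ⟨y k, hy k⟩ := by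
    apply M.isGraded.isInternal.injective
    simpa only [map_sum, DirectSum.coeAddMonoidHom_of] using h
  have h2 := congrArg (fun z => ((z n : M.gr n) : M.carrier)) h1
  have h3 : m = ∑ k ∈ Finset.range d,
      ((DirectSum.of (fun i => M.gr i) (k : ℤ) ⟨y k, hy k⟩ n : M.gr n) : M.carrier) := by
    simpa using h2
  refine h3.trans (Finset.sum_congr rfl fun k _ => ?_)
  rw [DirectSum.coe_of_apply]
  split_ifs <;> rfl

namespace GrClMod.IsCokernel

variable {𝕜 : Type} [Field 𝕜] {N : ℕ} {W : GrClMod.{w} 𝕜 N} {M : LinMCM.{w} 𝕜 N}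
  {p : (MvPolynomial (Fin N) 𝕜 ⊗[𝕜] W.gr 0) →ₛₗ[toY 𝕜 N] M.carrier}

theorem map_homZ_mem (h : W.IsCokernel M p) (n : ℤ) (x) :
    p (homZ N (W.gr 0) n x) ∈ M.gr n := by
  rcases lt_or_ge n 0 with hn | hn
  · rw [homZ_of_neg hn, LinearMap.zero_apply, map_zero]
    exact AddSubgroup.zero_mem _
  · obtain ⟨k, rfl⟩ := Int.eq_ofNat_of_zero_le hn
    induction x with
    | zero => rw [map_zero, map_zero]; exact AddSubgroup.zero_mem _
    | tmul r v =>
      have := M.isGraded.smul_mem k 0 (toY 𝕜 N (homogeneousComponent k r)) (p (1 ⊗ₜ v))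
        ⟨_, homogeneousComponent_isHomogeneous k r, rfl⟩ (h.degree_zero v)
      rw [← LinearMap.map_smulₛₗ, TensorProduct.smul_tmul', smul_eq_mul, mul_one, add_zero] at this
      simpa using this
    | add x y hx hy => rw [map_add, map_add]; exact AddSubgroup.add_mem _ hx hy

/-- Placing `W₀` in degree `0` determines the whole grading: decompose a preimage into components
and use that the decomposition in `M` is unique. -/
theorem mem_gr_iff (h : W.IsCokernel M p) {n : ℤ} {m : M.carrier} :
    m ∈ M.gr n ↔ ∃ x, p (homZ N (W.gr 0) n x) = m := by
  refine ⟨fun hm => ?_, fun ⟨x, hx⟩ => hx ▸ h.map_homZ_mem n x⟩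
  obtain ⟨x, rfl⟩ := h.surjective m
  obtain ⟨d, hd⟩ := exists_sum_homZ x
  have h1 := M.eq_of_eq_sum (fun k => h.map_homZ_mem k x) hm (d := d) (by
    conv_lhs => rw [hd, map_sum])
  by_cases hn : ∃ k < d, (k : ℤ) = n
  · obtain ⟨k, hk, rfl⟩ := hn
    refine ⟨x, ?_⟩
    rw [h1, Finset.sum_eq_single k]
    · simp
    · intro j _ hj
      rw [if_neg (by exact_mod_cast hj)]
    · intro hk'
      exact absurd (Finset.mem_range.2 hk) hk'
  · refine ⟨0, ?_⟩
    rw [map_zero, map_zero, h1, Finset.sum_eq_zero]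
    intro k hk
    rw [if_neg fun e => hn ⟨k, Finset.mem_range.1 hk, e⟩]

variable [CharZero 𝕜]

theorem exists_linearEquiv (h : W.IsCokernel M p) :
    ∃ e : W.Cok ≃ₗ[YRing 𝕜 N] M.carrier, ∀ x, e (W.toCok x) = p x := by
  have hle : LinearMap.range W.phi ≤ LinearMap.ker p := h.ker_eq.ge
  let f : W.Cok →ₛₗ[toY 𝕜 N] M.carrier := (LinearMap.range W.phi).liftQ p hle
  have hf : ∀ x, f (W.toCok x) = p x := fun x => rfl
  let g : W.Cok →ₗ[YRing 𝕜 N] M.carrier :=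
    { toFun := f
      map_add' := map_add f
      map_smul' := fun a m => by
        obtain ⟨r, rfl⟩ := Ideal.Quotient.mk_surjective a
        exact LinearMap.map_smulₛₗ f r m }
  refine ⟨LinearEquiv.ofBijective g ⟨?_, ?_⟩, hf⟩
  · rw [injective_iff_map_eq_zero]
    intro m hm
    obtain ⟨x, rfl⟩ := W.toCok_surjective m
    rw [← LinearMap.mem_ker, ker_toCok, ← h.ker_eq]
    exact hm
  · intro m
    obtain ⟨x, rfl⟩ := h.surjective m
    exact ⟨W.toCok x, rfl⟩

theorem nonempty_iso (hN : 0 < N) (h : W.IsCokernel M p) : Nonempty (W.toLinMCM hN ≅ M) := by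
  obtain ⟨e, he⟩ := h.exists_linearEquiv
  let F : LinMCM.Hom (W.toLinMCM hN) M :=
    { toLin := e.toLinearMap
      map_gr := by
        rintro n _ ⟨x, rfl⟩
        exact (he _).symm ▸ h.map_homZ_mem n x }
  let G : LinMCM.Hom M (W.toLinMCM hN) :=
    { toLin := e.symm.toLinearMap
      map_gr := by
        intro n m hm
        obtain ⟨x, rfl⟩ := h.mem_gr_iff.1 hm
        refine ⟨x, ?_⟩
        exact (e.symm_apply_eq.2 (he _).symm).symm }
  exact ⟨⟨F, G, LinMCM.Hom.ext (LinearMap.ext fun m => e.symm_apply_apply m),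
    LinMCM.Hom.ext (LinearMap.ext fun m => e.apply_symm_apply m)⟩⟩

end GrClMod.IsCokernel

/-! ### The equivalence of categories -/

section Equivalence

variable {𝕜 : Type} [Field 𝕜] [CharZero 𝕜] {N : ℕ}

theorem LinMCM.exists_isCokernel (hN : 0 < N) (M : LinMCM.{w} 𝕜 N) :
    ∃ (W : GrClMod.{w} 𝕜 N) (p : _), W.IsCokernel M p := by
  obtain ⟨n, r, φ, ψ, π, hφ, hψ, h₀, h₁, hπ, hker, h0⟩ := M.exists_factorization hN
  obtain ⟨W, b₀, b₁, hW⟩ := exists_grClMod_of_factorization.{w} hφ hψ h₀ h₁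
  exact ⟨W, _, GrClMod.isCokernel_of_matrix b₀ b₁ hW π hπ hker h0 fun c m => M.C_smul_mem c m⟩

theorem cokFunctor_isEquivalence (hN : 0 < N) : (GrClMod.cokFunctor.{w} 𝕜 N hN).IsEquivalence where
  essSurj := ⟨fun M => by
    obtain ⟨W, p, h⟩ := M.exists_isCokernel hN
    exact ⟨W, h.nonempty_iso hN⟩⟩

/-- The canonical projection `R ⊗ W₀ → coker φ_W`, semilinear over `R → R / ⟨q_N⟩`. -/
noncomputable def GrClMod.toCokY (hN : 0 < N) (W : GrClMod.{w} 𝕜 N) :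
    (MvPolynomial (Fin N) 𝕜 ⊗[𝕜] W.gr 0) →ₛₗ[toY 𝕜 N] (W.toLinMCM hN).carrier :=
  ⟨W.toCok.toAddHom, fun r x => W.toCok.map_smul r x⟩

theorem GrClMod.isCokernel_toCokY (hN : 0 < N) (W : GrClMod.{w} 𝕜 N) :
    W.IsCokernel (W.toLinMCM hN) (W.toCokY hN) where
  surjective := W.toCok_surjective
  ker_eq := by
    rw [← W.ker_toCok]; rfl
  degree_zero := W.toCok_one_tmul_mem

end Equivalence

/-! ### The Clifford module of a valise Adinkra -/

namespace Adinkra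

variable {𝕜 : Type} [Field 𝕜] {N : ℕ} {V : Type w}

/-- The edge of color `i` at `v`. -/
noncomputable def edge (A : Adinkra V N) (i : Fin N) (v : V) : A.graph.edgeSet :=
  (A.color_regular v i).choose

theorem mem_edge (A : Adinkra V N) (i : Fin N) (v : V) : v ∈ (A.edge i v).1 :=
  (A.color_regular v i).choose_spec.1.1

theorem color_edge (A : Adinkra V N) (i : Fin N) (v : V) : A.color (A.edge i v) = i :=
  (A.color_regular v i).choose_spec.1.2

/-- The neighbor of `v` along the edge of color `i`. -/
noncomputable def nbr (A : Adinkra V N) (i : Fin N) (v : V) : V :=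
  Sym2.Mem.other (A.mem_edge i v)

theorem edge_eq (A : Adinkra V N) (i : Fin N) (v : V) : s(v, A.nbr i v) = (A.edge i v).1 :=
  Sym2.other_spec (A.mem_edge i v)

theorem adj_nbr (A : Adinkra V N) (i : Fin N) (v : V) : A.graph.Adj v (A.nbr i v) := by
  rw [← SimpleGraph.mem_edgeSet, A.edge_eq]
  exact (A.edge i v).2

theorem color_nbr (A : Adinkra V N) (i : Fin N) (v : V) :
    A.color ⟨s(v, A.nbr i v), A.adj_nbr i v⟩ = i := by
  have : (⟨s(v, A.nbr i v), A.adj_nbr i v⟩ : A.graph.edgeSet) = A.edge i v :=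
    Subtype.ext (A.edge_eq i v)
  rw [this, A.color_edge]

theorem nbr_eq (A : Adinkra V N) {i : Fin N} {v u : V} (h : A.graph.Adj v u)
    (hc : A.color ⟨s(v, u), h⟩ = i) : A.nbr i v = u :=
  A.neighbor_unique (A.adj_nbr i v) h ((A.color_nbr i v).trans hc.symm)

/-- The sign of the edge of color `i` at `v`, as a scalar. -/
noncomputable def esign (A : Adinkra V N) (𝕜 : Type) [Field 𝕜] (i : Fin N) (v : V) : 𝕜 :=
  ((A.sign ⟨s(v, A.nbr i v), A.adj_nbr i v⟩ : ℤ) : 𝕜)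

theorem esign_eq (A : Adinkra V N) {i : Fin N} {v u : V} (h : A.graph.Adj v u)
    (hc : A.color ⟨s(v, u), h⟩ = i) : A.esign 𝕜 i v = ((A.sign ⟨s(v, u), h⟩ : ℤ) : 𝕜) := by
  obtain rfl := A.nbr_eq h hc
  rfl

theorem nbr_nbr (A : Adinkra V N) (i : Fin N) (v : V) : A.nbr i (A.nbr i v) = v :=
  A.nbr_eq (A.adj_nbr i v).symm (by rw [← A.edge_swap (A.adj_nbr i v), color_nbr])

theorem esign_nbr (A : Adinkra V N) (i : Fin N) (v : V) :
    A.esign 𝕜 i (A.nbr i v) = A.esign 𝕜 i v := by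
  rw [A.esign_eq (A.adj_nbr i v).symm (by rw [← A.edge_swap (A.adj_nbr i v), color_nbr]),
    ← A.edge_swap (A.adj_nbr i v)]
  rfl

theorem esign_mul_self (A : Adinkra V N) (i : Fin N) (v : V) :
    A.esign 𝕜 i v * A.esign 𝕜 i v = 1 := by
  rw [esign, ← Int.cast_mul, ← Units.val_mul, Int.units_mul_self]
  simp

/-- The two paths `i, j` and `j, i` from `v` are the two halves of one 4-cycle; the odd dashing of
that cycle gives them opposite signs. -/
theorem nbr_comm_and_sign (A : Adinkra V N) {i j : Fin N} (h : i ≠ j) (v : V) :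
    A.nbr j (A.nbr i v) = A.nbr i (A.nbr j v) ∧
      A.esign 𝕜 i v * A.esign 𝕜 j (A.nbr i v) +
        A.esign 𝕜 j v * A.esign 𝕜 i (A.nbr j v) = 0 := by
  have hsgn : ∀ a b c d : ZMod 2, a + b + c + d = 1 →
      (((-1 : ℤˣ) ^ a.val : ℤˣ) : ℤ) * (((-1 : ℤˣ) ^ b.val : ℤˣ) : ℤ) +
      (((-1 : ℤˣ) ^ d.val : ℤˣ) : ℤ) * (((-1 : ℤˣ) ^ c.val : ℤˣ) : ℤ) = 0 := by decide
  obtain ⟨v₁, v₂, v₃, h₀, h₁, h₂, h₃, c₀, c₁, c₂, c₃, hd⟩ := A.four_cycle i j h v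
  have c₃' : A.color ⟨s(v, v₃), h₃.symm⟩ = j := by rw [← A.edge_swap h₃]; exact c₃
  have c₂' : A.color ⟨s(v₃, v₂), h₂.symm⟩ = i := by rw [← A.edge_swap h₂]; exact c₂
  rw [A.nbr_eq h₀ c₀, A.nbr_eq h₁ c₁, A.nbr_eq h₃.symm c₃', A.nbr_eq h₂.symm c₂']
  refine ⟨rfl, ?_⟩
  rw [A.esign_eq h₀ c₀, A.esign_eq h₁ c₁, A.esign_eq h₃.symm c₃', A.esign_eq h₂.symm c₂',
    ← A.edge_swap h₃, ← A.edge_swap h₂]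
  have := hsgn _ _ _ _ hd
  simp only [sign]
  exact_mod_cast congrArg (fun z : ℤ => (z : 𝕜)) this

/-- The operator on `𝕜^V` encoded by the edges of color `i`. -/
noncomputable def colorOp (A : Adinkra V N) (𝕜 : Type) [Field 𝕜] (i : Fin N) :
    Module.End 𝕜 (V → 𝕜) where
  toFun x v := A.esign 𝕜 i v * x (A.nbr i v)
  map_add' x y := by ext; simp [mul_add]
  map_smul' r x := by ext; simp [mul_left_comm]

@[simp]
theorem colorOp_apply (A : Adinkra V N) (i : Fin N) (x : V → 𝕜) (v : V) :
    A.colorOp 𝕜 i x v = A.esign 𝕜 i v * x (A.nbr i v) := rfl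

theorem colorOp_single [DecidableEq V] (A : Adinkra V N) (i : Fin N) (v : V) :
    A.colorOp 𝕜 i (Pi.single v 1) = A.esign 𝕜 i v • Pi.single (A.nbr i v) 1 := by
  funext u
  rw [colorOp_apply, Pi.smul_apply]
  by_cases h : u = A.nbr i v
  · subst h
    rw [nbr_nbr, esign_nbr, Pi.single_eq_same, Pi.single_eq_same, smul_eq_mul]
  · have h' : A.nbr i u ≠ v := fun e => h (by rw [← e, nbr_nbr])
    rw [Pi.single_eq_of_ne h, Pi.single_eq_of_ne h', smul_zero, mul_zero]

theorem colorOp_mul_add (A : Adinkra V N) (i j : Fin N) :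
    A.colorOp 𝕜 i * A.colorOp 𝕜 j + A.colorOp 𝕜 j * A.colorOp 𝕜 i =
      if i = j then 2 else 0 := by
  refine LinearMap.ext fun x => funext fun v => ?_
  simp only [LinearMap.add_apply, Module.End.mul_apply, colorOp_apply, Pi.add_apply]
  split_ifs with h
  · subst h
    rw [nbr_nbr, esign_nbr, ← mul_assoc, esign_mul_self, one_mul, Module.End.ofNat_apply, two_smul]
    rfl
  · obtain ⟨h1, h2⟩ := A.nbr_comm_and_sign (𝕜 := 𝕜) h v
    rw [h1, ← mul_assoc, ← mul_assoc, ← add_mul, h2, zero_mul]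
    rfl

end Adinkra

/-- Double the square and exchange the indices in one copy; the anticommutators leave only the
diagonal, and the factor `2` cancels. -/
theorem sum_smul_mul_self {𝕜 E : Type*} [Field 𝕜] [CharZero 𝕜] {N : ℕ} [Ring E] [Algebra 𝕜 E]
    {e : Fin N → E} (he : ∀ i j, e i * e j + e j * e i = if i = j then 2 else 0) (c : Fin N → 𝕜) :
    (∑ i, c i • e i) * (∑ i, c i • e i) = algebraMap 𝕜 E (∑ i, c i * c i) := by
  have h1 : (∑ i, c i • e i) * (∑ i, c i • e i) = ∑ i, ∑ j, (c i * c j) • (e i * e j) := by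
    rw [Finset.sum_mul_sum]
    simp only [smul_mul_smul_comm]
  have h2 : (2 : 𝕜) • ((∑ i, c i • e i) * (∑ i, c i • e i)) =
      (2 : 𝕜) • algebraMap 𝕜 E (∑ i, c i * c i) := by
    rw [two_smul]
    conv_lhs => rw [h1]; rhs; rw [Finset.sum_comm]
    simp only [← Finset.sum_add_distrib]
    have : ∀ i j, (c i * c j) • (e i * e j) + (c j * c i) • (e j * e i) =
        if i = j then (2 * (c i * c i)) • (1 : E) else 0 := by
      intro i j
      rw [mul_comm (c j), ← smul_add, he]
      split_ifs with h
      · subst h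
        rw [mul_comm 2, mul_smul (c i * c i) (2 : 𝕜), two_smul, one_add_one_eq_two]
      · rw [smul_zero]
    simp only [this, Finset.sum_ite_eq, Finset.mem_univ, if_true]
    rw [← Finset.sum_smul, ← Finset.mul_sum, mul_smul, Algebra.algebraMap_eq_smul_one]
  exact smul_right_injective E (two_ne_zero : (2 : 𝕜) ≠ 0) h2

/-- The two parts of the basis span subspaces of `P` and `Q` that together fill `E`; disjointness
then forces the first span to be all of `P`. -/
theorem Module.Basis.exists_basis_of_isCompl {K E V : Type*} [Field K] [AddCommGroup E]
    [Module K E] (b : Module.Basis V K E) {P Q : Submodule K E} (h : IsCompl P Q) {s : V → Prop}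
    (hP : ∀ v, s v → b v ∈ P) (hQ : ∀ v, ¬ s v → b v ∈ Q) :
    ∃ b' : Module.Basis {v // s v} K P, ∀ v, (b' v : E) = b v := by
  have hP' : Submodule.span K (Set.range fun v : {v // s v} => b v) ≤ P := by
    rw [Submodule.span_le]; rintro _ ⟨v, rfl⟩; exact hP v v.2
  have hQ' : Submodule.span K (Set.range fun v : {v // ¬ s v} => b v) ≤ Q := by
    rw [Submodule.span_le]; rintro _ ⟨v, rfl⟩; exact hQ v v.2
  have htop : Submodule.span K (Set.range fun v : {v // s v} => b v) ⊔
      Submodule.span K (Set.range fun v : {v // ¬ s v} => b v) = ⊤ := by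
    rw [← Submodule.span_union, ← top_le_iff, ← b.span_eq]
    apply Submodule.span_mono
    rintro _ ⟨v, rfl⟩
    by_cases hv : s v
    · exact Or.inl ⟨⟨v, hv⟩, rfl⟩
    · exact Or.inr ⟨⟨v, hv⟩, rfl⟩
  have hspan : Submodule.span K (Set.range fun v : {v // s v} => b v) = P := by
    refine le_antisymm hP' fun x hx => ?_
    have hx' : x ∈ Submodule.span K (Set.range fun v : {v // s v} => b v) ⊔
      Submodule.span K (Set.range fun v : {v // ¬ s v} => b v) := by rw [htop]; trivial
    obtain ⟨y, hy, z, hz, rfl⟩ := Submodule.mem_sup.1 hx'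
    have hzP : z ∈ P := by simpa using P.sub_mem hx (hP' hy)
    rw [Submodule.disjoint_def.1 h.disjoint z hzP (hQ' hz), add_zero]
    exact hy
  have hli : LinearIndependent K fun v : {v // s v} => b v :=
    b.linearIndependent.comp _ Subtype.val_injective
  exact ⟨(Module.Basis.span hli).map (LinearEquiv.ofEq _ _ hspan), fun v => by
    rw [Module.Basis.map_apply, LinearEquiv.coe_ofEq_apply, Module.Basis.span_apply]⟩

namespace Adinkra

variable {𝕜 : Type} [Field 𝕜] {N : ℕ} {V : Type w} [Fintype V]

omit [Fintype V] in
theorem cast_height_nbr (A : Adinkra V N) (i : Fin N) (v : V) :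
    (A.height (A.nbr i v) : ZMod 2) = A.height v + 1 := by
  have := A.height_adj v (A.nbr i v) (A.adj_nbr i v)
  rcases (abs_eq zero_le_one).1 this with h | h
  · rw [sub_eq_iff_eq_add.1 h]; push_cast; ring
  · rw [sub_eq_iff_eq_add.1 h]; push_cast
    rw [CharTwo.neg_eq, add_comm]

/-- Edges change the height by one, so the signed permutations are odd for the grading by height
modulo `2`. No bound on the heights is needed. -/
theorem exists_hasCliffordModule [CharZero 𝕜] (A : Adinkra V N) :
    ∃ W : GrClMod.{w} 𝕜 N, A.HasCliffordModule W := by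
  classical
  let f : (Fin N → 𝕜) →ₗ[𝕜] Module.End 𝕜 (V → 𝕜) := Fintype.linearCombination 𝕜 (A.colorOp 𝕜)
  have hf : ∀ c, f c * f c = algebraMap 𝕜 (Module.End 𝕜 (V → 𝕜)) (qForm 𝕜 N c) := by
    intro c
    have := sum_smul_mul_self (E := Module.End 𝕜 (V → 𝕜)) (fun i j => A.colorOp_mul_add i j) c
    rw [Fintype.linearCombination_apply, this]
    simp [QuadraticMap.weightedSumSquares_apply]
  let gr : ZMod 2 → Submodule 𝕜 (V → 𝕜) := fun j =>
    { carrier := {x | ∀ v, (A.height v : ZMod 2) ≠ j → x v = 0}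
      zero_mem' := fun _ _ => rfl
      add_mem' := fun hx hy v hv => by rw [Pi.add_apply, hx v hv, hy v hv, add_zero]
      smul_mem' := fun c x hx v hv => by rw [Pi.smul_apply, hx v hv, smul_zero] }
  have hgr : ∀ c j, ∀ m ∈ gr j, f c m ∈ gr (j + 1) := by
    intro c j m hm
    rw [Fintype.linearCombination_apply, LinearMap.sum_apply]
    refine Submodule.sum_mem _ fun i _ => Submodule.smul_mem _ _ fun v hv => ?_
    rw [colorOp_apply, hm, mul_zero]
    intro h
    apply hv
    rw [← h, cast_height_nbr, add_assoc, CharTwo.add_self_eq_zero, add_zero]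
  have hcompl : IsCompl (gr 0) (gr 1) := by
    constructor
    · rw [Submodule.disjoint_def]
      intro x h0 h1
      funext v
      by_cases h : (A.height v : ZMod 2) = 0
      · exact h1 v (by rw [h]; decide)
      · exact h0 v h
    · rw [codisjoint_iff, Submodule.eq_top_iff']
      intro x
      refine Submodule.mem_sup.2 ⟨fun v => if (A.height v : ZMod 2) = 0 then x v else 0, ?_,
        fun v => if (A.height v : ZMod 2) = 0 then 0 else x v, ?_, ?_⟩
      · intro v hv
        exact if_neg hv
      · intro v hv
        have : ∀ a : ZMod 2, a ≠ 1 → a = 0 := by decide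
        exact if_pos (this _ hv)
      · funext v
        rw [Pi.add_apply]
        split_ifs <;> simp
  have hmem : ∀ v, Pi.basisFun 𝕜 V v ∈ gr (A.height v) := by
    intro v u hu
    rw [Pi.basisFun_apply, Pi.single_eq_of_ne]
    rintro rfl
    exact hu rfl
  have hop : ∀ v u (h : A.graph.Adj v u), A.colorOp 𝕜 (A.color ⟨s(v, u), h⟩) (Pi.basisFun 𝕜 V v) =
      ((A.sign ⟨s(v, u), h⟩ : ℤ) : 𝕜) • Pi.basisFun 𝕜 V u := by
    intro v u h
    rw [Pi.basisFun_apply, Pi.basisFun_apply, colorOp_single, A.esign_eq h rfl, A.nbr_eq h rfl]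
  refine ⟨GrClMod.ofOperators f hf gr ((isInternal_zmod_two_iff gr).2 hcompl) hgr,
    Pi.basisFun 𝕜 V, fun v => ?_, fun v u h => ?_⟩
  · exact hmem v
  · refine (GrClMod.ofOperators_gen_smul f hf gr _ hgr _ _).trans ?_
    rw [Fintype.linearCombination_apply_single, one_smul]
    exact hop v u h

omit [Fintype V] in
theorem coeffD_eq_sum (A : Adinkra V N) {w v : V} (h : A.height v = A.height w + 1)
    [DecidableEq V] :
    A.coeffD 𝕜 w v = ∑ i, if A.nbr i v = w then C (A.esign 𝕜 i v) * X i else 0 := by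
  by_cases hadj : A.graph.Adj v w
  · rw [coeffD, dif_pos ⟨hadj, h⟩, Finset.sum_eq_single (A.color ⟨s(v, w), hadj⟩),
      if_pos (A.nbr_eq hadj rfl), A.esign_eq hadj rfl]
    · simp
    · intro i _ hi
      rw [if_neg]
      rintro rfl
      exact hi (A.color_nbr i v).symm
    · simp
  · rw [coeffD, dif_neg fun hh => hadj hh.1, Finset.sum_eq_zero]
    intro i _
    rw [if_neg]
    rintro rfl
    exact hadj (A.adj_nbr i v)

-- Reading each edge from its lower end is the form needed for the transposed matrix, that is, for
-- `d†`.
omit [Fintype V] in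
theorem coeffD_eq_sum' (A : Adinkra V N) {w v : V} (h : A.height v = A.height w + 1)
    [DecidableEq V] :
    A.coeffD 𝕜 w v = ∑ i, if A.nbr i w = v then C (A.esign 𝕜 i w) * X i else 0 := by
  rw [A.coeffD_eq_sum h]
  refine Finset.sum_congr rfl fun i _ => ?_
  by_cases hi : A.nbr i w = v
  · subst hi
    rw [if_pos (A.nbr_nbr i w), if_pos rfl, esign_nbr]
  · rw [if_neg hi, if_neg]
    rintro rfl
    exact hi (A.nbr_nbr i v)

omit [Fintype V] in
theorem isHomogeneous_coeffD (A : Adinkra V N) (w v : V) : (A.coeffD 𝕜 w v).IsHomogeneous 1 := by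
  rw [coeffD]
  split_ifs with h
  · have := isHomogeneous_C_mul_X ((A.sign ⟨s(v, w), h.1⟩ : ℤ) : 𝕜) (A.color ⟨s(v, w), h.1⟩)
    rwa [map_intCast] at this
  · exact isHomogeneous_zero _ _ _

/-- With only two heights, every edge runs from height `1` to height `0`, so `d` sees all the edges
and is the odd-to-even block of the Clifford action. The even-to-odd block is its transpose because
an edge has the same sign at both ends. -/
theorem exists_bases [CharZero 𝕜] (A : Adinkra V N) (h01 : A.InHeights01) {W : GrClMod.{w} 𝕜 N}
    (h : A.HasCliffordModule W) :
    ∃ (b₀ : Module.Basis (A.Level 0) 𝕜 (W.gr 0)) (b₁ : Module.Basis (A.Level (-1)) 𝕜 (W.gr 1)),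
      (∀ k, W.phi (1 ⊗ₜ b₁ k) = ∑ l, A.dMatrix 𝕜 (-1) 0 l k ⊗ₜ b₀ l) ∧
      ∀ l, linForm W.actUp (1 ⊗ₜ b₀ l) = ∑ k, (A.dMatrix 𝕜 (-1) 0).transpose k l ⊗ₜ b₁ k := by
  classical
  obtain ⟨b, hgr, hb⟩ := h
  have hgen : ∀ i v, Cl.gen 𝕜 N i • b v = A.esign 𝕜 i v • b (A.nbr i v) := by
    intro i v
    have := hb v _ (A.adj_nbr i v)
    rwa [A.color_nbr] at this
  have hv0 : ∀ v, A.height v = -0 → b v ∈ W.gr 0 := by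
    intro v hv
    have := hgr v
    rw [hv] at this
    simpa using this
  have hv1 : ∀ v, A.height v = - -1 → b v ∈ W.gr 1 := by
    intro v hv
    have := hgr v
    rw [hv] at this
    simpa using this
  obtain ⟨b₀, hb₀⟩ := b.exists_basis_of_isCompl W.isCompl_gr (s := fun v => A.height v = -0) hv0
    fun v hv => hv1 v (by have := h01 v; omega)
  obtain ⟨b₁, hb₁⟩ := b.exists_basis_of_isCompl W.isCompl_gr.symm
    (s := fun v => A.height v = - -1) hv1 fun v hv => hv0 v (by have := h01 v; omega)
  have hn0 : ∀ i v, A.height v = - -1 → A.height (A.nbr i v) = -0 := by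
    intro i v hv
    have := A.height_adj v _ (A.adj_nbr i v)
    rcases h01 (A.nbr i v) with h | h <;> rw [h, hv] at this <;> simp_all
  have hn1 : ∀ i v, A.height v = -0 → A.height (A.nbr i v) = - -1 := by
    intro i v hv
    have := A.height_adj v _ (A.adj_nbr i v)
    rcases h01 (A.nbr i v) with h | h <;> rw [h, hv] at this <;> simp_all
  have hact : ∀ i (k : A.Level (-1)), W.act i (b₁ k) =
      A.esign 𝕜 i k • b₀ ⟨A.nbr i k, hn0 i k k.2⟩ := by
    intro i k
    apply Subtype.ext
    rw [GrClMod.coe_act, hb₁, hgen, Submodule.coe_smul, hb₀]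
  have hactUp : ∀ i (l : A.Level 0), W.actUp i (b₀ l) =
      A.esign 𝕜 i l • b₁ ⟨A.nbr i l, hn1 i l l.2⟩ := by
    intro i l
    apply Subtype.ext
    rw [GrClMod.coe_actUp, hb₀, hgen, Submodule.coe_smul, hb₁]
  have hht : ∀ (l : A.Level 0) (k : A.Level (-1)), A.height k = A.height l + 1 := by
    intro l k
    have := l.2; have := k.2; omega
  refine ⟨b₀, b₁, fun k => ?_, fun l => ?_⟩
  · rw [GrClMod.phi_eq_linForm, linForm_one_tmul]
    have : ∀ l : A.Level 0, A.dMatrix 𝕜 (-1) 0 l k ⊗ₜ[𝕜] b₀ l =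
        ∑ i, if l = ⟨A.nbr i k, hn0 i k k.2⟩ then
          (C (A.esign 𝕜 i k) * X i : MvPolynomial (Fin N) 𝕜) ⊗ₜ[𝕜] b₀ l else 0 := by
      intro l
      rw [dMatrix, Matrix.of_apply, A.coeffD_eq_sum (hht l k), TensorProduct.sum_tmul]
      refine Finset.sum_congr rfl fun i _ => ?_
      rw [TensorProduct.ite_tmul]
      simp only [Subtype.ext_iff, eq_comm]
    simp only [this]
    rw [Finset.sum_comm]
    refine Finset.sum_congr rfl fun i _ => ?_
    rw [Finset.sum_ite_eq' Finset.univ, if_pos (Finset.mem_univ _), hact, ← smul_eq_C_mul,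
      TensorProduct.smul_tmul]
  · rw [linForm_one_tmul]
    have : ∀ k : A.Level (-1), (A.dMatrix 𝕜 (-1) 0).transpose k l ⊗ₜ[𝕜] b₁ k =
        ∑ i, if k = ⟨A.nbr i l, hn1 i l l.2⟩ then
          (C (A.esign 𝕜 i l) * X i : MvPolynomial (Fin N) 𝕜) ⊗ₜ[𝕜] b₁ k else 0 := by
      intro k
      rw [Matrix.transpose_apply, dMatrix, Matrix.of_apply, A.coeffD_eq_sum' (hht l k),
        TensorProduct.sum_tmul]
      refine Finset.sum_congr rfl fun i _ => ?_
      rw [TensorProduct.ite_tmul]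
      simp only [Subtype.ext_iff, eq_comm]
    simp only [this]
    rw [Finset.sum_comm]
    refine Finset.sum_congr rfl fun i _ => ?_
    rw [Finset.sum_ite_eq' Finset.univ, if_pos (Finset.mem_univ _), hactUp, ← smul_eq_C_mul,
      TensorProduct.smul_tmul]

theorem hasCokernel_of_isCokernel [CharZero 𝕜] (A : Adinkra V N) (h01 : A.InHeights01)
    {W : GrClMod.{w} 𝕜 N} (h : A.HasCliffordModule W) {M : LinMCM.{w} 𝕜 N}
    {p : (MvPolynomial (Fin N) 𝕜 ⊗[𝕜] W.gr 0) →ₛₗ[toY 𝕜 N] M.carrier} (hp : W.IsCokernel M p) :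
    A.HasCokernel M := by
  classical
  obtain ⟨b₀, b₁, h0, -⟩ := A.exists_bases h01 h
  let E := GrClMod.coordEquiv N b₀
  have hE : ∀ k z v, E (homComp N (W.gr 0) k z) v = homogeneousComponent k (E z v) :=
    fun k z v => GrClMod.coordEquiv_homComp b₀ k z v
  let π : A.Cx 𝕜 0 →ₛₗ[toY 𝕜 N] M.carrier := p.comp E.symm.toLinearMap
  have hker : LinearMap.ker π = LinearMap.range (A.d 𝕜 (-1) 0) := by
    ext x
    rw [LinearMap.mem_ker, LinearMap.comp_apply, ← LinearMap.mem_ker, hp.ker_eq]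
    constructor
    · rintro ⟨z, hz⟩
      refine ⟨GrClMod.coordEquiv N b₁ z, ?_⟩
      have := GrClMod.coordEquiv_map b₀ b₁ W.phi h0 z
      rw [hz] at this
      rw [← E.apply_symm_apply x]
      exact this.symm
    · rintro ⟨y, rfl⟩
      refine ⟨(GrClMod.coordEquiv N b₁).symm y, E.injective ?_⟩
      refine (GrClMod.coordEquiv_map b₀ b₁ W.phi h0 _).trans ?_
      rw [LinearEquiv.apply_symm_apply]
      exact (E.apply_symm_apply _).symm
  refine ⟨(LinearMap.range (A.d 𝕜 (-1) 0)).liftQ π hker.ge, ⟨?_, ?_⟩, fun n => ?_⟩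
  · rw [injective_iff_map_eq_zero]
    intro m hm
    obtain ⟨x, rfl⟩ := Submodule.mkQ_surjective _ m
    rw [← LinearMap.mem_ker, Submodule.ker_mkQ, ← hker]
    exact hm
  · intro m
    obtain ⟨z, rfl⟩ := hp.surjective m
    exact ⟨Submodule.mkQ _ (E z), congrArg p (E.symm_apply_apply z)⟩
  · ext m
    rw [SetLike.mem_coe, hp.mem_gr_iff]
    constructor
    · rintro ⟨_, ⟨x, hx, rfl⟩, rfl⟩
      refine ⟨E.symm x, congrArg p ?_⟩
      apply E.injective
      refine Eq.trans ?_ (E.apply_symm_apply x).symm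
      rcases lt_or_ge n 0 with hn | hn
      · rw [homZ_of_neg hn, LinearMap.zero_apply, map_zero]
        funext v
        rcases hx v with h | ⟨k, hk, -⟩
        · exact h.symm
        · omega
      · obtain ⟨k, rfl⟩ := Int.eq_ofNat_of_zero_le hn
        funext v
        rw [homZ_natCast, hE, E.apply_symm_apply]
        rcases hx v with h | ⟨j, hj, h⟩
        · rw [h, map_zero]
        · rw [homogeneousComponent_of_mem h, if_pos (by exact_mod_cast hj.symm)]
    · rintro ⟨z, rfl⟩
      refine ⟨Submodule.mkQ _ (E (homZ N (W.gr 0) n z)), ⟨_, fun v => ?_, rfl⟩,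
        congrArg p (E.symm_apply_apply _)⟩
      rcases lt_or_ge n 0 with hn | hn
      · left
        rw [homZ_of_neg hn, LinearMap.zero_apply, map_zero]
        rfl
      · obtain ⟨k, rfl⟩ := Int.eq_ofNat_of_zero_le hn
        refine Or.inr ⟨k, rfl, ?_⟩
        rw [homZ_natCast, hE]
        exact homogeneousComponent_isHomogeneous _ _

/-- The identity is transported from the Clifford module along coordinates, which avoids a second
count of 4-cycles. -/
theorem d_dAdj [CharZero 𝕜] (A : Adinkra V N) (h01 : A.InHeights01) (x : A.Cx 𝕜 0) :
    A.d 𝕜 (-1) 0 (A.dAdj 𝕜 (-1) 0 x) = qPoly 𝕜 N • x := by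
  classical
  obtain ⟨W, hW⟩ := A.exists_hasCliffordModule (𝕜 := 𝕜)
  obtain ⟨b₀, b₁, h0, h1⟩ := A.exists_bases h01 hW
  obtain ⟨z, rfl⟩ := (GrClMod.coordEquiv N b₀).surjective x
  have e := congrArg (GrClMod.coordEquiv N b₀) (W.phi_linForm_actUp z)
  rwa [GrClMod.coordEquiv_map b₀ b₁ W.phi h0, GrClMod.coordEquiv_map b₁ b₀ _ h1, map_smul] at e

theorem dAdj_d [CharZero 𝕜] (A : Adinkra V N) (h01 : A.InHeights01) (x : A.Cx 𝕜 (-1)) :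
    A.dAdj 𝕜 (-1) 0 (A.d 𝕜 (-1) 0 x) = qPoly 𝕜 N • x := by
  classical
  obtain ⟨W, hW⟩ := A.exists_hasCliffordModule (𝕜 := 𝕜)
  obtain ⟨b₀, b₁, h0, h1⟩ := A.exists_bases h01 hW
  obtain ⟨z, rfl⟩ := (GrClMod.coordEquiv N b₁).surjective x
  have e := congrArg (GrClMod.coordEquiv N b₁) (W.linForm_actUp_phi z)
  rwa [GrClMod.coordEquiv_map b₁ b₀ _ h1, GrClMod.coordEquiv_map b₀ b₁ W.phi h0, map_smul] at e

theorem isMatrixFactorization_blockMap [CharZero 𝕜] (A : Adinkra V N) (h01 : A.InHeights01) :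
    IsMatrixFactorization (qPoly 𝕜 N) (A.blockMap 𝕜) :=
  ⟨⟨_, _, rfl⟩, LinearMap.ext fun x => Prod.ext (A.d_dAdj h01 x.1) (A.dAdj_d h01 x.2)⟩

theorem isLinearEnd_blockMap (A : Adinkra V N) : IsLinearEnd (A.blockMap 𝕜) := by
  constructor
  · refine fun i => ⟨fun i' => ?_, fun k' => ?_⟩
    · have : (A.blockMap 𝕜 (Pi.single i 1, 0)).1 i' = 0 :=
        congrFun (map_zero (A.d 𝕜 (-1) 0)) i'
      rw [this]
      exact isHomogeneous_zero _ _ _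
    · have : (A.blockMap 𝕜 (Pi.single i 1, 0)).2 k' = A.coeffD 𝕜 i k' := by
        change A.dAdj 𝕜 (-1) 0 (Pi.single i 1) k' = _
        rw [dAdj, Matrix.mulVecLin_apply, Matrix.mulVec_single_one]
        rfl
      rw [this]
      exact A.isHomogeneous_coeffD _ _
  · refine fun k => ⟨fun i' => ?_, fun k' => ?_⟩
    · have : (A.blockMap 𝕜 (0, Pi.single k 1)).1 i' = A.coeffD 𝕜 i' k := by
        change A.d 𝕜 (-1) 0 (Pi.single k 1) i' = _
        rw [d, Matrix.mulVecLin_apply, Matrix.mulVec_single_one]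
        rfl
      rw [this]
      exact A.isHomogeneous_coeffD _ _
    · have : (A.blockMap 𝕜 (0, Pi.single k 1)).2 k' = 0 :=
        congrFun (map_zero (A.dAdj 𝕜 (-1) 0)) k'
      rw [this]
      exact isHomogeneous_zero _ _ _

end Adinkra

/-! ### The quasi-isomorphism onto the cokernel -/

namespace Adinkra

variable {𝕜 : Type} [Field 𝕜] {N : ℕ} {V : Type w} [Fintype V]

theorem d_injective [CharZero 𝕜] (hN : 0 < N) (A : Adinkra V N) (h01 : A.InHeights01) :
    Function.Injective (A.d 𝕜 (-1) 0) := by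
  rw [injective_iff_map_eq_zero]
  intro x hx
  have := A.dAdj_d h01 x
  rw [hx, map_zero] at this
  exact (smul_eq_zero.1 this.symm).resolve_left (qPoly_ne_zero hN)

omit [Fintype V] in
theorem subsingleton_cx (A : Adinkra V N) (h01 : A.InHeights01) {n : ℤ} (h0 : n ≠ 0)
    (h1 : n ≠ -1) : Subsingleton (A.Cx 𝕜 n) := by
  have : IsEmpty (A.Level n) := ⟨fun v => by
    have := v.2
    rcases h01 v.1 with h | h <;> omega⟩
  infer_instance

/-- The projection of `C^0(A)` onto the cokernel of the differential. -/
noncomputable def cokerProj (A : Adinkra V N) (𝕜 : Type) [Field 𝕜] :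
    (A.complex 𝕜).X 0 ⟶ ModuleCat.of (MvPolynomial (Fin N) 𝕜) (A.coker 𝕜) :=
  ModuleCat.ofHom (LinearMap.range (A.d 𝕜 (-1) 0)).mkQ

theorem epi_cokerProj (A : Adinkra V N) : Epi (A.cokerProj 𝕜) :=
  (ModuleCat.epi_iff_surjective _).2 (Submodule.mkQ_surjective _)

/-- The projection of the complex of a valise onto the cokernel of its differential. -/
noncomputable def toCoker (A : Adinkra V N) (𝕜 : Type) [Field 𝕜] :
    A.complex 𝕜 ⟶ (HomologicalComplex.single (ModuleCat (MvPolynomial (Fin N) 𝕜))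
      (ComplexShape.up ℤ) 0).obj (ModuleCat.of (MvPolynomial (Fin N) 𝕜) (A.coker 𝕜)) :=
  HomologicalComplex.mkHomToSingle (A.cokerProj 𝕜) (fun i hi => by
      obtain rfl : i = -1 := by
        have : i + 1 = 0 := hi
        omega
      apply ModuleCat.hom_ext
      exact LinearMap.range_mkQ_comp (A.d 𝕜 (-1) 0))

theorem toCoker_f (A : Adinkra V N) :
    (A.toCoker 𝕜).f 0 = A.cokerProj 𝕜 ≫
      (HomologicalComplex.singleObjXSelf (ComplexShape.up ℤ) 0 _).inv :=
  HomologicalComplex.mkHomToSingle_f _ _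

theorem toCoker_f_comp (A : Adinkra V N) :
    (A.toCoker 𝕜).f 0 ≫ (HomologicalComplex.singleObjXSelf (ComplexShape.up ℤ) 0 _).hom =
      A.cokerProj 𝕜 := by
  rw [toCoker_f, Category.assoc, Iso.inv_hom_id, Category.comp_id]

theorem mem_range_d_of_toCoker_eq_zero (A : Adinkra V N) (x : A.Cx 𝕜 0)
    (hx : ((A.toCoker 𝕜).f 0).hom x = 0) : ∃ y, A.d 𝕜 (-1) 0 y = x := by
  have h1 : (A.cokerProj 𝕜).hom x = 0 := by
    rw [← A.toCoker_f_comp]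
    exact (congrArg (HomologicalComplex.singleObjXSelf (ComplexShape.up ℤ) 0
      (ModuleCat.of (MvPolynomial (Fin N) 𝕜) (A.coker 𝕜))).hom.hom hx).trans (map_zero _)
  exact (Submodule.Quotient.mk_eq_zero _).1 h1

/-- The complex lives in degrees `-1` and `0`. Its differential is injective since `d†d = q_N` and
`q_N` is a nonzerodivisor, so only the cokernel in degree `0` remains. -/
theorem quasiIso_toCoker [CharZero 𝕜] (hN : 0 < N) (A : Adinkra V N) (h01 : A.InHeights01) :
    QuasiIso (A.toCoker 𝕜) := by
  rw [quasiIso_iff]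
  intro i
  by_cases h0 : i = 0
  · subst h0
    rw [quasiIsoAt_iff' _ (-1) 0 1 (by simp) (by simp), ShortComplex.quasiIso_iff_of_zeros']
    · constructor
      · rw [ShortComplex.moduleCat_exact_iff]
        exact A.mem_range_d_of_toCoker_eq_zero
      · change Epi ((A.toCoker 𝕜).f 0)
        rw [toCoker_f]
        have := A.epi_cokerProj (𝕜 := 𝕜)
        infer_instance
    · have := A.subsingleton_cx (𝕜 := 𝕜) h01 (n := 1) (by decide) (by decide)
      exact (ModuleCat.isZero_of_subsingleton (ModuleCat.of _ (A.Cx 𝕜 1))).eq_of_tgt _ _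
    · exact HomologicalComplex.single_obj_d (ComplexShape.up ℤ) _ _ _ _
    · exact HomologicalComplex.single_obj_d (ComplexShape.up ℤ) _ _ _ _
  · rw [quasiIsoAt_iff_exactAt]
    · exact HomologicalComplex.exactAt_single_obj _ _ _ _ h0
    · by_cases h1 : i = -1
      · subst h1
        rw [HomologicalComplex.exactAt_iff' _ (-2) (-1) 0 (by simp) (by simp),
          ShortComplex.moduleCat_exact_iff]
        intro x hx
        refine ⟨0, ?_⟩
        rw [map_zero]
        exact (A.d_injective hN h01 (hx.trans (map_zero (A.d 𝕜 (-1) 0)).symm)).symm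
      · have := A.subsingleton_cx (𝕜 := 𝕜) h01 h0 h1
        exact ShortComplex.exact_of_isZero_X₂ _
          (ModuleCat.isZero_of_subsingleton (ModuleCat.of _ (A.Cx 𝕜 i)))

end Adinkra

/-! ### Signed bases for anticommuting involutions over the reals -/

section SignedBasis

variable {𝕜 W ι : Type*} [RCLike 𝕜] [AddCommGroup W] [Module 𝕜 W]

/-- Over the reals there is a positive definite symmetric bilinear form invariant under finitely
many involutions commuting up to sign. -/
theorem exists_invariant_bilinForm [FiniteDimensional 𝕜 W]
    (hs : Function.Surjective (algebraMap ℝ 𝕜)) (a : ι → Module.End 𝕜 W)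
    (hsq : ∀ i x, a i (a i x) = x)
    (hcomm : ∀ i j, (∀ x, a i (a j x) = a j (a i x)) ∨ ∀ x, a i (a j x) = -a j (a i x))
    (s : Finset ι) :
    ∃ B : LinearMap.BilinForm 𝕜 W, (∀ x y, B x y = B y x) ∧ (∀ x, x ≠ 0 → 0 < RCLike.re (B x x)) ∧
      ∀ i ∈ s, ∀ x y, B (a i x) (a i y) = B x y := by
  classical
  have halg : ∀ r : ℝ, RCLike.re (algebraMap ℝ 𝕜 r) = r := fun r => RCLike.ofReal_re r
  induction s using Finset.induction_on with
  | empty =>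
    let b := Module.finBasis 𝕜 W
    refine ⟨∑ k, LinearMap.BilinForm.linMulLin (b.coord k) (b.coord k), fun x y => ?_,
      fun x hx => ?_, by simp⟩
    · simp [mul_comm]
    -- Here the field must be real: a sum of complex squares would not be positive.
    · have hre : ∀ c : 𝕜, RCLike.re (c * c) = RCLike.re c * RCLike.re c := by
        intro c
        obtain ⟨r, rfl⟩ := hs c
        rw [← map_mul, halg, halg]
      simp only [LinearMap.sum_apply, LinearMap.BilinForm.linMulLin_apply, map_sum, hre]
      refine Finset.sum_pos' (fun k _ => mul_self_nonneg _) ?_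
      by_contra! h
      apply hx
      rw [← b.forall_coord_eq_zero_iff]
      intro k
      obtain ⟨r, hr⟩ := hs (b.coord k x)
      have := mul_self_eq_zero.1 (le_antisymm (h k (Finset.mem_univ _)) (mul_self_nonneg _))
      rw [← hr, halg] at this
      rw [← hr, this, map_zero]
  | insert i s hi ih =>
    obtain ⟨B, h1, h2, h3⟩ := ih
    -- Averaging over one involution keeps the invariance under the earlier ones, because commuting
    -- past `a i` costs a sign that occurs in both arguments.
    refine ⟨B + B.compl₁₂ (a i) (a i), fun x y => ?_, fun x hx => ?_, fun j hj x y => ?_⟩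
    · simp [h1 x, h1 (a i x)]
    · have : a i x ≠ 0 := fun h => hx (by rw [← hsq i x, h, map_zero])
      simpa using add_pos (h2 x hx) (h2 _ this)
    · rcases Finset.mem_insert.1 hj with rfl | hj
      · simp [hsq, add_comm]
      · rcases hcomm i j with h | h <;> simp [h, h3 j hj]

/-- The operators generated by `-1` and a family of operators. -/
def signedMonoid (a : ι → Module.End 𝕜 W) : Submonoid (Module.End 𝕜 W) :=
  Submonoid.closure (insert (-1) (Set.range a))

theorem neg_one_mem_signedMonoid (a : ι → Module.End 𝕜 W) : -1 ∈ signedMonoid a :=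
  Submonoid.subset_closure (Set.mem_insert _ _)

theorem mem_signedMonoid (a : ι → Module.End 𝕜 W) (i : ι) : a i ∈ signedMonoid a :=
  Submonoid.subset_closure (Set.mem_insert_of_mem _ ⟨i, rfl⟩)

variable {a : ι → Module.End 𝕜 W}

theorem signedMonoid_induction {P : Module.End 𝕜 W → Prop} (one : P 1)
    (neg : ∀ g, P g → P (-g)) (mul : ∀ i g, P g → P (a i * g)) {g : Module.End 𝕜 W}
    (hg : g ∈ signedMonoid a) : P g := by
  induction hg using Submonoid.closure_induction_left with
  | one => exact one
  | mul_left x hx y _ ih =>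
    rcases hx with rfl | ⟨i, rfl⟩
    · simpa using neg y ih
    · exact mul i y ih

theorem signedMonoid_comm
    (hcomm : ∀ i j, (∀ x, a i (a j x) = a j (a i x)) ∨ ∀ x, a i (a j x) = -a j (a i x))
    {g h : Module.End 𝕜 W} (hg : g ∈ signedMonoid a) (hh : h ∈ signedMonoid a) :
    (∀ x, g (h x) = h (g x)) ∨ ∀ x, g (h x) = -h (g x) := by
  have key : ∀ i, (∀ x, a i (h x) = h (a i x)) ∨ ∀ x, a i (h x) = -h (a i x) := by
    intro i
    refine signedMonoid_induction (P := fun h => (∀ x, a i (h x) = h (a i x)) ∨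
      ∀ x, a i (h x) = -h (a i x)) (by simp) ?_ ?_ hh
    · rintro h (e | e) <;> simp [e]
    · rintro j h (e | e) <;> rcases hcomm i j with e' | e' <;> simp [e, e']
  refine signedMonoid_induction (P := fun g => (∀ x, g (h x) = h (g x)) ∨
      ∀ x, g (h x) = -h (g x)) (by simp) ?_ ?_ hg
  · rintro g (e | e) <;> simp [e]
  · rintro j g (e | e) <;> rcases key j with e' | e' <;> simp [e, e']

theorem signedMonoid_sq (hsq : ∀ i x, a i (a i x) = x)
    (hcomm : ∀ i j, (∀ x, a i (a j x) = a j (a i x)) ∨ ∀ x, a i (a j x) = -a j (a i x))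
    {g : Module.End 𝕜 W} (hg : g ∈ signedMonoid a) :
    (∀ x, g (g x) = x) ∨ ∀ x, g (g x) = -x := by
  have : g ∈ signedMonoid a ∧ ((∀ x, g (g x) = x) ∨ ∀ x, g (g x) = -x) := by
    refine signedMonoid_induction (P := fun g => g ∈ signedMonoid a ∧
      ((∀ x, g (g x) = x) ∨ ∀ x, g (g x) = -x)) ⟨one_mem _, by simp⟩ ?_ ?_ hg
    · rintro g ⟨hg, e⟩
      refine ⟨by simpa using mul_mem (neg_one_mem_signedMonoid a) hg, by simpa using e⟩
    · rintro i g ⟨hg, e⟩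
      refine ⟨mul_mem (mem_signedMonoid a i) hg, ?_⟩
      rcases signedMonoid_comm hcomm (mem_signedMonoid a i) hg with h | h <;>
        rcases e with e | e <;> simp [← h, hsq, e]
      all_goals simp [h, hsq, e]
  exact this.2

theorem signedMonoid_invariant {B : LinearMap.BilinForm 𝕜 W}
    (hB : ∀ i x y, B (a i x) (a i y) = B x y) {g : Module.End 𝕜 W} (hg : g ∈ signedMonoid a)
    (x y : W) : B (g x) (g y) = B x y := by
  refine signedMonoid_induction (P := fun g => B (g x) (g y) = B x y) rfl ?_ ?_ hg
  · intro g hg; simpa using hg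
  · intro i g hg; simpa [hB] using hg

/-- A subspace stable under anticommuting isometric involutions contains a vector whose orbit
consists of vectors which are orthogonal or equal up to sign. -/
theorem exists_signed_orbit [FiniteDimensional 𝕜 W] (hsq : ∀ i x, a i (a i x) = x)
    (hcomm : ∀ i j, (∀ x, a i (a j x) = a j (a i x)) ∨ ∀ x, a i (a j x) = -a j (a i x))
    {B : LinearMap.BilinForm 𝕜 W} (hsymm : ∀ x y, B x y = B y x)
    (hB : ∀ i x y, B (a i x) (a i y) = B x y) (i₀ : ι) (Y : Submodule 𝕜 W)
    (hY : ∀ g ∈ signedMonoid a, ∀ x ∈ Y, g x ∈ Y) (hne : ∃ v ∈ Y, v ≠ 0 ∧ a i₀ v = v) :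
    ∃ v ∈ Y, v ≠ 0 ∧ a i₀ v = v ∧
      ∀ g ∈ signedMonoid a, g v = v ∨ g v = -v ∨ B (g v) v = 0 := by
  -- This is the common fixed space of the stabilizer of `v`. A vector minimizing its dimension has,
  -- in effect, the most symmetry possible.
  let S : W → Submodule 𝕜 W := fun v => ⨅ g : {g // g ∈ signedMonoid a ∧ g v = v},
    LinearMap.ker (g.1 - 1)
  have hS : ∀ v x, x ∈ S v ↔ ∀ g ∈ signedMonoid a, g v = v → g x = x := by
    intro v x
    simp [S, Submodule.mem_iInf, sub_eq_zero]
  obtain ⟨v, ⟨hv, hv0, hvi⟩, hmin⟩ := (InvImage.wf (fun v => Module.finrank 𝕜 (S v))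
    wellFounded_lt).has_min {v | v ∈ Y ∧ v ≠ 0 ∧ a i₀ v = v} hne
  refine ⟨v, hv, hv0, hvi, fun g hg => ?_⟩
  by_contra! h
  obtain ⟨h1, h2, h3⟩ := h
  -- If `g² = -1`, invariance and symmetry of `B` give `B (g v) v = -B (g v) v`, contrary to the
  -- assumption.
  have hgg : ∀ x, g (g x) = x := by
    refine (signedMonoid_sq hsq hcomm hg).resolve_right fun e => h3 ?_
    have := signedMonoid_invariant hB hg (g v) v
    rw [e, map_neg, LinearMap.neg_apply, hsymm] at this
    exact self_eq_neg.1 this.symm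
  -- An element of the stabilizer that anticommuted with `g` would send `g v` to `-g v` while fixing
  -- `v`, again forcing orthogonality.
  have hp : ∀ h ∈ signedMonoid a, h v = v → h (v + g v) = v + g v := by
    intro h hh hv
    rcases signedMonoid_comm hcomm hh hg with e | e
    · rw [map_add, e, hv]
    · exfalso
      apply h3
      have := signedMonoid_invariant hB hh (g v) v
      rw [e, hv, map_neg, LinearMap.neg_apply] at this
      exact self_eq_neg.1 this.symm
  refine hmin (v + g v) ⟨add_mem hv (hY g hg v hv), fun h => h2 (eq_neg_of_add_eq_zero_right h),
    hp _ (mem_signedMonoid a i₀) hvi⟩ ?_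
  -- The stabilizer of `v + g v` contains that of `v` and also `g`. Its fixed space is strictly
  -- smaller because it omits `v`, which `g` moves.
  refine Submodule.finrank_lt_finrank_of_lt (lt_of_le_of_ne (fun x hx => ?_) fun he => h1 ?_)
  · rw [hS] at hx ⊢
    exact fun h hh hv => hx h hh (hp h hh hv)
  · have : v ∈ S (v + g v) := by
      rw [he, hS]
      exact fun _ _ h => h
    exact (hS _ _).1 this g hg (by rw [map_add, hgg, add_comm])

end SignedBasis

section SignedBasis

variable {𝕜 W ι : Type*} [RCLike 𝕜] [AddCommGroup W] [Module 𝕜 W]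

/-- A set of nonzero eigenvectors of `a i₀`, closed under signs and under the operators `a i`,
whose elements are pairwise orthogonal or equal up to sign. -/
structure IsSignedSet (a : ι → Module.End 𝕜 W) (B : LinearMap.BilinForm 𝕜 W) (i₀ : ι)
    (X : Set W) : Prop where
  ne_zero : ∀ x ∈ X, x ≠ 0
  eigen : ∀ x ∈ X, a i₀ x = x ∨ a i₀ x = -x
  neg_mem : ∀ x ∈ X, -x ∈ X
  map_mem : ∀ i, ∀ x ∈ X, a i x ∈ X
  orthogonal : ∀ x ∈ X, ∀ y ∈ X, x = y ∨ x = -y ∨ B x y = 0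

variable {a : ι → Module.End 𝕜 W}

theorem IsSignedSet.signedMonoid_mem {B : LinearMap.BilinForm 𝕜 W} {i₀ : ι} {X : Set W}
    (hX : IsSignedSet a B i₀ X) {g : Module.End 𝕜 W} (hg : g ∈ signedMonoid a) {x : W}
    (hx : x ∈ X) : g x ∈ X :=
  signedMonoid_induction (P := fun g => g x ∈ X) hx (fun _ h => hX.neg_mem _ h)
    (fun i _ h => hX.map_mem i _ h) hg

/-- The union of a signed set with the orbit of a vector orthogonal to it. -/
theorem IsSignedSet.union_orbit (hsq : ∀ i x, a i (a i x) = x)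
    (hcomm : ∀ i j, (∀ x, a i (a j x) = a j (a i x)) ∨ ∀ x, a i (a j x) = -a j (a i x))
    {B : LinearMap.BilinForm 𝕜 W} (hsymm : ∀ x y, B x y = B y x)
    (hB : ∀ i x y, B (a i x) (a i y) = B x y) {i₀ : ι} {X : Set W} (hX : IsSignedSet a B i₀ X)
    {v : W} (hv : ∀ x ∈ X, B x v = 0) (hv0 : v ≠ 0) (hvi : a i₀ v = v)
    (horb : ∀ g ∈ signedMonoid a, g v = v ∨ g v = -v ∨ B (g v) v = 0) :
    IsSignedSet a B i₀ (X ∪ (fun g : Module.End 𝕜 W => g v) '' signedMonoid a) := by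
  have hXv : ∀ x ∈ X, ∀ g ∈ signedMonoid a, B x (g v) = 0 := by
    intro x hx g hg
    rw [← signedMonoid_invariant hB hg]
    rcases signedMonoid_sq hsq hcomm hg with e | e <;> simp [e, hv _ (hX.signedMonoid_mem hg hx)]
  constructor
  · rintro _ (hx | ⟨g, hg, rfl⟩)
    · exact hX.ne_zero _ hx
    · intro (h : g v = 0)
      apply hv0
      rcases signedMonoid_sq hsq hcomm hg with e | e
      · rw [← e v, h, map_zero]
      · rw [← neg_eq_zero, ← e v, h, map_zero]
  · rintro _ (hx | ⟨g, hg, rfl⟩)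
    · exact hX.eigen _ hx
    · change a i₀ (g v) = g v ∨ a i₀ (g v) = -g v
      rcases signedMonoid_comm hcomm (mem_signedMonoid a i₀) hg with e | e <;> simp [e, hvi]
  · rintro _ (hx | ⟨g, hg, rfl⟩)
    · exact Or.inl (hX.neg_mem _ hx)
    · exact Or.inr ⟨-1 * g, mul_mem (neg_one_mem_signedMonoid a) hg, by simp⟩
  · rintro i _ (hx | ⟨g, hg, rfl⟩)
    · exact Or.inl (hX.map_mem i _ hx)
    · exact Or.inr ⟨a i * g, mul_mem (mem_signedMonoid a i) hg, by simp⟩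
  · rintro _ (hx | ⟨g, hg, rfl⟩) _ (hy | ⟨h, hh, rfl⟩)
    · exact hX.orthogonal _ hx _ hy
    · exact Or.inr (Or.inr (hXv _ hx h hh))
    · exact Or.inr (Or.inr ((hsymm _ _).trans (hXv _ hy g hg)))
    · change g v = h v ∨ g v = -h v ∨ B (g v) (h v) = 0
      -- Applying `h`, whose square is `±1`, reduces the comparison of `g v` and `h v` to that of
      -- `(h * g) v` and `v`.
      have key : B (h (g v)) (h (h v)) = B (g v) (h v) := signedMonoid_invariant hB hh _ _
      have hsgn : ∀ u, (h (h u) = u ∧ h (h v) = v) ∨ (h (h u) = -u ∧ h (h v) = -v) := by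
        intro u
        rcases signedMonoid_sq hsq hcomm hh with e | e <;> simp [e]
      rcases horb (h * g) (mul_mem hh hg) with e | e | e <;>
        rcases hsgn (g v) with ⟨e1, e2⟩ | ⟨e1, e2⟩ <;> rw [Module.End.mul_apply] at e
      · left; rw [← e1, e]
      · right; left; rw [← neg_neg (g v), ← e1, e]
      · right; left; rw [← e1, e, map_neg]
      · left; rw [← neg_neg (g v), ← e1, e, map_neg, neg_neg]
      · right; right; rw [← key, e2, e]
      · right; right; rw [← key, e2, map_neg, e, neg_zero]

/-- Anticommuting involutions of a real vector space permute a basis up to signs. -/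
theorem exists_signed_basis [FiniteDimensional 𝕜 W] [Finite ι]
    (hs : Function.Surjective (algebraMap ℝ 𝕜)) (hsq : ∀ i x, a i (a i x) = x)
    (hanti : ∀ i j, i ≠ j → ∀ x, a i (a j x) = -a j (a i x)) {i₀ i₁ : ι} (hi : i₁ ≠ i₀) :
    ∃ (V : Set W) (b : Module.Basis V 𝕜 W), (∀ v, b v = v) ∧
      (∀ v, a i₀ (b v) = b v ∨ a i₀ (b v) = -b v) ∧
      ∀ i v, ∃ u, a i (b v) = b u ∨ a i (b v) = -b u := by
  have := Fintype.ofFinite ι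
  have hcomm : ∀ i j, (∀ x, a i (a j x) = a j (a i x)) ∨ ∀ x, a i (a j x) = -a j (a i x) := by
    intro i j
    by_cases h : i = j
    · subst h; exact Or.inl fun _ => rfl
    · exact Or.inr (hanti i j h)
  obtain ⟨B, hsymm, hpos, hB⟩ := exists_invariant_bilinForm hs a hsq hcomm Finset.univ
  replace hB := fun i => hB i (Finset.mem_univ i)
  have hB0 : ∀ x, B x x = 0 → x = 0 := fun x hx => by
    by_contra h
    have := hpos x h
    rw [hx, map_zero] at this
    exact lt_irrefl _ this
  -- Take a signed set with maximal span; the empty set shows that one exists.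
  obtain ⟨_, ⟨X, hX, rfl⟩, hmax⟩ := (wellFounded_gt (α := Submodule 𝕜 W)).has_min
    {P | ∃ X, IsSignedSet a B i₀ X ∧ Submodule.span 𝕜 X = P}
    ⟨_, ∅, ⟨by simp, by simp, by simp, by simp, by simp⟩, rfl⟩
  have hXY : ∀ y, y ∈ B.orthogonal (Submodule.span 𝕜 X) ↔ ∀ x ∈ X, B x y = 0 := by
    intro y
    rw [LinearMap.BilinForm.mem_orthogonal_iff]
    refine ⟨fun h x hx => h x (Submodule.subset_span hx), fun h x hx => ?_⟩
    have : Submodule.span 𝕜 X ≤ LinearMap.ker (B.flip y) :=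
      Submodule.span_le.2 fun x hx => h x hx
    exact this hx
  have htop : Submodule.span 𝕜 X = ⊤ := by
    have hbot : B.orthogonal (Submodule.span 𝕜 X) = ⊥ := by
      by_contra hne
      obtain ⟨u, hu, hu0⟩ := Submodule.exists_mem_ne_zero_of_ne_bot hne
      have hY : ∀ g ∈ signedMonoid a, ∀ x ∈ B.orthogonal (Submodule.span 𝕜 X),
          g x ∈ B.orthogonal (Submodule.span 𝕜 X) := by
        intro g hg y hy
        rw [hXY] at hy ⊢
        intro x hx
        rw [← signedMonoid_invariant hB hg]
        rcases signedMonoid_sq hsq hcomm hg with e | e <;>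
          simp [e, hy _ (hX.signedMonoid_mem hg hx)]
      -- Symmetrizing `u` under `a i₀` works unless `a i₀ u = -u`; in that case the anticommuting
      -- involution `a i₁` carries `u` into the `+1` eigenspace.
      have hex : ∃ v ∈ B.orthogonal (Submodule.span 𝕜 X), v ≠ 0 ∧ a i₀ v = v := by
        by_cases h : u + a i₀ u = 0
        · refine ⟨a i₁ u, hY _ (mem_signedMonoid a i₁) _ hu, fun h0 => hu0 ?_, ?_⟩
          · rw [← hsq i₁ u, h0, map_zero]
          · rw [hanti _ _ hi.symm, eq_neg_of_add_eq_zero_right h, map_neg, neg_neg]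
        · exact ⟨_, add_mem hu (hY _ (mem_signedMonoid a i₀) _ hu), h, by
            rw [map_add, hsq, add_comm]⟩
      obtain ⟨v, hv, hv0, hvi, horb⟩ := exists_signed_orbit hsq hcomm hsymm hB i₀ _ hY hex
      refine hmax _ ⟨_, hX.union_orbit hsq hcomm hsymm hB ((hXY v).1 hv) hv0 hvi horb, rfl⟩ ?_
      refine lt_of_le_of_ne (Submodule.span_mono Set.subset_union_left) fun he => hv0 (hB0 v ?_)
      refine (LinearMap.BilinForm.mem_orthogonal_iff.1 hv) v ?_
      rw [he]
      exact Submodule.subset_span (Or.inr ⟨1, one_mem _, rfl⟩)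
    have hnd : (B.restrict (Submodule.span 𝕜 X)).Nondegenerate :=
      ⟨fun x h => Subtype.ext (hB0 _ (h x)), fun x h => Subtype.ext (hB0 _ (h x))⟩
    have := (LinearMap.BilinForm.isCompl_orthogonal_of_restrict_nondegenerate
      (fun x y h => (hsymm y x).trans h) hnd)
    rw [hbot] at this
    simpa using this.codisjoint.eq_top
  obtain ⟨V, hVX, hspan, hli⟩ := exists_linearIndependent 𝕜 X
  have hVtop : ⊤ ≤ Submodule.span 𝕜 (Set.range ((↑) : V → W)) := by
    rw [Subtype.range_coe, hspan, htop]
  let b := Module.Basis.mk hli hVtop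
  have hb : ∀ v, b v = v := fun v => Module.Basis.mk_apply _ _ _
  refine ⟨V, b, hb, fun v => ?_, fun i v => ?_⟩
  · rw [hb]
    exact hX.eigen _ (hVX v.2)
  · by_contra! h
    have hx := hX.map_mem i _ (hVX v.2)
    refine hX.ne_zero _ hx (hB0 _ ?_)
    -- The image `a i v` lies in `X`. If it were not `±` a member of the basis, it would be
    -- orthogonal to the entire basis, hence zero by definiteness.
    have : (⊤ : Submodule 𝕜 W) ≤ LinearMap.ker (B (a i v)) := by
      rw [← htop, ← hspan, Submodule.span_le]
      intro u hu
      rcases hX.orthogonal _ hx _ (hVX hu) with e | e | e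
      · exact absurd (by rw [hb, hb]; exact e) (h ⟨u, hu⟩).1
      · exact absurd (by rw [hb, hb]; exact e) (h ⟨u, hu⟩).2
      · exact e
    exact this Submodule.mem_top

end SignedBasis

/-! ### Building an Adinkra from signed permutations -/

namespace Adinkra

variable {N : ℕ} {V : Type*}

/-- The Adinkra determined by the neighbours of each vertex and the signs and heights. -/
theorem exists_of_nbr (n : Fin N → V → V) (p : Fin N → V → ZMod 2) (ht : V → ZMod 2)
    (hnn : ∀ i v, n i (n i v) = v) (hp : ∀ i v, p i (n i v) = p i v)
    (hht : ∀ i v, ht (n i v) ≠ ht v) (hinj : ∀ i j v, n i v = n j v → i = j)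
    (hcomm : ∀ i j v, n i (n j v) = n j (n i v))
    (hsum : ∀ i j v, i ≠ j → p i v + p j (n i v) + p i (n j v) + p j v = 1) :
    ∃ A : Adinkra V N, (∀ v, A.height v = (ht v).val) ∧
      (∀ i v, A.graph.Adj v (n i v)) ∧
      ∀ (v u : V) (h : A.graph.Adj v u), n (A.color ⟨s(v, u), h⟩) v = u ∧
        A.dash ⟨s(v, u), h⟩ = p (A.color ⟨s(v, u), h⟩) v := by
  let G : SimpleGraph V :=
    { Adj := fun v u => ∃ i, n i v = u
      symm := ⟨fun v u ⟨i, hi⟩ => ⟨i, by rw [← hi, hnn]⟩⟩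
      loopless := ⟨fun v ⟨i, hi⟩ => hht i v (by rw [hi])⟩ }
  have hc : ∀ e : G.edgeSet, ∃ i, ∃ v, e.1 = s(v, n i v) := by
    rintro ⟨e, he⟩
    induction e using Sym2.ind with
    | _ v u =>
      obtain ⟨i, hi⟩ := he
      exact ⟨i, v, by rw [hi]⟩
  -- The dashing of an edge is read at an arbitrarily chosen end `o`; by `hp` the choice does not
  -- matter.
  choose c o hco using hc
  have hcol' : ∀ (e : G.edgeSet) (v u : V), e.1 = s(v, u) →
      n (c e) v = u ∧ p (c e) (o e) = p (c e) v := by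
    intro e v u h
    rcases Sym2.eq_iff.1 (h.symm.trans (hco e)) with ⟨h1, h2⟩ | ⟨h1, h2⟩
    · rw [h1, h2]
      exact ⟨rfl, rfl⟩
    · rw [h1, h2, hnn, hp]
      exact ⟨rfl, rfl⟩
  have hcol : ∀ (v u : V) (h : G.Adj v u), n (c ⟨s(v, u), h⟩) v = u ∧
      p (c ⟨s(v, u), h⟩) (o ⟨s(v, u), h⟩) = p (c ⟨s(v, u), h⟩) v := fun v u h =>
    hcol' _ v u rfl
  -- The color is well defined on a simple graph because distinct colors lead from `v` to distinct
  -- neighbors.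
  have hcn : ∀ i v u (h : G.Adj v u), n i v = u → c ⟨s(v, u), h⟩ = i := fun i v u h hi =>
    hinj _ _ v ((hcol v u h).1.trans hi.symm)
  have hval : ∀ x y : ZMod 2, x ≠ y → |(x.val : ℤ) - y.val| = 1 := by decide
  refine ⟨
    { graph := G
      parity := ht
      height := fun v => (ht v).val
      color := c
      dash := fun e => p (c e) (o e)
      parity_ne := fun v u ⟨i, hi⟩ => by rw [← hi]; exact (hht i v).symm
      height_adj := fun v u ⟨i, hi⟩ => by rw [← hi]; exact hval _ _ (hht i v)
      color_regular := fun v i => by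
        refine ⟨⟨s(v, n i v), i, rfl⟩, ⟨by simp, hcn i v _ _ rfl⟩, ?_⟩
        rintro ⟨e, he⟩ ⟨hv, hi⟩
        obtain ⟨u, rfl⟩ := Sym2.mem_iff_exists.1 hv
        have := (hcol v u he).1
        rw [hi] at this
        exact Subtype.ext (congrArg (fun y => s(v, y)) this.symm)
      four_cycle := fun i j hij v => by
        have h3 : n j (n i (n j (n i v))) = v := by rw [hcomm j i, hnn, hnn]
        refine ⟨n i v, n j (n i v), n i (n j (n i v)), ⟨i, rfl⟩, ⟨j, rfl⟩, ⟨i, rfl⟩, ⟨j, h3⟩,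
          hcn _ _ _ _ rfl, hcn _ _ _ _ rfl, hcn _ _ _ _ rfl, hcn _ _ _ _ h3, ?_⟩
        rw [(hcol _ _ _).2, (hcol _ _ _).2, (hcol _ _ _).2, (hcol _ _ _).2,
          hcn _ _ _ _ rfl, hcn _ _ _ _ rfl, hcn _ _ _ _ rfl, hcn _ _ _ _ h3, ← hsum i j v hij,
          ← hcomm i j, hp, hcomm, hnn, hp] }, fun _ => rfl,
    fun i v => ⟨i, rfl⟩, fun v u h => hcol v u h⟩

end Adinkra

/-! ### The grading involution and homogeneous signed bases -/

namespace GrClMod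

variable {𝕜 : Type} [Field 𝕜] {N : ℕ}

/-- The involution of a graded module which is `1` on the even and `-1` on the odd part. -/
noncomputable def gradeInv (W : GrClMod.{w} 𝕜 N) : Module.End 𝕜 W.carrier :=
  LinearMap.ofIsCompl W.isCompl_gr (W.gr 0).subtype (-(W.gr 1).subtype)

theorem gradeInv_even (W : GrClMod.{w} 𝕜 N) {x : W.carrier} (hx : x ∈ W.gr 0) :
    W.gradeInv x = x :=
  LinearMap.ofIsCompl_apply_left W.isCompl_gr (⟨x, hx⟩ : W.gr 0)

theorem gradeInv_odd (W : GrClMod.{w} 𝕜 N) {x : W.carrier} (hx : x ∈ W.gr 1) :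
    W.gradeInv x = -x :=
  LinearMap.ofIsCompl_apply_right W.isCompl_gr (⟨x, hx⟩ : W.gr 1)

theorem gr_induction (W : GrClMod.{w} 𝕜 N) {P : W.carrier → Prop} (h0 : ∀ x ∈ W.gr 0, P x)
    (h1 : ∀ x ∈ W.gr 1, P x) (add : ∀ x y, P x → P y → P (x + y)) (x : W.carrier) : P x := by
  have hx : x ∈ W.gr 0 ⊔ W.gr 1 := by rw [iSup_gr]; trivial
  obtain ⟨y, hy, z, hz, rfl⟩ := Submodule.mem_sup.1 hx
  exact add _ _ (h0 y hy) (h1 z hz)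

theorem gen_smul_mem (W : GrClMod.{w} 𝕜 N) (i : Fin N) (j : ZMod 2) {x : W.carrier}
    (hx : x ∈ W.gr j) : Cl.gen 𝕜 N i • x ∈ W.gr (1 + j) :=
  W.smul_mem 1 j _ _ (CliffordAlgebra.ι_mem_evenOdd_one (qForm 𝕜 N) _) hx

theorem gradeInv_gradeInv (W : GrClMod.{w} 𝕜 N) (x : W.carrier) :
    W.gradeInv (W.gradeInv x) = x := by
  induction x using W.gr_induction with
  | h0 x hx => rw [W.gradeInv_even hx, W.gradeInv_even hx]
  | h1 x hx => rw [W.gradeInv_odd hx, map_neg, W.gradeInv_odd hx, neg_neg]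
  | add x y hx hy => rw [map_add, map_add, hx, hy]

theorem gradeInv_gen_smul (W : GrClMod.{w} 𝕜 N) (i : Fin N) (x : W.carrier) :
    W.gradeInv (Cl.gen 𝕜 N i • x) = -(Cl.gen 𝕜 N i • W.gradeInv x) := by
  induction x using W.gr_induction with
  | h0 x hx => rw [W.gradeInv_even hx, W.gradeInv_odd (W.gen_smul_mem i 0 hx)]
  | h1 x hx =>
    rw [W.gradeInv_odd hx, W.gradeInv_even (W.gen_smul_mem i 1 hx), smul_neg, neg_neg]
  | add x y hx hy => rw [smul_add, map_add, hx, hy, map_add, smul_add, neg_add]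

variable [CharZero 𝕜]

theorem mem_gr_zero_of_gradeInv (W : GrClMod.{w} 𝕜 N) {x : W.carrier} (h : W.gradeInv x = x) :
    x ∈ W.gr 0 := by
  have hx : x ∈ W.gr 0 ⊔ W.gr 1 := by rw [iSup_gr]; trivial
  obtain ⟨y, hy, z, hz, rfl⟩ := Submodule.mem_sup.1 hx
  rw [map_add, W.gradeInv_even hy, W.gradeInv_odd hz, add_right_inj, neg_eq_iff_add_eq_zero,
    ← two_smul 𝕜, smul_eq_zero] at h
  rwa [h.resolve_left two_ne_zero, add_zero]

theorem mem_gr_one_of_gradeInv (W : GrClMod.{w} 𝕜 N) {x : W.carrier} (h : W.gradeInv x = -x) :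
    x ∈ W.gr 1 := by
  have hx : x ∈ W.gr 0 ⊔ W.gr 1 := by rw [iSup_gr]; trivial
  obtain ⟨y, hy, z, hz, rfl⟩ := Submodule.mem_sup.1 hx
  rw [map_add, W.gradeInv_even hy, W.gradeInv_odd hz, neg_add, add_left_inj,
    eq_neg_iff_add_eq_zero, ← two_smul 𝕜, smul_eq_zero] at h
  rwa [h.resolve_left two_ne_zero, zero_add]

theorem gen_smul_gen_smul_self (W : GrClMod.{w} 𝕜 N) (i : Fin N) (x : W.carrier) :
    Cl.gen 𝕜 N i • Cl.gen 𝕜 N i • x = x := by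
  rw [← mul_smul, Cl.gen_mul_self, one_smul]

omit [CharZero 𝕜] in
theorem gen_smul_gen_smul_of_ne (W : GrClMod.{w} 𝕜 N) {i j : Fin N} (h : i ≠ j) (x : W.carrier) :
    Cl.gen 𝕜 N i • Cl.gen 𝕜 N j • x = -(Cl.gen 𝕜 N j • Cl.gen 𝕜 N i • x) := by
  have := W.gen_smul_gen_smul_add i j x
  simp [h] at this
  exact eq_neg_of_add_eq_zero_left this

/-- The generators of the Clifford algebra and the grading involution. -/
noncomputable def involution (W : GrClMod.{w} 𝕜 N) : Option (Fin N) → Module.End 𝕜 W.carrier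
  | none => W.gradeInv
  | some i => Algebra.lsmul 𝕜 𝕜 W.carrier (Cl.gen 𝕜 N i)

end GrClMod

open GrClMod in
/-- Over the reals every Clifford module has a homogeneous basis permuted up to signs by the
generators. -/
theorem GrClMod.exists_signed_basis {𝕜 : Type} [RCLike 𝕜] {N : ℕ} (hN : 0 < N)
    (hs : Function.Surjective (algebraMap ℝ 𝕜)) (W : GrClMod.{w} 𝕜 N) :
    ∃ (V : Type w) (_ : Fintype V) (b : Module.Basis V 𝕜 W.carrier) (ht : V → ZMod 2)
      (n : Fin N → V → V) (p : Fin N → V → ZMod 2),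
      (∀ v, b v ∈ W.gr (ht v)) ∧
      ∀ i v, Cl.gen 𝕜 N i • b v = (-1 : 𝕜) ^ (p i v).val • b (n i v) := by
  classical
  -- The grading involution `none` plays the role of `i₀`, so the basis vectors are homogeneous; any
  -- generator can serve as the involution anticommuting with it.
  obtain ⟨V, b, -, h0, h1⟩ := _root_.exists_signed_basis (a := W.involution) hs
    (by
      rintro (_ | i) x
      · exact W.gradeInv_gradeInv x
      · exact W.gen_smul_gen_smul_self i x)
    (by
      rintro (_ | i) (_ | j) hij x
      · exact absurd rfl hij
      · exact W.gradeInv_gen_smul j x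
      · exact neg_eq_iff_eq_neg.1 (W.gradeInv_gen_smul i x).symm
      · exact W.gen_smul_gen_smul_of_ne (fun h => hij (congrArg some h)) x)
    (i₀ := none) (i₁ := some ⟨0, hN⟩) (by simp)
  have hV : Finite V := Module.Finite.finite_basis b
  have h0' : ∀ v, ∃ t : ZMod 2, b v ∈ W.gr t := by
    intro v
    rcases h0 v with h | h
    · exact ⟨0, W.mem_gr_zero_of_gradeInv h⟩
    · exact ⟨1, W.mem_gr_one_of_gradeInv h⟩
  have h1' : ∀ (i : Fin N) v, ∃ (u : V) (q : ZMod 2),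
      Cl.gen 𝕜 N i • b v = (-1 : 𝕜) ^ q.val • b u := by
    intro i v
    obtain ⟨u, h | h⟩ := h1 (some i) v
    · exact ⟨u, 0, by simpa using! h⟩
    · exact ⟨u, 1, by simpa [ZMod.val_one] using! h⟩
  choose ht hht using h0'
  choose n p hnp using h1'
  exact ⟨V, Fintype.ofFinite V, b, ht, n, p, hht, hnp⟩

/-! ### Real Clifford modules are encoded by valises -/

theorem Module.Basis.eq_and_eq_of_smul_eq_smul {K E V : Type*} [Field K] [AddCommGroup E]
    [Module K E] (b : Module.Basis V K E) {c c' : K} {v v' : V} (hc : c ≠ 0)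
    (h : c • b v = c' • b v') : v = v' ∧ c = c' := by
  classical
  have h1 := congrArg (fun x => b.repr x v) h
  simp only [map_smul, Module.Basis.repr_self, Finsupp.smul_apply, Finsupp.single_apply,
    smul_eq_mul] at h1
  by_cases hv : v = v'
  · exact ⟨hv, by simpa [hv] using h1⟩
  · simp [hc, Ne.symm hv] at h1

theorem ZMod.neg_one_pow_val_add {K : Type*} [Field K] (a b : ZMod 2) :
    (-1 : K) ^ a.val * (-1) ^ b.val = (-1) ^ (a + b).val := by
  rw [ZMod.val_add, ← pow_add, ← neg_one_pow_eq_pow_mod_two]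

theorem ZMod.neg_one_pow_val_injective {K : Type*} [Field K] [CharZero K] {a b : ZMod 2}
    (h : (-1 : K) ^ a.val = (-1) ^ b.val) : a = b := by
  have key : ∀ c : ZMod 2, (-1 : K) ^ c.val = 1 → c = 0 := by
    intro c hc
    have : ∀ c : ZMod 2, c ≠ 0 → c.val = 1 := by decide
    by_contra h0
    rw [this c h0, pow_one] at hc
    exact absurd hc (by norm_num)
  have h2 : (-1 : K) ^ (a + b).val = 1 := by
    rw [← ZMod.neg_one_pow_val_add, h, ← pow_add, ← two_mul, pow_mul]; simp
  exact CharTwo.add_eq_zero.1 (key _ h2)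

/-- Evaluate the Clifford relations on a signed basis. Matching basis vectors gives the identities
between neighbor maps, and matching signs gives those between dashings. -/
theorem GrClMod.exists_adinkra {𝕜 : Type} [RCLike 𝕜] {N : ℕ} (hN : 0 < N)
    (hs : Function.Surjective (algebraMap ℝ 𝕜)) (W : GrClMod.{w} 𝕜 N) [Nontrivial W.carrier] :
    ∃ (V : Type w) (_ : Fintype V) (A : Adinkra V N),
      A.IsValise ∧ A.InHeights01 ∧ A.HasCliffordModule W := by
  obtain ⟨V, _, b, ht, n, p, hb, hnp⟩ := W.exists_signed_basis hN hs
  have hne : ∀ a : ZMod 2, (-1 : 𝕜) ^ a.val ≠ 0 := fun a => pow_ne_zero _ (by norm_num)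
  have h2 : ∀ i j v, Cl.gen 𝕜 N i • Cl.gen 𝕜 N j • b v =
      (-1 : 𝕜) ^ (p j v + p i (n j v)).val • b (n i (n j v)) := by
    intro i j v
    rw [hnp, ← algebraMap_smul (Cl 𝕜 N) ((-1 : 𝕜) ^ _), ← mul_smul, ← Algebra.commutes, mul_smul,
      hnp, algebraMap_smul, smul_smul, ZMod.neg_one_pow_val_add]
  have hsq : ∀ i v, n i (n i v) = v ∧ p i v + p i (n i v) = 0 := by
    intro i v
    have := h2 i i v
    rw [W.gen_smul_gen_smul_self] at this
    obtain ⟨h, h'⟩ := b.eq_and_eq_of_smul_eq_smul (hne _)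
      (this.symm.trans (by simp : b v = (-1 : 𝕜) ^ (0 : ZMod 2).val • b v))
    exact ⟨h, ZMod.neg_one_pow_val_injective h'⟩
  have hanti : ∀ i j v, i ≠ j → n i (n j v) = n j (n i v) ∧
      p j v + p i (n j v) = 1 + (p i v + p j (n i v)) := by
    intro i j v hij
    have := W.gen_smul_gen_smul_of_ne hij (b v)
    have hneg : ∀ a : ZMod 2, -(-1 : 𝕜) ^ a.val = (-1) ^ (1 + a).val := fun a => by
      rw [← ZMod.neg_one_pow_val_add, ZMod.val_one, pow_one, neg_one_mul]
    rw [h2, h2, ← neg_smul, hneg] at this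
    obtain ⟨h, h'⟩ := b.eq_and_eq_of_smul_eq_smul (hne _) this
    exact ⟨h, ZMod.neg_one_pow_val_injective h'⟩
  have hz : ∀ a : ZMod 2, a = 0 ∨ a = 1 := by decide
  have hht : ∀ i v, ht (n i v) ≠ ht v := by
    intro i v h
    have h1 := W.gen_smul_mem i _ (hb v)
    rw [hnp, Submodule.smul_mem_iff _ (hne _)] at h1
    have h2 := hb (n i v)
    rw [h] at h2
    have hd := W.isInternal.submodule_iSupIndep.pairwiseDisjoint
      (show 1 + ht v ≠ ht v by simp)
    -- Generators are odd, so equal parities would put a basis vector in both homogeneous parts.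
    exact b.ne_zero _ (Submodule.disjoint_def.1 hd _ h1 h2)
  have hp : ∀ i v, p i (n i v) = p i v := fun i v => (CharTwo.add_eq_zero.1 (hsq i v).2).symm
  obtain ⟨A, hA1, hA2, hA3⟩ := Adinkra.exists_of_nbr n p ht (fun i v => (hsq i v).1) hp hht
    (fun i j v h => by
      by_contra hij
      -- If two colors shared an edge, the two sign products would coincide, against
      -- anticommutation.
      have := (hanti i j v hij).2
      have e1 : p i (n j v) = p i v := by rw [← h, hp]
      have e2 : p j (n i v) = p j v := by rw [h, hp]
      rw [e1, e2, add_comm (p j v), right_eq_add] at this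
      exact one_ne_zero this)
    (fun i j v => by
      by_cases h : i = j
      · rw [h]
      · exact (hanti i j v h).1)
    (fun i j v hij => by
      have := (hanti i j v hij).2
      have key : ∀ a b c d : ZMod 2, a + b = 1 + (c + d) → c + d + b + a = 1 := by decide
      exact key _ _ _ _ this)
  have hval : ∀ x : ZMod 2, (x.val : ℤ) = 0 ∨ (x.val : ℤ) = 1 := by decide
  have h01 : A.InHeights01 := fun v => by rw [hA1]; exact hval _
  refine ⟨V, inferInstance, A, ⟨?_, ?_⟩, h01, b, fun v => ?_, fun v u h => ?_⟩
  · obtain ⟨v⟩ : Nonempty V := b.index_nonempty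
    refine ⟨(n ⟨0, hN⟩ v, v), A.height_adj _ _ (hA2 _ _)⟩
  · rintro _ ⟨⟨v, u⟩, rfl⟩
    rcases h01 v with h | h <;> rcases h01 u with h' | h' <;> simp [h, h']
  · rw [hA1]
    simpa using hb v
  · obtain ⟨h1, h2⟩ := hA3 v u h
    rw [hnp, h1, Adinkra.sign, h2]
    simp

theorem mainTheorem5 (𝕜 : Type) [RCLike 𝕜] (N : ℕ) (hN : 0 < N) :
    -- matrix factorization and quasi-isomorphism
    (∀ (V : Type w) [Fintype V] (A : Adinkra V N), A.IsValise → A.InHeights01 →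
      (IsMatrixFactorization (qPoly 𝕜 N) (A.blockMap 𝕜) ∧ IsLinearEnd (A.blockMap 𝕜)) ∧
      ∃ π : A.complex 𝕜 ⟶ (HomologicalComplex.single
          (ModuleCat (MvPolynomial (Fin N) 𝕜)) (ComplexShape.up ℤ) 0).obj
          (ModuleCat.of (MvPolynomial (Fin N) 𝕜) (A.coker 𝕜)),
        QuasiIso π ∧
        π.f 0 ≫ (HomologicalComplex.singleObjXSelf (ComplexShape.up ℤ) 0 _).hom =
          ModuleCat.ofHom (LinearMap.range (A.d 𝕜 (-1) 0)).mkQ) ∧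
    -- the correspondences
    ∃ (E : GrClMod.{w} 𝕜 N ≌ LinMCM.{w} 𝕜 N)
      (p : ∀ W : GrClMod.{w} 𝕜 N, (MvPolynomial (Fin N) 𝕜 ⊗[𝕜] W.gr 0) →ₛₗ[toY 𝕜 N]
        (E.functor.obj W).carrier),
      (∀ W : GrClMod.{w} 𝕜 N, W.IsCokernel (E.functor.obj W) (p W)) ∧
      (∀ (W W' : GrClMod.{w} 𝕜 N) (f : W ⟶ W') (x : W.gr 0),
        (E.functor.map f).toLin (p W (1 ⊗ₜ x)) =
          p W' (1 ⊗ₜ ⟨f.toLin x, f.map_gr 0 x x.2⟩)) ∧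
      (∀ (V : Type w) [Fintype V] (A : Adinkra V N), A.IsValise → A.InHeights01 →
        ∃ (M : LinMCM.{w} 𝕜 N) (W : GrClMod.{w} 𝕜 N),
          Nontrivial M.carrier ∧ A.HasCokernel M ∧ A.HasCliffordModule W ∧
          Nonempty (E.functor.obj W ≅ M)) ∧
      -- for `𝕜 = ℝ` every nonzero module comes from a valise Adinkra
      (Function.Surjective (algebraMap ℝ 𝕜) →
        (∀ M : LinMCM.{w} 𝕜 N, Nontrivial M.carrier →
          ∃ (V : Type w) (_ : Fintype V) (A : Adinkra V N),
            A.IsValise ∧ A.InHeights01 ∧ A.HasCokernel M) ∧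
        (∀ W : GrClMod.{w} 𝕜 N, Nontrivial W.carrier →
          ∃ (V : Type w) (_ : Fintype V) (A : Adinkra V N),
            A.IsValise ∧ A.InHeights01 ∧ A.HasCliffordModule W)) := by
  have := cokFunctor_isEquivalence.{w} (𝕜 := 𝕜) hN
  refine ⟨fun V _ A _ h01 => ⟨⟨A.isMatrixFactorization_blockMap h01, A.isLinearEnd_blockMap⟩,
    A.toCoker 𝕜, A.quasiIso_toCoker hN h01, A.toCoker_f_comp⟩,
    (GrClMod.cokFunctor.{w} 𝕜 N hN).asEquivalence, fun W => W.toCokY hN,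
    fun W => W.isCokernel_toCokY hN, ?_, ?_, fun hs => ⟨fun M hM => ?_, fun W hW => ?_⟩⟩
  · intro W W' f x
    rfl
  · intro V _ A hval h01
    obtain ⟨W, hW⟩ := A.exists_hasCliffordModule (𝕜 := 𝕜)
    refine ⟨W.toLinMCM hN, W, ?_, A.hasCokernel_of_isCokernel h01 hW (W.isCokernel_toCokY hN), hW,
      ⟨Iso.refl _⟩⟩
    obtain ⟨⟨v, u⟩, hvu⟩ := hval.1
    -- A vertex of height `0` makes `W₀`, and with it the cokernel, nonzero; without one, all
    -- heights would be `1` and none would differ by one.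
    have hv : ∃ v, A.height v = 0 := by
      by_contra! h
      have h1 := (h01 v).resolve_left (h v)
      have h2 := (h01 u).resolve_left (h u)
      simp [h1, h2] at hvu
    obtain ⟨v, hv⟩ := hv
    obtain ⟨b, hb, -⟩ := hW
    have hbv := hb v
    rw [hv, Int.cast_zero] at hbv
    refine ⟨W.toCok (1 ⊗ₜ ⟨b v, hbv⟩), 0, fun h => b.ne_zero v ?_⟩
    exact congrArg Subtype.val (W.toCok_one_tmul_eq_zero h)
  · obtain ⟨W, p, hp⟩ := M.exists_isCokernel hN
    have hW : Nontrivial W.carrier := by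
      by_contra h
      rw [not_nontrivial_iff_subsingleton] at h
      obtain ⟨m, hm⟩ := exists_ne (0 : M.carrier)
      obtain ⟨x, rfl⟩ := hp.surjective m
      exact hm (by rw [Subsingleton.elim x 0, map_zero])
    obtain ⟨V, _, A, hA, h01, hAW⟩ := W.exists_adinkra hN hs
    exact ⟨V, inferInstance, A, hA, h01, A.hasCokernel_of_isCokernel h01 hAW hp⟩
  · exact W.exists_adinkra hN hs
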